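/- Let $A_+,A_-\subset\mathbb Z$ be disjoint finite arithmetic progressions with the same common difference $m\ge 1$, $|A_\pm|\ge 2$. Put $A=A_+\cup A_-$, $d=|A|-2$ and $D=\max A-\min A-1$. Let $n\ge 1$ be coprime to the greatest common divisor of the differences $i-j$, $i,j\in A$. A *twisted $n$-gon* in $\mathbb{RP}^r$ is a sequence $(v_i\in\mathbb{RP}^r)_{i\in\mathbb Z}$ with $v_{i+n}=\phi(v_i)$ for all $i$, for some projective transformation $\phi$. Let $X$ be the space of projective equivalence classes of *generic* twisted $n$-gons in $\mathbb{RP}^d$: for every $k$, any $d+1$ of the $d+2$ points $v_{k+j}$, $j\in A$, are in general position. Let $Y$ be the space of projective equivalence classes of (nondegenerate) *$A$-corrugated* twisted $n$-gons in $\mathbb{RP}^D$: for every $k$, the points $w_{k+j}$, $j\in A$, lie in a plane of dimension $|A|-2$, any $|A|-1$ of them are in general position, and any $D+1$ consecutive vertices span $\mathbb{RP}^D$. Both spaces carry the quotient topology of vertex-wise convergence. The *pentagram map* sends $(v_k)$ to $(\tilde v_k)$, $\tilde v_k=\mathrm{span}\langle v_{k+j}\mid j\in A_+\rangle\cap \mathrm{span}\langle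 v_{k+j}\mid j\in A_-\rangle$; on polygons in $\mathbb{RP}^d$ it is the *bi-diagonal map*. An *operator associated with* $v$ is an $n$-periodic difference operator $\mathcal D=\sum_{j\in A}a^jT^j$, $(TV)_k=V_{k+1}$, for which no index $k$ has all $a^j_k$ zero, and which satisfies $\mathcal DV=0$ for some lift $V$ of $v$ with $V_{i+n}=MV_i$, $M$ an invertible matrix. With $\mathcal D_\pm=\sum_{j\in A_\pm}a^jT^j$, its *Lax operator* is $\mathcal L=\mathcal D_-^{-1}\mathcal D_+$, a formal series in $T$ with $n$-periodic coefficients and finitely many negative powers; it is considered up to conjugation by sequences of nonzero numbers $\beta$ with $\beta_{k+n}=z\beta_k$ for a nonzero constant $z$. Then $X\neq\emptyset$, and there is a map $F:X\to Y$ which is a finite ramified covering in the following sense: $F$ is continuous, and there is a dense open set $O\subset Y$ such that $F^{-1}(O)$ is dense in $X$ and $F$ is over $O$ a covering map with finite fibers of bounded cardinality (the number of sheets is locally constant on $O$; over the reals it may be $0$ on part of $O$). Moreover: 1. $F[v]=[w]$ if and only if $v$ is the image of $w$ under some projection $\mathbb{RP}^D\dashrightarrow\mathbb{RP}^d$ (induced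 by a surjective linear map and defined at all vertices of $w$). 2. $F$ is given by the Lax operator: if $F[v]=[w]$, then $v$ and $w$ have a common Lax operator up to conjugation as above; conversely, if $[w]\in O$ and $v$, $w$ have a common Lax operator up to conjugation, then $F[v]=[w]$. 3. $F$ intertwines the pentagram map on $A$-corrugated polygons with the bi-diagonal map: if $F[v]=[w]$ and the images $\tilde v$, $\tilde w$ of $v$, $w$ are again a generic and a (nondegenerate) $A$-corrugated polygon, then $F[\tilde v]=[\tilde w]$. The classes $[v]\in X$ for which this happens for $v$ and for some $w$ with $F[v]=[w]$ are dense in $X$, and the classes $[w]\in Y$ whose pentagram image $\tilde w$ is again a nondegenerate $A$-corrugated polygon are dense in $Y$. -/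

import Mathlib

open scoped LinearAlgebra.Projectivization

noncomputable section

namespace Pentagram

/-- The vector space whose projectivization is `ℝP^r`. -/
abbrev Vec (r : ℕ) : Type := Fin (r + 1) → ℝ

/-- Real projective space `ℝP^r`. -/
abbrev RP (r : ℕ) : Type := ℙ ℝ (Vec r)

/-- The quotient topology on `ℝP^r`, from nonzero vectors. -/
instance instTopologicalSpaceRP (r : ℕ) : TopologicalSpace (RP r) :=
  TopologicalSpace.coinduced
    (fun v : {v : Vec r // v ≠ 0} => Projectivization.mk ℝ v.1 v.2) inferInstance

/-- The projective transformation of `ℝP^r` induced by an invertible linear map. -/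
def projTransf {r : ℕ} (g : Vec r ≃ₗ[ℝ] Vec r) : RP r → RP r :=
  Projectivization.map g.toLinearMap g.injective

/-- `S` is a finite arithmetic progression with common difference `m`. -/
def IsArithProg (m : ℕ) (S : Finset ℤ) : Prop :=
  ∃ (a : ℤ) (l : ℕ), S = (Finset.range l).image (fun i : ℕ => a + (i : ℤ) * (m : ℤ))

/-! ### Polygons -/

/-- A bi-infinite sequence of points is a twisted `n`-gon if the shift by `n` is realized by a
projective transformation (the monodromy). -/
def IsTwisted {r : ℕ} (n : ℕ) (v : ℤ → RP r) : Prop :=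
  ∃ g : Vec r ≃ₗ[ℝ] Vec r, ∀ i : ℤ, v (i + n) = projTransf g (v i)

/-- For every `k`, any `|A| - 1` of the `|A|` points `v (k + j)`, `j ∈ A`, are in general
position. -/
def InGeneralPosition {r : ℕ} (A : Finset ℤ) (v : ℤ → RP r) : Prop :=
  ∀ k : ℤ, ∀ j₀ ∈ A,
    Projectivization.Independent (fun j : {j : ℤ // j ∈ A.erase j₀} => v (k + j.1))

/-- For every `k`, the `|A|` points `v (k + j)`, `j ∈ A`, lie in a projective plane of dimension
`|A| - 2`, that is, in a linear subspace of dimension `|A| - 1`. -/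
def IsCorrugated {r : ℕ} (A : Finset ℤ) (v : ℤ → RP r) : Prop :=
  ∀ k : ℤ, ∃ U : Submodule ℝ (Vec r), Module.finrank ℝ U + 1 = A.card ∧
    ∀ j ∈ A, (v (k + j)).submodule ≤ U

/-- Any `r + 1` consecutive vertices span `ℝP^r`. -/
def ConsecutiveSpan {r : ℕ} (v : ℤ → RP r) : Prop :=
  ∀ k : ℤ, Projectivization.Independent (fun i : Fin (r + 1) => v (k + ((i : ℕ) : ℤ)))

/-- Generic twisted `n`-gons in `ℝP^d` (used with `|A| = d + 2`), with the topology of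
vertex-wise convergence. -/
def GenericPolygon (n : ℕ) (A : Finset ℤ) (d : ℕ) : Type :=
  {v : ℤ → RP d // IsTwisted n v ∧ InGeneralPosition A v}

/-- (Nondegenerate) `A`-corrugated twisted `n`-gons in `ℝP^D`
(used with `D = max A - min A - 1`), with the topology of vertex-wise convergence. -/
def CorrugatedPolygon (n : ℕ) (A : Finset ℤ) (D : ℕ) : Type :=
  {w : ℤ → RP D // IsTwisted n w ∧ IsCorrugated A w ∧ InGeneralPosition A w ∧ ConsecutiveSpan w}

instance (n : ℕ) (A : Finset ℤ) (d : ℕ) : TopologicalSpace (GenericPolygon n A d) :=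
  inferInstanceAs (TopologicalSpace {v : ℤ → RP d // IsTwisted n v ∧ InGeneralPosition A v})

instance (n : ℕ) (A : Finset ℤ) (D : ℕ) : TopologicalSpace (CorrugatedPolygon n A D) :=
  inferInstanceAs (TopologicalSpace {w : ℤ → RP D //
    IsTwisted n w ∧ IsCorrugated A w ∧ InGeneralPosition A w ∧ ConsecutiveSpan w})

/-- Projective equivalence of sequences of points: one projective transformation maps one onto
the other, vertex by vertex. -/
def ProjEquiv {r : ℕ} (v v' : ℤ → RP r) : Prop :=
  ∃ g : Vec r ≃ₗ[ℝ] Vec r, ∀ i : ℤ, v' i = projTransf g (v i)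

theorem projEquiv_equivalence (r : ℕ) : Equivalence (ProjEquiv (r := r)) where
  refl v := ⟨LinearEquiv.refl ℝ _, fun i => by
    induction v i using Projectivization.ind with
    | h x hx => rfl⟩
  symm := by
    rintro v v' ⟨g, hg⟩
    refine ⟨g.symm, fun i => ?_⟩
    rw [hg i]
    induction v i using Projectivization.ind with
    | h x hx => simp [projTransf, Projectivization.map_mk]
  trans := by
    rintro v v' v'' ⟨g, hg⟩ ⟨h, hh⟩
    refine ⟨g.trans h, fun i => ?_⟩
    rw [hh i, hg i]
    induction v i using Projectivization.ind with
    | h x hx => simp [projTransf, Projectivization.map_mk]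

instance genericSetoid (n : ℕ) (A : Finset ℤ) (d : ℕ) : Setoid (GenericPolygon n A d) :=
  ⟨fun v v' => ProjEquiv v.1 v'.1, (projEquiv_equivalence d).comap Subtype.val⟩

instance corrugatedSetoid (n : ℕ) (A : Finset ℤ) (D : ℕ) : Setoid (CorrugatedPolygon n A D) :=
  ⟨fun v v' => ProjEquiv v.1 v'.1, (projEquiv_equivalence D).comap Subtype.val⟩

/-- Projective equivalence classes of generic twisted `n`-gons, with the quotient topology. -/
abbrev GenericClass (n : ℕ) (A : Finset ℤ) (d : ℕ) : Type :=
  Quotient (genericSetoid n A d)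

/-- Projective equivalence classes of `A`-corrugated twisted `n`-gons, with the quotient
topology. -/
abbrev CorrugatedClass (n : ℕ) (A : Finset ℤ) (D : ℕ) : Type :=
  Quotient (corrugatedSetoid n A D)

/-- The projective class of a generic polygon. -/
abbrev GenericPolygon.cls {n : ℕ} {A : Finset ℤ} {d : ℕ} (v : GenericPolygon n A d) :
    GenericClass n A d := Quotient.mk _ v

/-- The projective class of an `A`-corrugated polygon. -/
abbrev CorrugatedPolygon.cls {n : ℕ} {A : Finset ℤ} {D : ℕ} (w : CorrugatedPolygon n A D) :
    CorrugatedClass n A D := Quotient.mk _ w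

/-- `v'` is the image of `v` under the pentagram map of `Ap`, `Am`: the vertex `v' k` is the
intersection of the spans of `v (k + j)`, `j ∈ Ap`, and of `v (k + j)`, `j ∈ Am`. On polygons in
`ℝP^d` this is the bi-diagonal map, on corrugated polygons it is the corrugated pentagram map. -/
def IsPentagramImage {r : ℕ} (Ap Am : Finset ℤ) (v v' : ℤ → RP r) : Prop :=
  ∀ k : ℤ, (v' k).submodule =
    (⨆ j ∈ Ap, (v (k + j)).submodule) ⊓ (⨆ j ∈ Am, (v (k + j)).submodule)

/-- `v` is the image of `w` under a projection `ℝP^D ⇢ ℝP^d`, defined at all vertices of `w`. -/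
def IsProjectionOf {D d : ℕ} (w : ℤ → RP D) (v : ℤ → RP d) : Prop :=
  ∃ P : Vec D →ₗ[ℝ] Vec d, Function.Surjective P ∧
    ∀ i : ℤ, (v i).submodule = (w i).submodule.map P

/-! ### Difference operators and Lax operators

A family `a : ℤ → ℤ → ℝ` encodes the formal series `∑ⱼ aʲ Tʲ`, where `a j` is the scalar sequence
`aʲ`, acting by `(aʲ Tʲ V)ₖ = a j k • V (k + j)`. -/

/-- `n`-periodic pseudo-difference operators: formal series in `T` with `n`-periodic
coefficients and with only finitely many negative powers. -/
def IsPseudoDiff (n : ℕ) (a : ℤ → ℤ → ℝ) : Prop :=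
  (∃ N : ℤ, ∀ j < N, ∀ k, a j k = 0) ∧ ∀ j k, a j (k + n) = a j k

/-- The product `(∑ᵢ aⁱ Tⁱ)(∑ₗ bˡ Tˡ) = ∑ aⁱ (Tⁱ bˡ) Tⁱ⁺ˡ`. For series with finitely many negative
powers the sum below has finitely many nonzero terms. -/
def opMul (a b : ℤ → ℤ → ℝ) : ℤ → ℤ → ℝ :=
  fun j k => ∑ᶠ i : ℤ, a i k * b (j - i) (k + i)

/-- The identity operator. -/
def opOne : ℤ → ℤ → ℝ := fun j _ => if j = 0 then 1 else 0

/-- The part of an operator that is supported on the powers in `S`. -/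
def opPart (S : Finset ℤ) (a : ℤ → ℤ → ℝ) : ℤ → ℤ → ℝ :=
  fun j k => if j ∈ S then a j k else 0

/-- `V` is a quasi-periodic lift of the sequence `v` of points. -/
def IsQuasiPeriodicLift {r : ℕ} (n : ℕ) (v : ℤ → RP r) (V : ℤ → Vec r) : Prop :=
  (∀ i : ℤ, ∃ h : V i ≠ 0, Projectivization.mk ℝ (V i) h = v i) ∧
    ∃ M : Vec r ≃ₗ[ℝ] Vec r, ∀ i : ℤ, V (i + n) = M (V i)

/-- `a` encodes an `n`-periodic difference operator `∑_{j ∈ A} aʲ Tʲ` associated with the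
polygon `v`: it annihilates a quasi-periodic lift of `v` by a nontrivial relation at each index. -/
def IsAssociatedOperator {r : ℕ} (n : ℕ) (A : Finset ℤ) (v : ℤ → RP r) (a : ℤ → ℤ → ℝ) : Prop :=
  (∀ j ∉ A, ∀ k, a j k = 0) ∧ (∀ j k, a j (k + n) = a j k) ∧ (∀ k, ∃ j, a j k ≠ 0) ∧
    ∃ V : ℤ → Vec r, IsQuasiPeriodicLift n v V ∧
      ∀ k : ℤ, ∑ j ∈ A, a j k • V (k + j) = 0

/-- `L = 𝓓₋⁻¹ 𝓓₊`, where `𝓓 = 𝓓₊ + 𝓓₋` is an operator associated with the polygon `v` and the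
inverse is taken among `n`-periodic pseudo-difference operators. -/
def IsLaxOperator {r : ℕ} (n : ℕ) (Ap Am : Finset ℤ) (v : ℤ → RP r) (L : ℤ → ℤ → ℝ) : Prop :=
  ∃ a I : ℤ → ℤ → ℝ, IsAssociatedOperator n (Ap ∪ Am) v a ∧ IsPseudoDiff n I ∧
    opMul (opPart Am a) I = opOne ∧ opMul I (opPart Am a) = opOne ∧
    L = opMul I (opPart Ap a)

/-- `L' = β L β⁻¹` for a quasi-periodic sequence `β` of nonzero real numbers. -/
def ScalarConj (n : ℕ) (L L' : ℤ → ℤ → ℝ) : Prop :=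
  ∃ (β : ℤ → ℝ) (z : ℝ), z ≠ 0 ∧ (∀ k, β k ≠ 0) ∧ (∀ k, β (k + n) = z * β k) ∧
    ∀ j k, L' j k = β k * L j k / β (k + j)

/-- The polygons `v` and `w` have the same Lax operator up to conjugation by scalar sequences. -/
def SameLax {r s : ℕ} (n : ℕ) (Ap Am : Finset ℤ) (v : ℤ → RP r) (w : ℤ → RP s) : Prop :=
  ∃ L L' : ℤ → ℤ → ℝ, IsLaxOperator n Ap Am v L ∧ IsLaxOperator n Ap Am w L' ∧ ScalarConj n L L'

/-! ### Ramified coverings -/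

/-- `F` is a finite ramified covering that is unramified over the dense open set `O`: `F` is
continuous, the part of the source over `O` is dense, and over `O` the map is a covering map with
finite fibers of bounded cardinality. -/
def IsFiniteRamifiedCovering {X Y : Type*} [TopologicalSpace X] [TopologicalSpace Y]
    (F : X → Y) (O : Set Y) : Prop :=
  Continuous F ∧ IsOpen O ∧ Dense O ∧ Dense (F ⁻¹' O) ∧ IsCoveringMapOn F O ∧
    ∃ N : ℕ, ∀ y ∈ O, (F ⁻¹' {y}).encard ≤ N

end Pentagram

end

open scoped LinearAlgebra.Projectivization
open Filter Topology

noncomputable section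

namespace Pentagram

/-! ### Points of projective space and their lifts -/

/-! The map F. The d + 2 vectors lifting the points v_{k+j}, j ∈ A, satisfy one linear relation,
unique up to scale and without zero coefficients. For all k together these relations form a
difference operator 𝓓 of order hi - lo = D + 1, so its solutions form a space of dimension D + 1.
The fundamental solution W of 𝓓 with values in ℝ^(D+1) is a nondegenerate corrugated polygon, and
every other solution, in particular the lift of v, is a linear image of W. Conversely, the relations
of a corrugated polygon over v are those of v (`Rel.of_map`), so it is unique up to projective
equivalence (`IsProjectionOf.projEquiv`). This gives `corrugation` and property 1. Property 3
follows because the pentagram image is the class of 𝓓₊V, and 𝓓₊ commutes with linear maps.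

The covering. Let M be a monodromy of W. Polygons over [W] come from surjections P with P M = g P,
that is, from M-invariant subspaces, except that the monodromy is only defined up to factors that
are periodic modulo the gcd G of the differences in A. Since n is coprime to G, two normal forms of
the monodromy suffice, one for each sign of a norm. If the discriminant of M is nonzero, an
invariant subspace is determined by a set of eigenvalues, so fibers are finite (`encard_fiber_le`);
and the Sylvester equation is solvable, so invariant projections persist under perturbation and F is
open there (`nhds_le_map_corrugation`). An open map with bounded finite fibers on a Hausdorff space
is a covering where the fiber cardinality is locally constant, which is a dense open set
(`exists_isFiniteRamifiedCovering`).

The Lax operator. One operator annihilates lifts of both v and W, hence a common Lax operator. In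
the other direction, equal Lax operators give R with R 𝓔₊ = 𝓓₊ and R 𝓔₋ = 𝓓₋, after a scalar
conjugation. If 𝓔₊ and 𝓔₋ are coprime, in the sense of a resultant-like linear system (`Cop`), then
R has order zero, so the two operators agree up to scalars (`corrugation_of_sameLax`).

Density. It is enough to have one model with all the nondegeneracy properties. It is an operator
with constant coefficients whose polynomial has d + 1 positive roots, roots with distinct n-th
powers, and coprime parts (`exists_isModelOp`); Descartes' rule of signs gives general position. An
arbitrary polygon is joined to the model by a path along which every condition is the nonvanishing
of a meromorphic function of t, nonzero at the model; hence it holds arbitrarily near the polygon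
(`dense_generic`, `dense_corrugated`). -/

/-- The point of `ℝP^r` with homogeneous coordinates `x` (a default value if `x = 0`). -/
def pt {r : ℕ} (x : Vec r) : RP r :=
  if h : x ≠ 0 then Projectivization.mk ℝ x h
  else Projectivization.mk ℝ (fun _ => 1) (fun h0 => one_ne_zero (congrFun h0 0))

theorem pt_eq_mk {r : ℕ} {x : Vec r} (h : x ≠ 0) : pt x = Projectivization.mk ℝ x h := by
  simp [pt, h]

theorem pt_eq_pt_iff {r : ℕ} {x y : Vec r} (hx : x ≠ 0) (hy : y ≠ 0) :
    pt x = pt y ↔ ∃ c : ℝ, c ≠ 0 ∧ x = c • y := by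
  rw [pt_eq_mk hx, pt_eq_mk hy, Projectivization.mk_eq_mk_iff']
  constructor
  · rintro ⟨c, hc⟩
    refine ⟨c, ?_, hc.symm⟩
    rintro rfl
    exact hx (by rw [← hc, zero_smul])
  · rintro ⟨c, -, hc⟩
    exact ⟨c, hc.symm⟩

theorem pt_smul {r : ℕ} {x : Vec r} {c : ℝ} (hc : c ≠ 0) (hx : x ≠ 0) : pt (c • x) = pt x :=
  (pt_eq_pt_iff (smul_ne_zero hc hx) hx).2 ⟨c, hc, rfl⟩

theorem submodule_pt {r : ℕ} {x : Vec r} (hx : x ≠ 0) : (pt x).submodule = Submodule.span ℝ {x} := by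
  rw [pt_eq_mk hx, Projectivization.submodule_mk]

theorem projTransf_pt {r : ℕ} (g : Vec r ≃ₗ[ℝ] Vec r) {x : Vec r} (hx : x ≠ 0) :
    projTransf g (pt x) = pt (g x) := by
  rw [pt_eq_mk hx, pt_eq_mk (g.map_ne_zero_iff.2 hx), projTransf, Projectivization.map_mk]
  rfl

theorem exists_pt {r : ℕ} (p : RP r) : ∃ x : Vec r, x ≠ 0 ∧ pt x = p :=
  ⟨p.rep, p.rep_nonzero, by rw [pt_eq_mk p.rep_nonzero, p.mk_rep]⟩

/-- The saturation of an open set of nonzero vectors is a union of its multiples by nonzero scalars,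
hence open. Continuity at a point of `RP r` can therefore be tested at a vector above it. -/
theorem isOpenQuotientMap_mk (r : ℕ) :
    IsOpenQuotientMap (fun x : {x : Vec r // x ≠ 0} => Projectivization.mk ℝ x.1 x.2) := by
  have hq : IsQuotientMap (fun x : {x : Vec r // x ≠ 0} => Projectivization.mk ℝ x.1 x.2) := by
    refine ⟨⟨rfl⟩, fun p => ?_⟩
    exact ⟨⟨p.rep, p.rep_nonzero⟩, p.mk_rep⟩
  refine ⟨hq.surjective, hq.continuous, fun U hU => ?_⟩
  rw [← hq.isOpen_preimage, isOpen_iff_mem_nhds]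
  rintro x ⟨y, hyU, hxy⟩
  obtain ⟨c, hc, hyx⟩ := (pt_eq_pt_iff y.2 x.2).1 (by rw [pt_eq_mk, pt_eq_mk]; exact hxy)
  have hcont : Continuous fun z : {x : Vec r // x ≠ 0} =>
      (⟨c • z.1, smul_ne_zero hc z.2⟩ : {x : Vec r // x ≠ 0}) := by fun_prop
  have hmem : ∀ᶠ z in 𝓝 x, (⟨c • z.1, smul_ne_zero hc z.2⟩ : {x : Vec r // x ≠ 0}) ∈ U := by
    apply hcont.continuousAt.eventually_mem
    apply hU.mem_nhds
    convert hyU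
    exact hyx.symm
  filter_upwards [hmem] with z hz
  refine ⟨_, hz, ?_⟩
  have := pt_smul hc z.2
  rwa [pt_eq_mk (smul_ne_zero hc z.2), pt_eq_mk z.2] at this

theorem continuousAt_pt {r : ℕ} {x : Vec r} (hx : x ≠ 0) : ContinuousAt pt x := by
  have h : ContinuousAt (fun y : {y : Vec r // y ≠ 0} => pt y.1) ⟨x, hx⟩ := by
    have : (fun y : {y : Vec r // y ≠ 0} => pt y.1) =
        fun y => Projectivization.mk ℝ y.1 y.2 := by
      ext1 y; exact pt_eq_mk y.2
    rw [this]
    exact (isOpenQuotientMap_mk r).continuous.continuousAt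
  have ho : IsOpen {y : Vec r | y ≠ 0} := isOpen_ne
  exact (ho.isOpenEmbedding_subtypeVal.continuousAt_iff (g := pt) (x := ⟨x, hx⟩)).1 h

/-- Representatives are normalized by x₀ · x = x₀ · x₀ where x₀ · x ≠ 0 and are arbitrary elsewhere;
only continuity at one point is needed. -/
theorem exists_section {r : ℕ} {x₀ : Vec r} (hx₀ : x₀ ≠ 0) :
    ∃ s : RP r → Vec r, (∀ p, s p ≠ 0 ∧ pt (s p) = p) ∧ ContinuousAt s (pt x₀) ∧
      s (pt x₀) = x₀ := by
  classical
  have h0 : x₀ ⬝ᵥ x₀ ≠ 0 := by rwa [ne_eq, dotProduct_self_eq_zero]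
  let s : RP r → Vec r := fun p =>
    if x₀ ⬝ᵥ p.rep ≠ 0 then ((x₀ ⬝ᵥ x₀) / (x₀ ⬝ᵥ p.rep)) • p.rep else p.rep
  have hs : ∀ p, s p ≠ 0 ∧ pt (s p) = p := by
    intro p
    have hp : pt p.rep = p := by rw [pt_eq_mk p.rep_nonzero, p.mk_rep]
    by_cases h : x₀ ⬝ᵥ p.rep = 0
    · simp [s, h, p.rep_nonzero, hp]
    · have hc : (x₀ ⬝ᵥ x₀) / (x₀ ⬝ᵥ p.rep) ≠ 0 := div_ne_zero h0 h
      simp only [s, ne_eq, h, not_false_eq_true, if_true]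
      exact ⟨smul_ne_zero hc p.rep_nonzero, by rw [pt_smul hc p.rep_nonzero, hp]⟩
  have hval : ∀ x : Vec r, x₀ ⬝ᵥ x ≠ 0 → s (pt x) = ((x₀ ⬝ᵥ x₀) / (x₀ ⬝ᵥ x)) • x := by
    intro x hx
    have hx0 : x ≠ 0 := by rintro rfl; simp at hx
    obtain ⟨c, hc, h⟩ := (pt_eq_pt_iff (pt x).rep_nonzero hx0).1 (by
      rw [pt_eq_mk (pt x).rep_nonzero, (pt x).mk_rep])
    have h2 : x₀ ⬝ᵥ (pt x).rep = c * (x₀ ⬝ᵥ x) := by rw [h, dotProduct_smul, smul_eq_mul]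
    have h3 : x₀ ⬝ᵥ (pt x).rep ≠ 0 := by rw [h2]; exact mul_ne_zero hc hx
    simp only [s, ne_eq, h3, not_false_eq_true, if_true]
    rw [h2, h, smul_smul]
    congr 1
    field_simp
  refine ⟨s, hs, ?_, ?_⟩
  · rw [pt_eq_mk hx₀]
    refine ((isOpenQuotientMap_mk r).continuousAt_comp_iff (x := ⟨x₀, hx₀⟩)).1 ?_
    have hcd : Continuous fun x : {x : Vec r // x ≠ 0} => x₀ ⬝ᵥ x.1 := by
      exact continuous_finsetSum _ fun i _ =>
        continuous_const.mul ((continuous_apply i).comp continuous_subtype_val)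
    have hev : ∀ᶠ x : {x : Vec r // x ≠ 0} in 𝓝 ⟨x₀, hx₀⟩, x₀ ⬝ᵥ x.1 ≠ 0 :=
      hcd.continuousAt.eventually_ne h0
    have hc : ContinuousAt (fun x : {x : Vec r // x ≠ 0} => ((x₀ ⬝ᵥ x₀) / (x₀ ⬝ᵥ x.1)) • x.1)
        ⟨x₀, hx₀⟩ :=
      (continuousAt_const.div hcd.continuousAt h0).smul continuous_subtype_val.continuousAt
    refine hc.congr ?_
    filter_upwards [hev] with x hx
    simp only [Function.comp]
    rw [← pt_eq_mk, hval _ hx]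
  · rw [hval _ h0, div_self h0, one_smul]

/-- `V` is a lift of the sequence `v` of points. -/
def IsLift {r : ℕ} (V : ℤ → Vec r) (v : ℤ → RP r) : Prop := ∀ i, V i ≠ 0 ∧ pt (V i) = v i

theorem exists_isLift {r : ℕ} (v : ℤ → RP r) : ∃ V, IsLift V v := by
  choose V hV using fun i => exists_pt (v i)
  exact ⟨V, hV⟩

theorem isLift_pt {r : ℕ} {V : ℤ → Vec r} (hV : ∀ i, V i ≠ 0) : IsLift V (fun i => pt (V i)) :=
  fun i => ⟨hV i, rfl⟩

theorem IsLift.smul {r : ℕ} {V : ℤ → Vec r} {v : ℤ → RP r} (h : IsLift V v) {β : ℤ → ℝ}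
    (hβ : ∀ i, β i ≠ 0) : IsLift (fun i => β i • V i) v :=
  fun i => ⟨smul_ne_zero (hβ i) (h i).1, by rw [pt_smul (hβ i) (h i).1, (h i).2]⟩

theorem IsLift.map {r : ℕ} {V : ℤ → Vec r} {v : ℤ → RP r} (h : IsLift V v)
    (g : Vec r ≃ₗ[ℝ] Vec r) : IsLift (fun i => g (V i)) (fun i => projTransf g (v i)) :=
  fun i => ⟨g.map_ne_zero_iff.2 (h i).1, by
    show pt (g (V i)) = projTransf g (v i)
    rw [← (h i).2, projTransf_pt g (h i).1]⟩

theorem IsLift.exists_smul {r : ℕ} {V V' : ℤ → Vec r} {v : ℤ → RP r} (h : IsLift V v)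
    (h' : IsLift V' v) : ∃ β : ℤ → ℝ, (∀ i, β i ≠ 0) ∧ ∀ i, V' i = β i • V i := by
  have : ∀ i, ∃ c : ℝ, c ≠ 0 ∧ V' i = c • V i := fun i =>
    (pt_eq_pt_iff (h' i).1 (h i).1).1 ((h' i).2.trans (h i).2.symm)
  choose β hβ using this
  exact ⟨β, fun i => (hβ i).1, fun i => (hβ i).2⟩

theorem independent_iff_of_isLift {r : ℕ} {V : ℤ → Vec r} {v : ℤ → RP r} (h : IsLift V v)
    {ι : Type*} (f : ι → ℤ) :
    Projectivization.Independent (fun i => v (f i)) ↔ LinearIndependent ℝ (fun i => V (f i)) := by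
  constructor
  · intro hi
    rw [Projectivization.independent_iff] at hi
    have : ∀ i, ∃ c : ℝ, c ≠ 0 ∧ V (f i) = c • (v (f i)).rep := fun i =>
      (pt_eq_pt_iff (h _).1 (v (f i)).rep_nonzero).1 (by
        rw [(h _).2, pt_eq_mk (v (f i)).rep_nonzero, (v (f i)).mk_rep])
    choose c hc hV using this
    have := hi.units_smul (fun i => Units.mk0 (c i) (hc i))
    convert! this using 1
    ext1 i
    rw [hV]; rfl
  · intro hi
    have := Projectivization.Independent.mk _ (fun i => (h (f i)).1) hi
    convert this using 2 with i
    exact (h (f i)).2.symm.trans (pt_eq_mk _)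

/-- Any `|A| - 1` of the vectors `V (k + j)`, `j ∈ A`, are independent. -/
def GenPos {E : Type*} [AddCommGroup E] [Module ℝ E] (A : Finset ℤ) (V : ℤ → E) (k : ℤ) : Prop :=
  ∀ j₀ ∈ A, LinearIndependent ℝ (fun j : {j : ℤ // j ∈ A.erase j₀} => V (k + j.1))

theorem inGeneralPosition_iff {r : ℕ} {V : ℤ → Vec r} {v : ℤ → RP r} (h : IsLift V v)
    {A : Finset ℤ} : InGeneralPosition A v ↔ ∀ k, GenPos A V k := by
  refine forall_congr' fun k => forall₂_congr fun j₀ _ => ?_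
  exact independent_iff_of_isLift h (fun j : {j : ℤ // j ∈ A.erase j₀} => k + j.1)

theorem consecutiveSpan_iff {r : ℕ} {V : ℤ → Vec r} {v : ℤ → RP r} (h : IsLift V v) :
    ConsecutiveSpan v ↔
      ∀ k : ℤ, LinearIndependent ℝ (fun i : Fin (r + 1) => V (k + ((i : ℕ) : ℤ))) :=
  forall_congr' fun k => independent_iff_of_isLift h (fun i : Fin (r + 1) => k + ((i : ℕ) : ℤ))

theorem isCorrugated_iff {r : ℕ} {V : ℤ → Vec r} {v : ℤ → RP r} (h : IsLift V v)
    {A : Finset ℤ} : IsCorrugated A v ↔ ∀ k : ℤ, ∃ U : Submodule ℝ (Vec r),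
      Module.finrank ℝ U + 1 = A.card ∧ ∀ j ∈ A, V (k + j) ∈ U := by
  refine forall_congr' fun k => exists_congr fun U => and_congr_right fun _ =>
    forall₂_congr fun j _ => ?_
  rw [← (h (k + j)).2, submodule_pt (h _).1, Submodule.span_singleton_le_iff_mem]

theorem projEquiv_iff {r : ℕ} {V V' : ℤ → Vec r} {v v' : ℤ → RP r} (h : IsLift V v)
    (h' : IsLift V' v') : ProjEquiv v v' ↔
      ∃ g : Vec r ≃ₗ[ℝ] Vec r, ∀ i, ∃ c : ℝ, c ≠ 0 ∧ V' i = c • g (V i) := by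
  refine exists_congr fun g => forall_congr' fun i => ?_
  rw [← (h' i).2, ← (h i).2, projTransf_pt g (h i).1,
    pt_eq_pt_iff (h' i).1 (g.map_ne_zero_iff.2 (h i).1)]

theorem isTwisted_iff_projEquiv {r n : ℕ} {v : ℤ → RP r} :
    IsTwisted n v ↔ ProjEquiv v (fun i => v (i + n)) := Iff.rfl

theorem isTwisted_iff {r n : ℕ} {V : ℤ → Vec r} {v : ℤ → RP r} (h : IsLift V v) :
    IsTwisted n v ↔
      ∃ g : Vec r ≃ₗ[ℝ] Vec r, ∀ i, ∃ c : ℝ, c ≠ 0 ∧ V (i + n) = c • g (V i) :=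
  isTwisted_iff_projEquiv.trans (projEquiv_iff h (fun i => h (i + n)))

theorem isProjectionOf_iff {D d : ℕ} {W : ℤ → Vec D} {w : ℤ → RP D} {V : ℤ → Vec d}
    {v : ℤ → RP d} (hW : IsLift W w) (hV : IsLift V v) : IsProjectionOf w v ↔
      ∃ P : Vec D →ₗ[ℝ] Vec d, Function.Surjective P ∧
        ∀ i, ∃ c : ℝ, c ≠ 0 ∧ V i = c • P (W i) := by
  refine exists_congr fun P => and_congr_right fun _ => forall_congr' fun i => ?_
  rw [← (hW i).2, ← (hV i).2, submodule_pt (hW i).1, submodule_pt (hV i).1, Submodule.map_span,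
    Set.image_singleton, Submodule.span_singleton_eq_span_singleton]
  constructor
  · rintro ⟨z, hz⟩
    refine ⟨(z⁻¹ : ℝˣ), Units.ne_zero _, ?_⟩
    rw [← hz, Units.smul_def, smul_smul, Units.inv_mul, one_smul]
  · rintro ⟨c, hc, h⟩
    refine ⟨Units.mk0 c⁻¹ (inv_ne_zero hc), ?_⟩
    rw [h, Units.smul_def, smul_smul, Units.val_mk0, inv_mul_cancel₀ hc, one_smul]

/-! ### Invariance of the conditions on polygons under projective equivalence. -/

section Invariance

variable {r : ℕ} {v v' : ℤ → RP r}

theorem ProjEquiv.exists_isLift (h : ProjEquiv v v') {V : ℤ → Vec r} (hV : IsLift V v) :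
    ∃ g : Vec r ≃ₗ[ℝ] Vec r, IsLift (fun i => g (V i)) v' := by
  obtain ⟨g, hg⟩ := h
  refine ⟨g, ?_⟩
  have := hV.map g
  rwa [← (funext hg : v' = _)] at this

theorem ProjEquiv.isTwisted {n : ℕ} (h : ProjEquiv v v') (hv : IsTwisted n v) :
    IsTwisted n v' := by
  rw [isTwisted_iff_projEquiv] at *
  have he := projEquiv_equivalence r
  refine he.trans (he.trans (he.symm h) hv) ?_
  obtain ⟨g, hg⟩ := h
  exact ⟨g, fun i => hg _⟩

theorem ProjEquiv.inGeneralPosition {A : Finset ℤ} (h : ProjEquiv v v')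
    (hv : InGeneralPosition A v) : InGeneralPosition A v' := by
  obtain ⟨V, hV⟩ := Pentagram.exists_isLift v
  obtain ⟨g, hg⟩ := h.exists_isLift hV
  rw [inGeneralPosition_iff hV] at hv
  rw [inGeneralPosition_iff hg]
  exact fun k j₀ hj₀ => (hv k j₀ hj₀).map' g.toLinearMap g.ker

theorem ProjEquiv.consecutiveSpan (h : ProjEquiv v v') (hv : ConsecutiveSpan v) :
    ConsecutiveSpan v' := by
  obtain ⟨V, hV⟩ := Pentagram.exists_isLift v
  obtain ⟨g, hg⟩ := h.exists_isLift hV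
  rw [consecutiveSpan_iff hV] at hv
  rw [consecutiveSpan_iff hg]
  exact fun k => (hv k).map' g.toLinearMap g.ker

theorem ProjEquiv.isCorrugated {A : Finset ℤ} (h : ProjEquiv v v') (hv : IsCorrugated A v) :
    IsCorrugated A v' := by
  obtain ⟨V, hV⟩ := Pentagram.exists_isLift v
  obtain ⟨g, hg⟩ := h.exists_isLift hV
  rw [isCorrugated_iff hV] at hv
  rw [isCorrugated_iff hg]
  intro k
  obtain ⟨U, hU, hm⟩ := hv k
  refine ⟨U.map g.toLinearMap, ?_, fun j hj => Submodule.mem_map_of_mem (hm j hj)⟩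
  rw [← hU, LinearEquiv.finrank_map_eq g U]

end Invariance

theorem continuous_projTransf {r : ℕ} (g : Vec r ≃ₗ[ℝ] Vec r) : Continuous (projTransf g) := by
  rw [(isOpenQuotientMap_mk r).isQuotientMap.continuous_iff, continuous_iff_continuousAt]
  rintro ⟨x, hx⟩
  have h : ContinuousAt (fun y : {y : Vec r // y ≠ 0} => pt (g y.1)) ⟨x, hx⟩ := by
    have hg : Continuous g := LinearMap.continuous_of_finiteDimensional g.toLinearMap
    exact (continuousAt_pt (g.map_ne_zero_iff.2 hx)).comp_of_eq
      (hg.comp continuous_subtype_val).continuousAt rfl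
  convert h using 1
  ext1 y
  rw [Function.comp, ← pt_eq_mk, projTransf_pt g y.2]

/-- The classes of an invariant set of sequences modulo projective equivalence. -/
theorem isOpenQuotientMap_quotientMk {r : ℕ} {p : (ℤ → RP r) → Prop}
    (hp : ∀ v v', ProjEquiv v v' → p v → p v') (s : Setoid {v // p v})
    (hs : ∀ v v' : {v // p v}, s v v' ↔ ProjEquiv v.1 v'.1) :
    IsOpenQuotientMap (Quotient.mk s) := by
  refine ⟨Quotient.mk_surjective, continuous_quotient_mk', fun U hU => ?_⟩
  rw [← isQuotientMap_quotient_mk'.isOpen_preimage, isOpen_iff_mem_nhds]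
  rintro v ⟨u, huU, huv⟩
  -- The fixed transformation `g` takes `v` to `u ∈ U`, and by continuity it takes a neighbourhood
  -- of `v` into `U`.
  obtain ⟨g, hg⟩ := (projEquiv_equivalence r).symm ((hs _ _).1 (Quotient.exact huv))
  have hgp : ∀ x : {v // p v}, p fun i => projTransf g (x.1 i) := fun x =>
    hp x.1 _ ⟨g, fun i => rfl⟩ x.2
  have hcont : Continuous fun x : {v // p v} =>
      (⟨fun i => projTransf g (x.1 i), hgp x⟩ : {v // p v}) := by
    refine Continuous.subtype_mk (continuous_pi fun i => ?_) _
    exact (continuous_projTransf g).comp ((continuous_apply i).comp continuous_subtype_val)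
  have hmem : ∀ᶠ x in 𝓝 v, (⟨fun i => projTransf g (x.1 i), hgp x⟩ : {v // p v}) ∈ U := by
    apply hcont.continuousAt.eventually_mem
    apply hU.mem_nhds
    convert huU
    exact (hg _).symm
  filter_upwards [hmem] with x hx
  refine ⟨_, hx, ?_⟩
  exact Quotient.sound ((hs _ _).2 ((projEquiv_equivalence r).symm ⟨g, fun i => rfl⟩))

theorem isOpenQuotientMap_genericCls (n : ℕ) (A : Finset ℤ) (d : ℕ) :
    IsOpenQuotientMap (GenericPolygon.cls (n := n) (A := A) (d := d)) :=
  isOpenQuotientMap_quotientMk (p := fun v : ℤ → RP d => IsTwisted n v ∧ InGeneralPosition A v)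
    (fun _ _ h hv => ⟨h.isTwisted hv.1, h.inGeneralPosition hv.2⟩) (genericSetoid n A d)
    (fun _ _ => Iff.rfl)

theorem isOpenQuotientMap_corrugatedCls (n : ℕ) (A : Finset ℤ) (D : ℕ) :
    IsOpenQuotientMap (CorrugatedPolygon.cls (n := n) (A := A) (D := D)) :=
  isOpenQuotientMap_quotientMk (p := fun w : ℤ → RP D => IsTwisted n w ∧ IsCorrugated A w ∧
      InGeneralPosition A w ∧ ConsecutiveSpan w)
    (fun _ _ h hv => ⟨h.isTwisted hv.1, h.isCorrugated hv.2.1, h.inGeneralPosition hv.2.2.1,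
      h.consecutiveSpan hv.2.2.2⟩) (corrugatedSetoid n A D) (fun _ _ => Iff.rfl)

end Pentagram

namespace Pentagram

/-! ### Linear relations and recurrences -/

section Relations

variable {E F : Type*} [AddCommGroup E] [Module ℝ E] [AddCommGroup F] [Module ℝ F]

/-- The difference operator with coefficients `a j`, `j ∈ A`, annihilates `V`. -/
def Rel (A : Finset ℤ) (a : ℤ → ℤ → ℝ) (V : ℤ → E) : Prop :=
  ∀ k, ∑ j ∈ A, a j k • V (k + j) = 0

theorem Rel.map {A : Finset ℤ} {a : ℤ → ℤ → ℝ} {V : ℤ → E} (h : Rel A a V) (P : E →ₗ[ℝ] F) :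
    Rel A a (fun i => P (V i)) := fun k => by
  simpa only [map_sum, map_smul, map_zero] using congrArg P (h k)

theorem Rel.sub {A : Finset ℤ} {a : ℤ → ℤ → ℝ} {V V' : ℤ → E} (h : Rel A a V) (h' : Rel A a V') :
    Rel A a (fun i => V i - V' i) := fun k => by
  simp only [smul_sub, Finset.sum_sub_distrib, h k, h' k, sub_zero]

/-- Rescaling the vectors conjugates the operator. -/
theorem Rel.smul {A : Finset ℤ} {a : ℤ → ℤ → ℝ} {V : ℤ → E} (h : Rel A a V) {β : ℤ → ℝ}
    (hβ : ∀ i, β i ≠ 0) (l : ℤ → ℝ) :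
    Rel A (fun j k => l k * a j k / β (k + j)) (fun i => β i • V i) := fun k => by
  have : ∀ j, (l k * a j k / β (k + j)) • β (k + j) • V (k + j) =
      l k • a j k • V (k + j) := fun j => by
    rw [smul_smul, smul_smul, div_mul_cancel₀ _ (hβ _)]
  simp only [this, ← Finset.smul_sum, h k, smul_zero]

/-- The form in which general position is used: a relation over all of `A` with one zero coefficient
is trivial. Hence nontrivial relations have no zero coefficient and are unique up to scale. -/
theorem genPos_iff {A : Finset ℤ} {V : ℤ → E} {k : ℤ} : GenPos A V k ↔ ∀ j₀ ∈ A, ∀ x : ℤ → ℝ,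
    ∑ j ∈ A, x j • V (k + j) = 0 → x j₀ = 0 → ∀ j ∈ A, x j = 0 := by
  refine forall₂_congr fun j₀ hj₀ => ?_
  have := linearIndepOn_finset_iff (R := ℝ) (s := A.erase j₀) (v := fun j => V (k + j))
  refine Iff.trans (this : LinearIndependent ℝ (fun j : {j : ℤ // j ∈ A.erase j₀} =>
    V (k + j.1)) ↔ _) ⟨fun h x hx h0 j hj => ?_, fun h x hx j hj => ?_⟩
  · by_cases hjj : j = j₀
    · rw [hjj, h0]
    · refine h x ?_ j (Finset.mem_erase.2 ⟨hjj, hj⟩)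
      rw [← Finset.add_sum_erase A _ hj₀, h0, zero_smul, zero_add] at hx
      exact hx
  · have h1 := h (fun j => if j = j₀ then 0 else x j) ?_ (by simp) j (Finset.mem_of_mem_erase hj)
    · simpa [Finset.ne_of_mem_erase hj] using h1
    · rw [← Finset.add_sum_erase A _ hj₀, if_pos rfl, zero_smul, zero_add, ← hx]
      refine Finset.sum_congr rfl fun i hi => ?_
      rw [if_neg (Finset.ne_of_mem_erase hi)]

theorem GenPos.ne_zero {A : Finset ℤ} {V : ℤ → E} {k : ℤ} (h : GenPos A V k) {x : ℤ → ℝ}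
    (hx : ∑ j ∈ A, x j • V (k + j) = 0) (h0 : ∃ j ∈ A, x j ≠ 0) : ∀ j ∈ A, x j ≠ 0 := by
  intro j hj hj0
  obtain ⟨i, hi, hi0⟩ := h0
  exact hi0 (genPos_iff.1 h j hj x hx hj0 i hi)

theorem GenPos.proportional {A : Finset ℤ} {V : ℤ → E} {k : ℤ} (h : GenPos A V k) {x y : ℤ → ℝ}
    (hx : ∑ j ∈ A, x j • V (k + j) = 0) (hy : ∑ j ∈ A, y j • V (k + j) = 0)
    (h0 : ∃ j ∈ A, y j ≠ 0) : ∃ c, ∀ j ∈ A, x j = c * y j := by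
  obtain ⟨i, hi, hi0⟩ := h0
  refine ⟨x i / y i, fun j hj => ?_⟩
  have := genPos_iff.1 h i hi (fun j => x j - x i / y i * y j) ?_ (by field_simp; ring) j hj
  · exact sub_eq_zero.1 this
  · simp only [sub_smul, Finset.sum_sub_distrib, mul_smul, ← Finset.smul_sum, hx, hy, smul_zero,
      sub_zero]

theorem GenPos.of_proportional {A : Finset ℤ} {V : ℤ → E} {k : ℤ} {y : ℤ → ℝ}
    (hy : ∀ j ∈ A, y j ≠ 0)
    (h : ∀ x : ℤ → ℝ, ∑ j ∈ A, x j • V (k + j) = 0 → ∃ c, ∀ j ∈ A, x j = c * y j) :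
    GenPos A V k := by
  rw [genPos_iff]
  intro j₀ hj₀ x hx h0 j hj
  obtain ⟨c, hc⟩ := h x hx
  have : c = 0 := by
    have := hc j₀ hj₀
    rw [h0] at this
    simpa [hy j₀ hj₀] using this.symm
  rw [hc j hj, this, zero_mul]

theorem GenPos.map_injective {A : Finset ℤ} {V : ℤ → E} {k : ℤ} (P : E →ₗ[ℝ] F)
    (h : GenPos A (fun i => P (V i)) k) : GenPos A V k := fun j₀ hj₀ =>
  LinearIndependent.of_comp P (h j₀ hj₀)

/-- `|A|` vectors in a space of smaller dimension satisfy a nontrivial relation. -/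
theorem exists_row {A : Finset ℤ} {V : ℤ → E} {k : ℤ} (U : Submodule ℝ E)
    [Module.Finite ℝ U] (hU : Module.finrank ℝ U < A.card) (hV : ∀ j ∈ A, V (k + j) ∈ U) :
    ∃ x : ℤ → ℝ, ∑ j ∈ A, x j • V (k + j) = 0 ∧ ∃ j ∈ A, x j ≠ 0 := by
  by_contra hcon
  push Not at hcon
  have hli : LinearIndependent ℝ (fun j : {j : ℤ // j ∈ A} => V (k + j.1)) :=
    linearIndepOn_finset_iff.2 hcon
  have hli' : LinearIndependent ℝ (fun j : {j : ℤ // j ∈ A} => (⟨V (k + j.1), hV j.1 j.2⟩ : U)) :=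
    LinearIndependent.of_comp U.subtype hli
  have := hli'.fintype_card_le_finrank
  rw [Fintype.card_coe] at this
  omega

end Relations

/-- The integers `lo` and `hi` are the extreme elements of `A`, and `D = hi - lo - 1`. -/
structure IsSpan (A : Finset ℤ) (lo hi : ℤ) (D : ℕ) : Prop where
  lo_mem : lo ∈ A
  hi_mem : hi ∈ A
  lo_le : ∀ j ∈ A, lo ≤ j
  le_hi : ∀ j ∈ A, j ≤ hi
  hi_eq : hi = lo + D + 1

/-! ### Two-sided linear recurrences. -/

section Recurrence

variable {E : Type*} [AddCommGroup E] [Module ℝ E] {A : Finset ℤ} {lo hi : ℤ} {D : ℕ}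
  {a : ℤ → ℤ → ℝ}

/-- Nonvanishing extreme coefficients let the equation be solved for the value just beyond either
end of a window, so zeros spread in both directions. -/
theorem Rel.eq_zero (hA : IsSpan A lo hi D) (hlo : ∀ k, a lo k ≠ 0) (hhi : ∀ k, a hi k ≠ 0)
    {x : ℤ → E} (hx : Rel A a x) (k₀ : ℤ) (h0 : ∀ i, k₀ ≤ i → i ≤ k₀ + D → x i = 0) (i : ℤ) :
    x i = 0 := by
  have hext : ∀ k j₀, j₀ ∈ A → a j₀ k ≠ 0 → (∀ j ∈ A, j ≠ j₀ → x (k + j) = 0) →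
      x (k + j₀) = 0 := by
    intro k j₀ hj₀ hne h
    have := hx k
    rw [Finset.sum_eq_single_of_mem j₀ hj₀ (fun j hj hjj => by rw [h j hj hjj, smul_zero])] at this
    exact (smul_eq_zero.1 this).resolve_left hne
  have key : ∀ m : ℕ, ∀ i, k₀ - m ≤ i → i ≤ k₀ + D + m → x i = 0 := by
    intro m
    induction m with
    | zero => intro i h1 h2; exact h0 i (by simpa using h1) (by simpa using h2)
    | succ m ih =>
      have hh := hA.hi_eq
      intro i h1 h2
      push_cast at h1 h2
      rcases lt_or_ge i (k₀ - m) with hl | hl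
      · have := hext (i - lo) lo hA.lo_mem (hlo _) (fun j hj hjj => by
          have := hA.lo_le j hj
          have := hA.le_hi j hj
          exact ih _ (by omega) (by omega))
        simpa using this
      · rcases lt_or_ge (k₀ + D + m) i with hg | hg
        · have := hext (i - hi) hi hA.hi_mem (hhi _) (fun j hj hjj => by
            have := hA.lo_le j hj
            have := hA.le_hi j hj
            exact ih _ (by omega) (by omega))
          simpa using this
        · exact ih i hl hg
  exact key (i - k₀).natAbs i (by omega) (by omega)

/-- Two solutions that agree on a window agree. -/
theorem Rel.ext (hA : IsSpan A lo hi D) (hlo : ∀ k, a lo k ≠ 0) (hhi : ∀ k, a hi k ≠ 0)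
    {x y : ℤ → E} (hx : Rel A a x) (hy : Rel A a y) (k₀ : ℤ)
    (h0 : ∀ i, k₀ ≤ i → i ≤ k₀ + D → x i = y i) (i : ℤ) : x i = y i :=
  sub_eq_zero.1 ((hx.sub hy).eq_zero hA hlo hhi k₀ (fun i h1 h2 => sub_eq_zero.2 (h0 i h1 h2)) i)

/-- Any solution is a linear image of a solution with an independent window. -/
theorem Rel.exists_linearMap (hA : IsSpan A lo hi D) (hlo : ∀ k, a lo k ≠ 0)
    (hhi : ∀ k, a hi k ≠ 0) {W : ℤ → Vec D} (hW : Rel A a W) {k₀ : ℤ}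
    (hli : LinearIndependent ℝ (fun i : Fin (D + 1) => W (k₀ + ((i : ℕ) : ℤ))))
    {x : ℤ → E} (hx : Rel A a x) : ∃ P : Vec D →ₗ[ℝ] E, ∀ i, x i = P (W i) := by
  let b := basisOfLinearIndependentOfCardEqFinrank hli (by simp)
  refine ⟨b.constr ℝ (fun i : Fin (D + 1) => x (k₀ + ((i : ℕ) : ℤ))), fun i => ?_⟩
  refine hx.ext hA hlo hhi (hW.map _) k₀ (fun i h1 h2 => ?_) i
  obtain ⟨s, rfl⟩ : ∃ s : ℕ, i = k₀ + (s : ℤ) := ⟨(i - k₀).toNat, by omega⟩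
  have hs : s < D + 1 := by omega
  have := b.constr_basis ℝ (fun i : Fin (D + 1) => x (k₀ + ((i : ℕ) : ℤ))) ⟨s, hs⟩
  rw [coe_basisOfLinearIndependentOfCardEqFinrank] at this
  exact this.symm

/-- All windows of a solution are independent if one of them is. -/
theorem Rel.linearIndependent (hA : IsSpan A lo hi D) (hlo : ∀ k, a lo k ≠ 0)
    (hhi : ∀ k, a hi k ≠ 0) {W : ℤ → Vec D} (hW : Rel A a W) {k₀ : ℤ}
    (hli : LinearIndependent ℝ (fun i : Fin (D + 1) => W (k₀ + ((i : ℕ) : ℤ)))) (k : ℤ) :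
    LinearIndependent ℝ (fun i : Fin (D + 1) => W (k + ((i : ℕ) : ℤ))) := by
  -- The kernel of `B k` consists of the functionals vanishing on the window at `k`. A functional
  -- turns `W` into a scalar solution, which vanishes everywhere once it vanishes on one window.
  let B : ℤ → Matrix (Fin (D + 1)) (Fin (D + 1)) ℝ := fun k =>
    Matrix.of fun i : Fin (D + 1) => W (k + ((i : ℕ) : ℤ))
  have hB : ∀ k, LinearIndependent ℝ (fun i : Fin (D + 1) => W (k + ((i : ℕ) : ℤ))) ↔
      Function.Injective (B k).mulVec := fun k =>
    (Matrix.linearIndependent_rows_iff_isUnit (A := B k)).trans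
      Matrix.mulVec_injective_iff_isUnit.symm
  rw [hB] at hli ⊢
  have hlin : ∀ (ξ : Vec D) (k : ℤ) (i : Fin (D + 1)),
      (B k).mulVec ξ i = dotProductBilin ℝ ℝ ξ (W (k + ((i : ℕ) : ℤ))) := fun ξ k i =>
    dotProduct_comm _ _
  refine (injective_iff_map_eq_zero (Matrix.mulVecLin (B k))).2 fun ξ hξ => ?_
  refine (injective_iff_map_eq_zero (Matrix.mulVecLin (B k₀))).1 hli ξ ?_
  ext i
  refine (hlin ξ k₀ i).trans ?_
  refine (hW.map (dotProductBilin ℝ ℝ ξ)).eq_zero hA hlo hhi k (fun i h1 h2 => ?_) _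
  obtain ⟨s, rfl⟩ : ∃ s : ℕ, i = k + (s : ℤ) := ⟨(i - k).toNat, by omega⟩
  exact (hlin ξ k ⟨s, by omega⟩).symm.trans (congrFun hξ _)

/-- In a solution with independent windows there are no relations but those of the operator. -/
theorem Rel.genPos (hA : IsSpan A lo hi D) (ha : ∀ j ∈ A, ∀ k, a j k ≠ 0)
    {W : ℤ → Vec D} (hW : Rel A a W)
    (hli : ∀ k, LinearIndependent ℝ (fun i : Fin (D + 1) => W (k + ((i : ℕ) : ℤ)))) (k : ℤ) :
    GenPos A W k := by
  -- Subtracting a multiple of the row removes the index `hi`; the other indices of `A` lie in lo,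
  -- …, hi - 1, which after the shift by `k` is a single window of length D + 1.
  refine GenPos.of_proportional (fun j hj => ha j hj k) fun x hx => ⟨x hi / a hi k, ?_⟩
  have hz : ∑ j ∈ A, (x j - x hi / a hi k * a j k) • W (k + j) = 0 := by
    simp only [sub_smul, Finset.sum_sub_distrib, mul_smul, ← Finset.smul_sum, hx, hW k, smul_zero,
      sub_zero]
  have hhi0 : x hi - x hi / a hi k * a hi k = 0 := by
    rw [div_mul_cancel₀ _ (ha hi hA.hi_mem k), sub_self]
  intro j hj
  by_cases hjh : j = hi
  · rw [hjh]; exact sub_eq_zero.1 hhi0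
  have hh := hA.hi_eq
  have h1 := hli (k + lo)
  rw [Fintype.linearIndependent_iff] at h1
  have h2 := h1 (fun i => if lo + ((i : ℕ) : ℤ) ∈ A then
    x (lo + ((i : ℕ) : ℤ)) - x hi / a hi k * a (lo + ((i : ℕ) : ℤ)) k else 0) ?_
  · have hl := hA.lo_le j hj
    have hu := hA.le_hi j hj
    have := h2 ⟨(j - lo).toNat, by omega⟩
    have e : lo + (((j - lo).toNat : ℕ) : ℤ) = j := by omega
    simp only [e, hj, if_true] at this
    exact sub_eq_zero.1 this
  · rw [← Finset.sum_erase_add A _ hA.hi_mem, hhi0, zero_smul, add_zero] at hz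
    rw [← hz]
    simp only [ite_smul, zero_smul]
    rw [← Finset.sum_filter]
    refine Finset.sum_bij (fun i _ => lo + ((i : ℕ) : ℤ)) ?_ ?_ ?_ ?_
    · intro i hi'
      have := i.2
      simp only [Finset.mem_filter, Finset.mem_univ, true_and] at hi'
      exact Finset.mem_erase.2 ⟨by omega, hi'⟩
    · intro i _ i' _ h
      ext; omega
    · intro j hj
      have hj' := Finset.mem_of_mem_erase hj
      have hl := hA.lo_le j hj'
      have hu := hA.le_hi j hj'
      have hne := Finset.ne_of_mem_erase hj
      have e : lo + (((j - lo).toNat : ℕ) : ℤ) = j := by omega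
      exact ⟨⟨(j - lo).toNat, by omega⟩, Finset.mem_filter.2 ⟨Finset.mem_univ _, e.symm ▸ hj'⟩, e⟩
    · intro i _
      rw [add_assoc]

end Recurrence

/-! ### The fundamental solution -/

/-- Forward solution of a linear recurrence of order `D + 1`. -/
def solveNat {E : Type*} [AddCommGroup E] [Module ℝ E] (D : ℕ) (α : ℕ → ℕ → ℝ) (init : ℕ → E) :
    ℕ → E
  | i => if _h : i ≤ D then init i else
    (-(α (D + 1) (i - (D + 1)))⁻¹) •
      ∑ s : Fin (D + 1), α s (i - (D + 1)) • solveNat D α init (i - (D + 1) + s)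
termination_by i => i
decreasing_by omega

theorem solveNat_of_le {E : Type*} [AddCommGroup E] [Module ℝ E] {D : ℕ} {α : ℕ → ℕ → ℝ}
    {init : ℕ → E} {i : ℕ} (h : i ≤ D) : solveNat D α init i = init i := by
  rw [solveNat, dif_pos h]

theorem solveNat_add {E : Type*} [AddCommGroup E] [Module ℝ E] (D : ℕ) (α : ℕ → ℕ → ℝ)
    (init : ℕ → E) (k : ℕ) : solveNat D α init (k + (D + 1)) =
      (-(α (D + 1) k)⁻¹) • ∑ s : Fin (D + 1), α s k • solveNat D α init (k + s) := by
  rw [solveNat, dif_neg (by omega)]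
  simp only [Nat.add_sub_cancel]

theorem solveNat_rel {E : Type*} [AddCommGroup E] [Module ℝ E] (D : ℕ) {α : ℕ → ℕ → ℝ}
    (init : ℕ → E) {k : ℕ} (h : α (D + 1) k ≠ 0) :
    ∑ s ∈ Finset.range (D + 2), α s k • solveNat D α init (k + s) = 0 := by
  rw [Finset.sum_range_succ, solveNat_add, Finset.sum_range, smul_smul, mul_neg,
    mul_inv_cancel₀ h, neg_one_smul, add_neg_cancel]

/-- The solution of the recurrence given by `a` whose values at `0, …, D` are the standard basis. -/
def fundSol (A : Finset ℤ) (lo : ℤ) (D : ℕ) (a : ℤ → ℤ → ℝ) (i : ℤ) : Vec D :=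
  if 0 ≤ i then
    solveNat D (fun s k => if lo + (s : ℤ) ∈ A then a (lo + s) (k - lo) else 0)
      (fun p s => if (s : ℕ) = p then 1 else 0) i.toNat
  else
    -- The recurrence is run backwards in the variable p = D - i: the coefficients appear in reverse
    -- order, and equation k becomes equation -1 - k - lo.
    solveNat D (fun s k => if lo + D + 1 - (s : ℤ) ∈ A then a (lo + D + 1 - s) (-1 - k - lo) else 0)
      (fun p s => if (s : ℕ) + p = D then 1 else 0) (D - i).toNat

section FundSol

variable {A : Finset ℤ} {lo hi : ℤ} {D : ℕ} {a : ℤ → ℤ → ℝ}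

theorem fundSol_of_le {i : ℤ} (h : i ≤ D) : fundSol A lo D a i =
    solveNat (E := Vec D) D (fun s k => if lo + D + 1 - (s : ℤ) ∈ A then a (lo + D + 1 - s) (-1 - k - lo) else 0)
      (fun p s => if (s : ℕ) + p = D then 1 else 0) (D - i).toNat := by
  unfold fundSol
  split_ifs with h0
  · rw [solveNat_of_le (by omega), solveNat_of_le (by omega)]
    ext s
    have : ((s : ℕ) = i.toNat) ↔ ((s : ℕ) + (D - i).toNat = D) := by omega
    simp only [this]
  · rfl

theorem fundSol_natCast {p : ℕ} (h : p ≤ D) (s : Fin (D + 1)) :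
    fundSol A lo D a p s = if (s : ℕ) = p then 1 else 0 := by
  unfold fundSol
  rw [if_pos (by omega), Int.toNat_natCast, solveNat_of_le h]

theorem sum_range_eq_sum {E : Type*} [AddCommGroup E] [Module ℝ E] (hA : IsSpan A lo hi D)
    (f : ℤ → E) : ∑ s ∈ Finset.range (D + 2), (if lo + (s : ℤ) ∈ A then f (lo + s) else 0) =
      ∑ j ∈ A, f j := by
  have hh := hA.hi_eq
  rw [← Finset.sum_filter]
  refine Finset.sum_bij (fun s _ => lo + (s : ℤ)) ?_ ?_ ?_ ?_
  · intro i hi'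
    exact (Finset.mem_filter.1 hi').2
  · intro i _ i' _ h
    omega
  · intro j hj
    have hl := hA.lo_le j hj
    have hu := hA.le_hi j hj
    have e : lo + (((j - lo).toNat : ℕ) : ℤ) = j := by omega
    exact ⟨(j - lo).toNat, Finset.mem_filter.2 ⟨Finset.mem_range.2 (by omega), e.symm ▸ hj⟩, e⟩
  · intro i _
    rfl

/-- If `0 ≤ k + lo`, all indices of the row are nonnegative and the forward recurrence applies.
Otherwise they are all at most D, where the backward formula is valid because the two agree on 0, …,
D. -/
theorem rel_fundSol (hA : IsSpan A lo hi D) (hlo : ∀ k, a lo k ≠ 0) (hhi : ∀ k, a hi k ≠ 0) :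
    Rel A a (fundSol A lo D a) := by
  intro k
  have hh := hA.hi_eq
  rcases le_or_gt 0 (k + lo) with h0 | h0
  · obtain ⟨q, hq⟩ : ∃ q : ℕ, k + lo = q := ⟨(k + lo).toNat, by omega⟩
    have := solveNat_rel D (E := Vec D)
      (α := fun s k => if lo + (s : ℤ) ∈ A then a (lo + s) (k - lo) else 0)
      (fun p s => if (s : ℕ) = p then 1 else 0) (k := q) (by
        have : lo + ((D + 1 : ℕ) : ℤ) = hi := by push_cast; omega
        rw [this, if_pos hA.hi_mem]; exact hhi _)
    refine (sum_range_eq_sum hA _).symm.trans (Eq.trans ?_ this)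
    refine Finset.sum_congr rfl fun s _ => ?_
    rw [ite_smul, zero_smul]
    congr 1
    have e1 : (q : ℤ) - lo = k := by omega
    rw [e1, fundSol, if_pos (by omega)]
    congr 2
    omega
  · obtain ⟨q, hq⟩ : ∃ q : ℕ, -1 - (k + lo) = q := ⟨(-1 - (k + lo)).toNat, by omega⟩
    have := solveNat_rel D (E := Vec D)
      (α := fun s k => if lo + D + 1 - (s : ℤ) ∈ A then a (lo + D + 1 - s) (-1 - k - lo) else 0)
      (fun p s => if (s : ℕ) + p = D then 1 else 0) (k := q) (by
        have : lo + D + 1 - ((D + 1 : ℕ) : ℤ) = lo := by push_cast; omega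
        rw [this, if_pos hA.lo_mem]; exact hlo _)
    refine (sum_range_eq_sum hA _).symm.trans (Eq.trans ?_ this)
    rw [← Finset.sum_range_reflect]
    refine Finset.sum_congr rfl fun s hs => ?_
    have hs' := Finset.mem_range.1 hs
    rw [ite_smul, zero_smul]
    have e1 : lo + (((D + 2 - 1 - s : ℕ)) : ℤ) = lo + D + 1 - s := by omega
    have e2 : -1 - (q : ℤ) - lo = k := by omega
    rw [e1, e2, fundSol_of_le (by omega)]
    congr 3
    omega

theorem linearIndependent_fundSol_zero :
    LinearIndependent ℝ (fun i : Fin (D + 1) => fundSol A lo D a (0 + ((i : ℕ) : ℤ))) := by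
  have : (fun i : Fin (D + 1) => fundSol A lo D a (0 + ((i : ℕ) : ℤ))) =
      fun i => Pi.basisFun ℝ (Fin (D + 1)) i := by
    ext i s
    rw [zero_add, fundSol_natCast (by omega), Pi.basisFun_apply, Pi.single_apply]
    simp only [Fin.ext_iff]
  rw [this]
  exact (Pi.basisFun ℝ (Fin (D + 1))).linearIndependent

theorem linearIndependent_fundSol (hA : IsSpan A lo hi D) (hlo : ∀ k, a lo k ≠ 0)
    (hhi : ∀ k, a hi k ≠ 0) (k : ℤ) :
    LinearIndependent ℝ (fun i : Fin (D + 1) => fundSol A lo D a (k + ((i : ℕ) : ℤ))) :=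
  (rel_fundSol hA hlo hhi).linearIndependent hA hlo hhi linearIndependent_fundSol_zero k

theorem ne_zero_of_window {W : ℤ → Vec D}
    (h : ∀ k, LinearIndependent ℝ (fun i : Fin (D + 1) => W (k + ((i : ℕ) : ℤ)))) (i : ℤ) :
    W i ≠ 0 := by
  simpa using (h i).ne_zero 0

end FundSol

/-! ### Normalized relations -/

/-- The least squares solution of `B x = y`. -/
def lsq {ρ ι : Type*} [Fintype ρ] [Fintype ι] [DecidableEq ι] (B : Matrix ρ ι ℝ) (y : ρ → ℝ) :
    ι → ℝ :=
  (B.transpose * B)⁻¹.mulVec (B.transpose.mulVec y)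

/-- Over ℝ the matrices BᵀB and B have the same kernel. Injectivity of a rectangular matrix thus
becomes the nonvanishing of one polynomial in its entries. -/
theorem det_gram_ne_zero_iff {ρ ι : Type*} [Fintype ρ] [Fintype ι] [DecidableEq ι]
    {B : Matrix ρ ι ℝ} : (B.transpose * B).det ≠ 0 ↔ Function.Injective B.mulVec := by
  rw [← isUnit_iff_ne_zero, ← Matrix.isUnit_iff_isUnit_det, ← Matrix.mulVec_injective_iff_isUnit]
  have h := Matrix.ker_mulVecLin_transpose_mul_self B
  have e1 : Function.Injective (B.transpose * B).mulVec ↔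
      LinearMap.ker (B.transpose * B).mulVecLin = ⊥ := by
    rw [LinearMap.ker_eq_bot]; rfl
  have e2 : Function.Injective B.mulVec ↔ LinearMap.ker B.mulVecLin = ⊥ := by
    rw [LinearMap.ker_eq_bot]; rfl
  rw [e1, e2, h]

theorem lsq_eq {ρ ι : Type*} [Fintype ρ] [Fintype ι] [DecidableEq ι] {B : Matrix ρ ι ℝ}
    (hB : Function.Injective B.mulVec) {x : ι → ℝ} {y : ρ → ℝ} (h : B.mulVec x = y) :
    lsq B y = x := by
  have hu : IsUnit (B.transpose * B).det := isUnit_iff_ne_zero.2 (det_gram_ne_zero_iff.2 hB)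
  rw [lsq, ← h, Matrix.mulVec_mulVec, Matrix.mulVec_mulVec, Matrix.mul_assoc,
    Matrix.nonsing_inv_mul _ hu,
    Matrix.one_mulVec]

/-- The matrix with columns `V (k + j)`, `j ∈ S`. -/
def colMat {r : ℕ} (S : Finset ℤ) (V : ℤ → Vec r) (k : ℤ) : Matrix (Fin (r + 1)) {j // j ∈ S} ℝ :=
  Matrix.of fun s j => V (k + j.1) s

theorem colMat_mulVec {r : ℕ} (S : Finset ℤ) (V : ℤ → Vec r) (k : ℤ) (x : {j // j ∈ S} → ℝ) :
    (colMat S V k).mulVec x = ∑ j, x j • V (k + j.1) := by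
  ext s
  simp [colMat, Matrix.mulVec, dotProduct, Finset.sum_apply, mul_comm]

theorem colMat_injective_iff {r : ℕ} (S : Finset ℤ) (V : ℤ → Vec r) (k : ℤ) :
    Function.Injective (colMat S V k).mulVec ↔
      LinearIndependent ℝ (fun j : {j // j ∈ S} => V (k + j.1)) := by
  rw [Fintype.linearIndependent_iff]
  refine (injective_iff_map_eq_zero (Matrix.mulVecLin (colMat S V k))).trans ?_
  refine forall_congr' fun x => ?_
  rw [Matrix.mulVecLin_apply, colMat_mulVec, funext_iff (f := x)]
  rfl

/-- The relation between the vectors `V (k + j)`, `j ∈ A`, with coefficient `-1` at `hi`. -/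
def nrow {r : ℕ} (A : Finset ℤ) (hi : ℤ) (V : ℤ → Vec r) (j k : ℤ) : ℝ :=
  if h : j ∈ A.erase hi then lsq (colMat (A.erase hi) V k) (V (k + hi)) ⟨j, h⟩
  else if j = hi then -1 else 0

theorem nrow_hi {r : ℕ} (A : Finset ℤ) (hi : ℤ) (V : ℤ → Vec r) (k : ℤ) :
    nrow A hi V hi k = -1 := by simp [nrow]

/-- The coefficient -1 at `hi` fixes the scale, so the relation becomes a well-defined function of
the vectors, rational through `lsq`. -/
theorem nrow_eq {r : ℕ} {A : Finset ℤ} {hi : ℤ} (hhi : hi ∈ A) {V : ℤ → Vec r} {k : ℤ}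
    (h : GenPos A V k) {x : ℤ → ℝ} (hx : ∑ j ∈ A, x j • V (k + j) = 0) (h1 : x hi = -1) :
    ∀ j ∈ A, nrow A hi V j k = x j := by
  intro j hj
  by_cases hjh : j = hi
  · rw [hjh, nrow_hi, h1]
  · have hj' : j ∈ A.erase hi := Finset.mem_erase.2 ⟨hjh, hj⟩
    rw [nrow, dif_pos hj', lsq_eq ((colMat_injective_iff _ _ _).2 (h hi hhi))
      (x := fun j => x j.1)]
    rw [colMat_mulVec, Finset.sum_coe_sort (A.erase hi) (fun j => x j • V (k + j))]
    rw [← Finset.add_sum_erase A _ hhi, h1, neg_one_smul] at hx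
    exact (neg_add_eq_zero.1 hx).symm

theorem nrow_rel {r : ℕ} {A : Finset ℤ} {hi : ℤ} (hhi : hi ∈ A) {V : ℤ → Vec r} {k : ℤ}
    (h : GenPos A V k) (hx : ∃ x : ℤ → ℝ, ∑ j ∈ A, x j • V (k + j) = 0 ∧ ∃ j ∈ A, x j ≠ 0) :
    ∑ j ∈ A, nrow A hi V j k • V (k + j) = 0 ∧ ∀ j ∈ A, nrow A hi V j k ≠ 0 := by
  obtain ⟨x, hx, h0⟩ := hx
  have hne := h.ne_zero hx h0
  have hy : ∑ j ∈ A, (-x j / x hi) • V (k + j) = 0 := by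
    have : ∀ j, (-x j / x hi) • V (k + j) = (-(x hi)⁻¹) • x j • V (k + j) := fun j => by
      rw [smul_smul]; congr 1; ring
    simp only [this, ← Finset.smul_sum, hx, smul_zero]
  have he := nrow_eq hhi h hy (by rw [neg_div, div_self (hne hi hhi)])
  constructor
  · rw [← hy]
    exact Finset.sum_congr rfl fun j hj => by rw [he j hj]
  · intro j hj
    rw [he j hj]
    exact div_ne_zero (neg_ne_zero.2 (hne j hj)) (hne hi hhi)

end Pentagram

namespace Pentagram

/-! ### Corrugated polygons as solutions of difference equations -/

/-- `W` solves the difference equation with nonvanishing coefficients `a`, and its windows of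
length `D + 1` are bases. -/
structure IsSol {D : ℕ} (A : Finset ℤ) (a : ℤ → ℤ → ℝ) (W : ℤ → Vec D) : Prop where
  rel : Rel A a W
  ne : ∀ j ∈ A, ∀ k, a j k ≠ 0
  window : ∀ k, LinearIndependent ℝ (fun i : Fin (D + 1) => W (k + ((i : ℕ) : ℤ)))

/-- The numerical data of the theorem. -/
structure IsData (n : ℕ) (A : Finset ℤ) (lo hi : ℤ) (D d : ℕ) : Prop extends
    IsSpan A lo hi D where
  card : A.card = d + 2
  n_pos : 0 < n

section

variable {n : ℕ} {A : Finset ℤ} {lo hi : ℤ} {D d : ℕ} {a : ℤ → ℤ → ℝ}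

theorem isSol_fundSol (hA : IsSpan A lo hi D) (ha : ∀ j ∈ A, ∀ k, a j k ≠ 0) :
    IsSol A a (fundSol A lo D a) :=
  ⟨rel_fundSol hA (ha _ hA.lo_mem) (ha _ hA.hi_mem), ha,
    linearIndependent_fundSol hA (ha _ hA.lo_mem) (ha _ hA.hi_mem)⟩

theorem IsSol.isLift {W : ℤ → Vec D} (h : IsSol A a W) : IsLift W (fun i => pt (W i)) :=
  isLift_pt (ne_zero_of_window h.window)

theorem IsSol.genPos (hA : IsSpan A lo hi D) {W : ℤ → Vec D} (h : IsSol A a W) (k : ℤ) :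
    GenPos A W k := h.rel.genPos hA h.ne h.window k

theorem IsSol.exists_linearMap {E : Type*} [AddCommGroup E] [Module ℝ E]
    (hA : IsSpan A lo hi D) {W : ℤ → Vec D} (h : IsSol A a W) {V : ℤ → E} (hV : Rel A a V) :
    ∃ P : Vec D →ₗ[ℝ] E, ∀ i, V i = P (W i) :=
  h.rel.exists_linearMap hA (h.ne _ hA.lo_mem) (h.ne _ hA.hi_mem) (h.window 0) hV

theorem linearMap_ext_of_window {E : Type*} [AddCommGroup E] [Module ℝ E] {W : ℤ → Vec D}
    (h : ∀ k, LinearIndependent ℝ (fun i : Fin (D + 1) => W (k + ((i : ℕ) : ℤ))))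
    {f g : Vec D →ₗ[ℝ] E} (hfg : ∀ i, f (W i) = g (W i)) : f = g := by
  refine (basisOfLinearIndependentOfCardEqFinrank (h 0) (by simp)).ext fun i => ?_
  rw [coe_basisOfLinearIndependentOfCardEqFinrank]
  exact hfg _

/-- Both sequences are universal among solutions, so each is a linear image of the other, and the
two maps are mutually inverse. -/
theorem IsSol.exists_linearEquiv (hA : IsSpan A lo hi D) {W W' : ℤ → Vec D} (h : IsSol A a W)
    (h' : IsSol A a W') : ∃ g : Vec D ≃ₗ[ℝ] Vec D, ∀ i, W' i = g (W i) := by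
  obtain ⟨P, hP⟩ := h.exists_linearMap hA h'.rel
  obtain ⟨Q, hQ⟩ := h'.exists_linearMap hA h.rel
  refine ⟨LinearEquiv.ofLinearMap P Q (linearMap_ext_of_window h'.window fun i => ?_)
    (linearMap_ext_of_window h.window fun i => ?_), hP⟩
  · simp [← hQ, ← hP]
  · simp [← hQ, ← hP]

theorem IsSol.map {W : ℤ → Vec D} (h : IsSol A a W) (g : Vec D ≃ₗ[ℝ] Vec D) :
    IsSol A a (fun i => g (W i)) :=
  ⟨h.rel.map g.toLinearMap, h.ne, fun k => (h.window k).map' g.toLinearMap g.ker⟩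

theorem linearIndependent_smul_window {W : ℤ → Vec D} {β : ℤ → ℝ} (hβ : ∀ i, β i ≠ 0)
    (h : ∀ k, LinearIndependent ℝ (fun i : Fin (D + 1) => W (k + ((i : ℕ) : ℤ)))) (k : ℤ) :
    LinearIndependent ℝ (fun i : Fin (D + 1) =>
      (fun i => β i • W i) (k + ((i : ℕ) : ℤ))) :=
  (h k).units_smul (fun i : Fin (D + 1) => Units.mk0 (β (k + ((i : ℕ) : ℤ))) (hβ _))

/-- A relation of nontrivial type that holds in a generic projection holds upstairs. -/
theorem Rel.of_map {E F : Type*} [AddCommGroup E] [Module ℝ E] [AddCommGroup F] [Module ℝ F]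
    {W : ℤ → E} {b : ℤ → ℤ → ℝ} (P : E →ₗ[ℝ] F) (hW : Rel A b W) (hb : ∀ k, ∃ j ∈ A, b j k ≠ 0)
    (hg : ∀ k, GenPos A (fun i => P (W i)) k) (ha : Rel A a (fun i => P (W i))) :
    Rel A a W := by
  intro k
  -- Downstairs the row of `a` must be a multiple of the row of `b`, and the latter already holds
  -- upstairs.
  obtain ⟨c, hc⟩ := (hg k).proportional (ha k) (hW.map P k) (hb k)
  calc ∑ j ∈ A, a j k • W (k + j) = ∑ j ∈ A, c • b j k • W (k + j) :=
        Finset.sum_congr rfl fun j hj => by rw [hc j hj, mul_smul]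
    _ = 0 := by rw [← Finset.smul_sum, hW k, smul_zero]

theorem isCorrugated_of_rel {r : ℕ} (hi_mem : hi ∈ A) {V : ℤ → Vec r} {v : ℤ → RP r}
    (h : IsLift V v) (hg : ∀ k, GenPos A V k)
    (hx : ∀ k, ∃ x : ℤ → ℝ, ∑ j ∈ A, x j • V (k + j) = 0 ∧ ∃ j ∈ A, x j ≠ 0) :
    IsCorrugated A v := by
  rw [isCorrugated_iff h]
  intro k
  obtain ⟨hrel, -⟩ := nrow_rel hi_mem (hg k) (hx k)
  refine ⟨Submodule.span ℝ (Set.range fun j : {j // j ∈ A.erase hi} => V (k + j.1)), ?_, ?_⟩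
  · rw [finrank_span_eq_card (hg k hi hi_mem), Fintype.card_coe, Finset.card_erase_add_one hi_mem]
  · intro j hj
    by_cases hjh : j = hi
    · rw [← Finset.add_sum_erase A _ hi_mem, nrow_hi, neg_one_smul, neg_add_eq_zero] at hrel
      rw [hjh, hrel]
      exact Submodule.sum_mem _ fun i hi' => Submodule.smul_mem _ _
        (Submodule.subset_span ⟨⟨i, hi'⟩, rfl⟩)
    · exact Submodule.subset_span ⟨⟨j, Finset.mem_erase.2 ⟨hjh, hj⟩⟩, rfl⟩

theorem IsSol.isCorrugated (hA : IsSpan A lo hi D) {W : ℤ → Vec D} (h : IsSol A a W)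
    {w : ℤ → RP D} (hw : IsLift W w) : IsCorrugated A w :=
  isCorrugated_of_rel hA.hi_mem hw (h.genPos hA)
    fun k => ⟨fun j => a j k, h.rel k, lo, hA.lo_mem, h.ne _ hA.lo_mem k⟩

theorem rel_nrow_of_corrugated {r : ℕ} (hi_mem : hi ∈ A) {V : ℤ → Vec r} {v : ℤ → RP r}
    (h : IsLift V v) (hc : IsCorrugated A v) (hg : InGeneralPosition A v) :
    Rel A (nrow A hi V) V ∧ ∀ j ∈ A, ∀ k, nrow A hi V j k ≠ 0 := by
  rw [isCorrugated_iff h] at hc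
  rw [inGeneralPosition_iff h] at hg
  have := fun k => nrow_rel hi_mem (hg k) (by
    obtain ⟨U, hU, hm⟩ := hc k
    exact exists_row U (by omega) hm)
  exact ⟨fun k => (this k).1, fun j hj k => (this k).2 j hj⟩

theorem isSol_nrow (hi_mem : hi ∈ A) {W : ℤ → Vec D} {w : ℤ → RP D} (h : IsLift W w)
    (hc : IsCorrugated A w) (hg : InGeneralPosition A w) (hs : ConsecutiveSpan w) :
    IsSol A (nrow A hi W) W :=
  ⟨(rel_nrow_of_corrugated hi_mem h hc hg).1, (rel_nrow_of_corrugated hi_mem h hc hg).2,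
    (consecutiveSpan_iff h).1 hs⟩

theorem exists_row_of_card (hcard : A.card = d + 2) (V : ℤ → Vec d) (k : ℤ) :
    ∃ x : ℤ → ℝ, ∑ j ∈ A, x j • V (k + j) = 0 ∧ ∃ j ∈ A, x j ≠ 0 :=
  exists_row ⊤ (by rw [finrank_top]; simp [hcard]) fun _ _ => Submodule.mem_top

theorem rel_nrow_of_card (hcard : A.card = d + 2) (hi_mem : hi ∈ A) {V : ℤ → Vec d}
    (hg : ∀ k, GenPos A V k) : Rel A (nrow A hi V) V ∧ ∀ j ∈ A, ∀ k, nrow A hi V j k ≠ 0 := by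
  have := fun k => nrow_rel hi_mem (hg k) (exists_row_of_card hcard V k)
  exact ⟨fun k => (this k).1, fun j hj k => (this k).2 j hj⟩

theorem span_eq_top_of_genPos (hcard : A.card = d + 2) (hi_mem : hi ∈ A) {V : ℤ → Vec d} {k : ℤ}
    (hg : GenPos A V k) :
    Submodule.span ℝ (Set.range fun j : {j // j ∈ A.erase hi} => V (k + j.1)) = ⊤ :=
  (hg hi hi_mem).span_eq_top_of_card_eq_finrank' (by
    rw [Fintype.card_coe, Finset.card_erase_of_mem hi_mem, hcard]; simp)

theorem surjective_of_genPos {E : Type*} [AddCommGroup E] [Module ℝ E] (hcard : A.card = d + 2)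
    (hi_mem : hi ∈ A) {W : ℤ → E} {V : ℤ → Vec d} {k : ℤ} (hg : GenPos A V k)
    {P : E →ₗ[ℝ] Vec d} (hP : ∀ i, V i = P (W i)) : Function.Surjective P := by
  rw [← LinearMap.range_eq_top, eq_top_iff, ← span_eq_top_of_genPos hcard hi_mem hg,
    Submodule.span_le]
  rintro _ ⟨j, rfl⟩
  exact ⟨_, (hP _).symm⟩

theorem IsProjectionOf.exists_isLift {w : ℤ → RP D} {v : ℤ → RP d} (h : IsProjectionOf w v)
    {W : ℤ → Vec D} (hW : IsLift W w) : ∃ P : Vec D →ₗ[ℝ] Vec d, Function.Surjective P ∧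
      IsLift (fun i => P (W i)) v := by
  obtain ⟨V, hV⟩ := Pentagram.exists_isLift v
  obtain ⟨P, hs, hP⟩ := (isProjectionOf_iff hW hV).1 h
  refine ⟨P, hs, fun i => ?_⟩
  obtain ⟨c, hc, h⟩ := hP i
  have hne : P (W i) ≠ 0 := by
    intro h0
    exact (hV i).1 (by rw [h, h0, smul_zero])
  exact ⟨hne, by rw [← pt_smul hc hne, ← h, (hV i).2]⟩

theorem isProjectionOf_of_isLift {w : ℤ → RP D} {v : ℤ → RP d} {W : ℤ → Vec D} (hW : IsLift W w)
    {P : Vec D →ₗ[ℝ] Vec d} (hs : Function.Surjective P) (hV : IsLift (fun i => P (W i)) v) :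
    IsProjectionOf w v :=
  (isProjectionOf_iff hW hV).2 ⟨P, hs, fun _ => ⟨1, one_ne_zero, (one_smul _ _).symm⟩⟩

theorem IsProjectionOf.congr {w w' : ℤ → RP D} {v v' : ℤ → RP d} (h : IsProjectionOf w v)
    (hw : ProjEquiv w w') (hv : ProjEquiv v v') : IsProjectionOf w' v' := by
  obtain ⟨W, hW⟩ := Pentagram.exists_isLift w
  obtain ⟨P, hs, hP⟩ := h.exists_isLift hW
  obtain ⟨g, hg⟩ := hw.exists_isLift hW
  obtain ⟨g', hg'⟩ := hv.exists_isLift hP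
  refine isProjectionOf_of_isLift hg (P := g'.toLinearMap ∘ₗ P ∘ₗ g.symm.toLinearMap)
    ((g'.surjective.comp hs).comp g.symm.surjective) ?_
  simpa using hg'

/-- A corrugated sequence of which `v` is a projection is determined by `v`. -/
theorem IsProjectionOf.projEquiv (hA : IsSpan A lo hi D) {w w' : ℤ → RP D} {v v' : ℤ → RP d}
    (hw : IsCorrugated A w) (hws : ConsecutiveSpan w)
    (hw' : IsCorrugated A w') (hws' : ConsecutiveSpan w')
    (hv : InGeneralPosition A v) (h : IsProjectionOf w v) (h' : IsProjectionOf w' v')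
    (hvv : ProjEquiv v v') : ProjEquiv w w' := by
  have h2 : IsProjectionOf w' v := h'.congr ((projEquiv_equivalence D).refl _)
    ((projEquiv_equivalence d).symm hvv)
  obtain ⟨W, hW⟩ := Pentagram.exists_isLift w
  obtain ⟨W', hW'⟩ := Pentagram.exists_isLift w'
  obtain ⟨P, -, hP⟩ := h.exists_isLift hW
  obtain ⟨P', -, hP'⟩ := h2.exists_isLift hW'
  have gP := (inGeneralPosition_iff hP).1 hv
  have gP' := (inGeneralPosition_iff hP').1 hv
  have hsol := isSol_nrow hA.hi_mem hW hw ((inGeneralPosition_iff hW).2 fun k =>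
    (gP k).map_injective P) hws
  have hsol' := isSol_nrow hA.hi_mem hW' hw' ((inGeneralPosition_iff hW').2 fun k =>
    (gP' k).map_injective P') hws'
  -- Rescaling `W'` by `β` makes the two projections equal as vectors. The row of `W` then
  -- annihilates the projection of the rescaled `W'`, and by `Rel.of_map` also the rescaled `W'`
  -- itself.
  obtain ⟨β, hβ, hPP⟩ := hP'.exists_smul hP
  have hrel : Rel A (nrow A hi W) (fun i => β i • W' i) := by
    refine Rel.of_map P' (hsol'.rel.smul hβ (fun _ => 1)) (fun k => ⟨lo, hA.lo_mem, ?_⟩) ?_ ?_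
    · exact div_ne_zero (mul_ne_zero one_ne_zero (hsol'.ne _ hA.lo_mem _)) (hβ _)
    · simp only [map_smul, ← hPP]
      exact gP
    · simp only [map_smul, ← hPP]
      exact hsol.rel.map P
  have hsol2 : IsSol A (nrow A hi W) (fun i => β i • W' i) :=
    ⟨hrel, hsol.ne, linearIndependent_smul_window hβ hsol'.window⟩
  obtain ⟨g, hg⟩ := hsol.exists_linearEquiv hA hsol2
  refine (projEquiv_iff hW hW').2 ⟨g, fun i => ⟨(β i)⁻¹, inv_ne_zero (hβ i), ?_⟩⟩
  rw [← hg i, smul_smul, inv_mul_cancel₀ (hβ i), one_smul]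

theorem shift_window {w : ℤ → RP D} (hws : ConsecutiveSpan w) (n : ℤ) :
    ConsecutiveSpan (fun i => w (i + n)) := fun k => by
  simpa only [add_right_comm] using hws (k + n)

theorem shift_isCorrugated {w : ℤ → RP D} (hw : IsCorrugated A w) (n : ℤ) :
    IsCorrugated A (fun i => w (i + n)) := fun k => by
  simpa only [add_right_comm] using hw (k + n)

/-- A nondegenerate corrugated sequence that projects to a twisted polygon is twisted. -/
theorem IsProjectionOf.isTwisted (hA : IsSpan A lo hi D) {w : ℤ → RP D} {v : ℤ → RP d}
    (hw : IsCorrugated A w) (hws : ConsecutiveSpan w)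
    (hv : InGeneralPosition A v) (ht : IsTwisted n v) (h : IsProjectionOf w v) :
    IsTwisted n w := by
  obtain ⟨P, hs, hP⟩ := id h
  -- The shift of `w` is a corrugated sequence over the shift of `v`, which is equivalent to `v`;
  -- uniqueness over `v` provides the monodromy of `w`.
  exact IsProjectionOf.projEquiv hA hw hws (shift_isCorrugated hw n) (shift_window hws n) hv h
    (v' := fun i => v (i + n)) ⟨P, hs, fun i => hP _⟩ ht

/-- `V` solves its own normalized equation, so it is a linear image of the fundamental solution of
that equation. -/
theorem fundSol_projection (h : IsData n A lo hi D d) {V : ℤ → Vec d} {v : ℤ → RP d}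
    (hV : IsLift V v) (hv : InGeneralPosition A v) :
    IsSol A (nrow A hi V) (fundSol A lo D (nrow A hi V)) ∧
      IsProjectionOf (fun i => pt (fundSol A lo D (nrow A hi V) i)) v := by
  have hg := (inGeneralPosition_iff hV).1 hv
  obtain ⟨hrel, hne⟩ := rel_nrow_of_card h.card h.hi_mem hg
  have hsol := isSol_fundSol h.toIsSpan hne
  obtain ⟨P, hP⟩ := hsol.exists_linearMap h.toIsSpan hrel
  refine ⟨hsol, isProjectionOf_of_isLift hsol.isLift
    (surjective_of_genPos h.card h.hi_mem (hg 0) hP) ?_⟩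
  rwa [← funext hP]

theorem IsSol.mem_corrugated (hA : IsSpan A lo hi D) {W : ℤ → Vec D} (h : IsSol A a W)
    {w : ℤ → RP D} (hw : IsLift W w) (ht : IsTwisted n w) :
    IsTwisted n w ∧ IsCorrugated A w ∧ InGeneralPosition A w ∧ ConsecutiveSpan w :=
  ⟨ht, h.isCorrugated hA hw, (inGeneralPosition_iff hw).2 (h.genPos hA),
    (consecutiveSpan_iff hw).2 h.window⟩

theorem fundSol_mem_corrugated (h : IsData n A lo hi D d) {V : ℤ → Vec d} {v : ℤ → RP d}
    (hV : IsLift V v) (hv : InGeneralPosition A v) (ht : IsTwisted n v) :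
    let w : ℤ → RP D := fun i => pt (fundSol A lo D (nrow A hi V) i)
    IsTwisted n w ∧ IsCorrugated A w ∧ InGeneralPosition A w ∧ ConsecutiveSpan w := by
  obtain ⟨hsol, hproj⟩ := fundSol_projection h hV hv
  exact hsol.mem_corrugated h.toIsSpan hsol.isLift (hproj.isTwisted h.toIsSpan
    (hsol.isCorrugated h.toIsSpan hsol.isLift) ((consecutiveSpan_iff hsol.isLift).2 hsol.window)
    hv ht)

theorem exists_corrugation (h : IsData n A lo hi D d) (v : GenericPolygon n A d) :
    ∃ w : CorrugatedPolygon n A D, IsProjectionOf w.1 v.1 := by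
  obtain ⟨V, hV⟩ := Pentagram.exists_isLift v.1
  exact ⟨⟨_, fundSol_mem_corrugated h hV v.2.2 v.2.1⟩, (fundSol_projection h hV v.2.2).2⟩

theorem corrugated_projEquiv (h : IsData n A lo hi D d) {v v' : GenericPolygon n A d}
    {w w' : CorrugatedPolygon n A D} (hw : IsProjectionOf w.1 v.1) (hw' : IsProjectionOf w'.1 v'.1)
    (hv : ProjEquiv v.1 v'.1) : w.cls = w'.cls :=
  Quotient.sound (IsProjectionOf.projEquiv h.toIsSpan w.2.2.1 w.2.2.2.2 w'.2.2.1 w'.2.2.2.2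
    v.2.2 hw hw' hv)

/-- The map from classes of generic polygons to classes of corrugated polygons. -/
def corrugation (h : IsData n A lo hi D d) : GenericClass n A d → CorrugatedClass n A D :=
  Quotient.lift (fun v => (exists_corrugation h v).choose.cls) fun v v' hvv =>
    corrugated_projEquiv h (exists_corrugation h v).choose_spec
      (exists_corrugation h v').choose_spec hvv

theorem corrugation_eq_iff (h : IsData n A lo hi D d) (v : GenericPolygon n A d)
    (w : CorrugatedPolygon n A D) :
    corrugation h v.cls = w.cls ↔ IsProjectionOf w.1 v.1 := by
  constructor
  · intro he
    have hp : ProjEquiv (exists_corrugation h v).choose.1 w.1 := Quotient.exact he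
    exact (exists_corrugation h v).choose_spec.congr hp ((projEquiv_equivalence d).refl _)
  · intro hp
    exact corrugated_projEquiv h (exists_corrugation h v).choose_spec hp
      ((projEquiv_equivalence d).refl _)

end

/-! ### The pentagram map -/

/-- The lift of the pentagram image defined by an operator. -/
def pent {E : Type*} [AddCommGroup E] [Module ℝ E] (Ap : Finset ℤ) (a : ℤ → ℤ → ℝ) (V : ℤ → E)
    (k : ℤ) : E := ∑ j ∈ Ap, a j k • V (k + j)

theorem map_pent {E F : Type*} [AddCommGroup E] [Module ℝ E] [AddCommGroup F] [Module ℝ F]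
    (Ap : Finset ℤ) (a : ℤ → ℤ → ℝ) (V : ℤ → E) (k : ℤ) (P : E →ₗ[ℝ] F) :
    P (pent Ap a V k) = pent Ap a (fun i => P (V i)) k := by
  simp only [pent, map_sum, map_smul]

section Pent

variable {r : ℕ} {Ap Am : Finset ℤ} {a : ℤ → ℤ → ℝ} {V : ℤ → Vec r} {k : ℤ}

theorem pent_ne_zero (hp : Ap.Nonempty) (hm : Am.Nonempty) (hdisj : Disjoint Ap Am)
    (hg : GenPos (Ap ∪ Am) V k) (ha : ∀ j ∈ Ap ∪ Am, a j k ≠ 0) : pent Ap a V k ≠ 0 := by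
  intro h0
  obtain ⟨i, hi⟩ := hp
  obtain ⟨j, hj⟩ := hm
  have := genPos_iff.1 hg j (Finset.mem_union_right _ hj) (fun i => if i ∈ Ap then a i k else 0)
    ?_ (if_neg (Finset.disjoint_right.1 hdisj hj)) i (Finset.mem_union_left _ hi)
  · rw [if_pos hi] at this
    exact ha i (Finset.mem_union_left _ hi) this
  · rw [Finset.sum_union hdisj]
    have h1 : ∑ i ∈ Am, (if i ∈ Ap then a i k else 0) • V (k + i) = 0 :=
      Finset.sum_eq_zero fun i hi => by rw [if_neg (Finset.disjoint_right.1 hdisj hi), zero_smul]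
    rw [h1, add_zero, ← h0]
    exact Finset.sum_congr rfl fun i hi => by rw [if_pos hi]

/-- Two expressions of a common vector, one over `Ap` and one over `Am`, subtract to a relation over
the union, hence to a multiple of the row. The part of the row over `Ap` therefore spans the
intersection. -/
theorem iSup_inf_iSup_eq (hdisj : Disjoint Ap Am) (hp : Ap.Nonempty)
    (hg : GenPos (Ap ∪ Am) V k)
    (ha : ∀ j ∈ Ap ∪ Am, a j k ≠ 0) (hrel : ∑ j ∈ Ap ∪ Am, a j k • V (k + j) = 0) :
    (⨆ j ∈ Ap, Submodule.span ℝ {V (k + j)}) ⊓ (⨆ j ∈ Am, Submodule.span ℝ {V (k + j)}) =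
      Submodule.span ℝ {pent Ap a V k} := by
  have hmem : ∀ (S : Finset ℤ) (x : Vec r), x ∈ (⨆ j ∈ S, Submodule.span ℝ {V (k + j)}) ↔
      ∃ c : ℤ → ℝ, ∑ j ∈ S, c j • V (k + j) = x := by
    intro S x
    rw [Submodule.mem_iSup_finset_iff_exists_sum]
    constructor
    · rintro ⟨μ, rfl⟩
      choose c hc using fun j => Submodule.mem_span_singleton.1 (μ j).2
      exact ⟨c, Finset.sum_congr rfl fun j _ => hc j⟩
    · rintro ⟨c, rfl⟩
      exact ⟨fun j => ⟨c j • V (k + j), Submodule.smul_mem _ _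
        (Submodule.mem_span_singleton_self _)⟩, rfl⟩
  apply le_antisymm
  · rintro x ⟨h1, h2⟩
    obtain ⟨c, hc⟩ := (hmem _ _).1 h1
    obtain ⟨c', hc'⟩ := (hmem _ _).1 h2
    obtain ⟨i, hi⟩ := hp
    obtain ⟨t, ht⟩ := hg.proportional (x := fun j => if j ∈ Ap then c j else -c' j) (by
      rw [Finset.sum_union hdisj]
      have e1 : ∑ i ∈ Am, (if i ∈ Ap then c i else -c' i) • V (k + i) = -x := by
        rw [← hc', ← Finset.sum_neg_distrib]
        exact Finset.sum_congr rfl fun i hi => by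
          rw [if_neg (Finset.disjoint_right.1 hdisj hi), neg_smul]
      have e2 : ∑ i ∈ Ap, (if i ∈ Ap then c i else -c' i) • V (k + i) = x := by
        rw [← hc]
        exact Finset.sum_congr rfl fun i hi => by rw [if_pos hi]
      rw [e1, e2, add_neg_cancel]) hrel ⟨i, Finset.mem_union_left _ hi,
        ha i (Finset.mem_union_left _ hi)⟩
    rw [Submodule.mem_span_singleton]
    refine ⟨t, ?_⟩
    rw [← hc, pent, Finset.smul_sum]
    refine Finset.sum_congr rfl fun j hj => ?_
    have := ht j (Finset.mem_union_left _ hj)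
    rw [if_pos hj] at this
    rw [this, mul_smul]
  · rw [Submodule.span_singleton_le_iff_mem]
    refine ⟨(hmem _ _).2 ⟨fun j => a j k, rfl⟩, (hmem _ _).2 ⟨fun j => -a j k, ?_⟩⟩
    rw [Finset.sum_union hdisj] at hrel
    simp only [neg_smul, Finset.sum_neg_distrib]
    exact neg_eq_of_add_eq_zero_left hrel

theorem isPentagramImage_iff (hdisj : Disjoint Ap Am) (hp : Ap.Nonempty) {v v' : ℤ → RP r}
    (hV : IsLift V v) (hg : ∀ k, GenPos (Ap ∪ Am) V k)
    (ha : ∀ j ∈ Ap ∪ Am, ∀ k, a j k ≠ 0) (hrel : Rel (Ap ∪ Am) a V) :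
    IsPentagramImage Ap Am v v' ↔
      ∀ k, (v' k).submodule = Submodule.span ℝ {pent Ap a V k} := by
  refine forall_congr' fun k => ?_
  have : ∀ j, (v (k + j)).submodule = Submodule.span ℝ {V (k + j)} := fun j => by
    rw [← (hV _).2, submodule_pt (hV _).1]
  simp only [this]
  rw [iSup_inf_iSup_eq hdisj hp (hg k) (fun j hj => ha j hj k) (hrel k)]

theorem isPentagramImage_pt (hdisj : Disjoint Ap Am) (hp : Ap.Nonempty) (hm : Am.Nonempty)
    {v : ℤ → RP r} (hV : IsLift V v) (hg : ∀ k, GenPos (Ap ∪ Am) V k)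
    (ha : ∀ j ∈ Ap ∪ Am, ∀ k, a j k ≠ 0) (hrel : Rel (Ap ∪ Am) a V) :
    IsPentagramImage Ap Am v (fun k => pt (pent Ap a V k)) :=
  (isPentagramImage_iff hdisj hp hV hg ha hrel).2 fun k =>
    submodule_pt (pent_ne_zero hp hm hdisj (hg k) fun j hj => ha j hj k)

/-- The pentagram map commutes with projections. -/
theorem IsProjectionOf.pentagramImage {D d : ℕ} (hdisj : Disjoint Ap Am) (hp : Ap.Nonempty)
    {hi : ℤ} (hi_mem : hi ∈ Ap ∪ Am)
    {w w' : ℤ → RP D} {v v' : ℤ → RP d} (h : IsProjectionOf w v)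
    (hc : IsCorrugated (Ap ∪ Am) w) (hg : InGeneralPosition (Ap ∪ Am) v)
    (hv : IsPentagramImage Ap Am v v') (hw : IsPentagramImage Ap Am w w') :
    IsProjectionOf w' v' := by
  obtain ⟨W, hW⟩ := Pentagram.exists_isLift w
  obtain ⟨P, hs, hP⟩ := h.exists_isLift hW
  have hgP := (inGeneralPosition_iff hP).1 hg
  have hgW : ∀ k, GenPos (Ap ∪ Am) W k := fun k => (hgP k).map_injective P
  obtain ⟨hrel, hne⟩ := rel_nrow_of_corrugated hi_mem hW hc ((inGeneralPosition_iff hW).2 hgW)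
  -- The row of `W` also annihilates its projection, so a single operator computes both pentagram
  -- images.
  rw [isPentagramImage_iff hdisj hp hW hgW hne hrel] at hw
  rw [isPentagramImage_iff hdisj hp hP hgP hne (hrel.map P)] at hv
  refine ⟨P, hs, fun i => ?_⟩
  rw [hv, hw, Submodule.map_span, Set.image_singleton, map_pent]

end Pent

end Pentagram

namespace Pentagram

/-! ### Classes of functions closed under rational operations -/

/-- A class of real functions that contains the constants and is closed under the field operations
(inversion being restricted to functions that do not vanish at the base point `t₀`), such that a
function of the class that does not vanish at `t₀` does not vanish along the filter `𝓕`. -/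
structure FunClass {T : Type*} (C : (T → ℝ) → Prop) (t₀ : T) (𝓕 : Filter T) : Prop where
  const : ∀ c : ℝ, C fun _ => c
  add : ∀ {f g : T → ℝ}, C f → C g → C fun t => f t + g t
  mul : ∀ {f g : T → ℝ}, C f → C g → C fun t => f t * g t
  inv : ∀ {f : T → ℝ}, C f → f t₀ ≠ 0 → C fun t => (f t)⁻¹
  ne : ∀ {f : T → ℝ}, C f → f t₀ ≠ 0 → ∀ᶠ t in 𝓕, f t ≠ 0

/-- The instance used for continuity and openness at a given polygon. -/
theorem funClass_continuousAt {T : Type*} [TopologicalSpace T] (t₀ : T) :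
    FunClass (fun f => ContinuousAt f t₀) t₀ (𝓝 t₀) where
  const _ := continuousAt_const
  add hf hg := hf.add hg
  mul hf hg := hf.mul hg
  inv hf h := hf.inv₀ h
  ne hf h := hf.eventually_ne h

/-- The instance used for density: the model sits at t = 1 and an arbitrary polygon at t = 0. By the
identity theorem a function that is nonzero at 1 has finite order at 0, hence is nonzero on a
punctured neighbourhood of 0. -/
theorem funClass_meromorphic :
    FunClass (fun f : ℝ → ℝ => Meromorphic f ∧ AnalyticAt ℝ f 1) 1 (𝓝[≠] 0) where
  const c := ⟨fun _ => MeromorphicAt.const c _, analyticAt_const⟩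
  add hf hg := ⟨fun x => (hf.1 x).add (hg.1 x), hf.2.add hg.2⟩
  mul hf hg := ⟨fun x => (hf.1 x).mul (hg.1 x), hf.2.mul hg.2⟩
  inv hf h := ⟨fun x => (hf.1 x).inv, hf.2.inv h⟩
  ne {f} hf h := by
    rw [← meromorphicOrderAt_ne_top_iff_eventually_ne_zero (hf.1 0)]
    refine hf.1.meromorphicOn.meromorphicOrderAt_ne_top_of_isPreconnected (U := Set.univ)
      isPreconnected_univ (Set.mem_univ (1 : ℝ)) (Set.mem_univ _) ?_
    rw [meromorphicOrderAt_ne_top_iff_eventually_ne_zero (hf.1 1)]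
    exact (hf.2.continuousAt.eventually_ne h).filter_mono nhdsWithin_le_nhds

namespace FunClass

variable {T : Type*} {C : (T → ℝ) → Prop} {t₀ : T} {𝓕 : Filter T}

theorem neg (h : FunClass C t₀ 𝓕) {f : T → ℝ} (hf : C f) : C fun t => -f t := by
  simpa only [neg_one_mul] using h.mul (h.const (-1)) hf

theorem sub (h : FunClass C t₀ 𝓕) {f g : T → ℝ} (hf : C f) (hg : C g) :
    C fun t => f t - g t := by
  simpa only [sub_eq_add_neg] using h.add hf (h.neg hg)

theorem div (h : FunClass C t₀ 𝓕) {f g : T → ℝ} (hf : C f) (hg : C g) (h0 : g t₀ ≠ 0) :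
    C fun t => f t / g t := by
  simpa only [div_eq_mul_inv] using h.mul hf (h.inv hg h0)

theorem sum (h : FunClass C t₀ 𝓕) {ι : Type*} (s : Finset ι) {f : ι → T → ℝ}
    (hf : ∀ i ∈ s, C (f i)) : C fun t => ∑ i ∈ s, f i t := by
  classical
  induction s using Finset.induction_on with
  | empty => simpa using h.const 0
  | insert i s his ih =>
    simp only [Finset.sum_insert his]
    exact h.add (hf i (Finset.mem_insert_self _ _))
      (ih fun j hj => hf j (Finset.mem_insert_of_mem hj))

theorem prod (h : FunClass C t₀ 𝓕) {ι : Type*} (s : Finset ι) {f : ι → T → ℝ}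
    (hf : ∀ i ∈ s, C (f i)) : C fun t => ∏ i ∈ s, f i t := by
  classical
  induction s using Finset.induction_on with
  | empty => simpa using h.const 1
  | insert i s his ih =>
    simp only [Finset.prod_insert his]
    exact h.mul (hf i (Finset.mem_insert_self _ _))
      (ih fun j hj => hf j (Finset.mem_insert_of_mem hj))

/-! ### Matrix operations within a class of functions. -/

section Matrix

variable {l m k : Type*} [Fintype m]

theorem matrixMul (h : FunClass C t₀ 𝓕) {A : T → Matrix l m ℝ} {B : T → Matrix m k ℝ}
    (hA : ∀ i j, C fun t => A t i j) (hB : ∀ i j, C fun t => B t i j) (i : l) (j : k) :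
    C fun t => (A t * B t) i j := by
  simp only [Matrix.mul_apply]
  exact h.sum _ fun x _ => h.mul (hA _ _) (hB _ _)

theorem mulVec (h : FunClass C t₀ 𝓕) {A : T → Matrix l m ℝ} {x : T → m → ℝ}
    (hA : ∀ i j, C fun t => A t i j) (hx : ∀ i, C fun t => x t i) (i : l) :
    C fun t => (A t).mulVec (x t) i := by
  simp only [Matrix.mulVec, dotProduct]
  exact h.sum _ fun j _ => h.mul (hA _ _) (hx _)

theorem det [Fintype l] [DecidableEq l] (h : FunClass C t₀ 𝓕) {A : T → Matrix l l ℝ}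
    (hA : ∀ i j, C fun t => A t i j) : C fun t => (A t).det := by
  simp only [Matrix.det_apply']
  exact h.sum _ fun σ _ => h.mul (h.const _) (h.prod _ fun i _ => hA _ _)

theorem matrixInv [Fintype l] [DecidableEq l] (h : FunClass C t₀ 𝓕) {A : T → Matrix l l ℝ}
    (hA : ∀ i j, C fun t => A t i j) (h0 : (A t₀).det ≠ 0) (i j : l) :
    C fun t => (A t)⁻¹ i j := by
  simp only [Matrix.inv_def, Ring.inverse_eq_inv', Matrix.smul_apply, smul_eq_mul,
    Matrix.adjugate_apply]
  refine h.mul (h.inv (h.det hA) h0) (h.det fun i' j' => ?_)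
  by_cases hj : i' = j
  · subst hj
    simpa only [Matrix.updateRow_self] using h.const _
  · simpa only [Matrix.updateRow_ne hj] using hA i' j'

theorem gram {p q : Type*} [Fintype p] (h : FunClass C t₀ 𝓕) {B : T → Matrix p q ℝ}
    (hB : ∀ i j, C fun t => B t i j) (i j : q) :
    C fun t => ((B t).transpose * B t) i j :=
  h.matrixMul (fun i j => by simpa only [Matrix.transpose_apply] using hB j i) hB i j

/-- Injectivity of a matrix is an open condition. -/
theorem eventually_injective [Fintype l] (h : FunClass C t₀ 𝓕) {B : T → Matrix l m ℝ}
    (hB : ∀ i j, C fun t => B t i j) (h0 : Function.Injective (B t₀).mulVec) :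
    ∀ᶠ t in 𝓕, Function.Injective (B t).mulVec := by
  classical
  filter_upwards [h.ne (h.det (h.gram hB)) (det_gram_ne_zero_iff.2 h0)] with t ht
  exact det_gram_ne_zero_iff.1 ht

theorem lsq [Fintype l] [DecidableEq m] (h : FunClass C t₀ 𝓕) {B : T → Matrix l m ℝ} {y : T → l → ℝ}
    (hB : ∀ i j, C fun t => B t i j) (hy : ∀ i, C fun t => y t i)
    (h0 : Function.Injective (B t₀).mulVec) (i : m) :
    C fun t => Pentagram.lsq (B t) (y t) i :=
  h.mulVec (h.matrixInv (h.gram hB) (det_gram_ne_zero_iff.2 h0))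
    (h.mulVec (fun i j => by simpa only [Matrix.transpose_apply] using hB j i) hy) i

/-- Linear independence is an open condition. -/
theorem eventually_linearIndependent [Fintype l] (h : FunClass C t₀ 𝓕) {f : T → m → l → ℝ}
    (hf : ∀ i s, C fun t => f t i s) (h0 : LinearIndependent ℝ (f t₀)) :
    ∀ᶠ t in 𝓕, LinearIndependent ℝ (f t) := by
  have hiff : ∀ t, Function.Injective (Matrix.of fun s i => f t i s).mulVec ↔
      LinearIndependent ℝ (f t) := fun t => Matrix.mulVec_injective_iff
  filter_upwards [h.eventually_injective (B := fun t => Matrix.of fun s i => f t i s)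
    (fun i j => hf j i) ((hiff t₀).2 h0)] with t ht
  exact (hiff t).1 ht

end Matrix

/-! ### Relations, fundamental solutions and pentagram images depending on a parameter. -/

section Sequences

variable {r : ℕ} {A : Finset ℤ} {lo hi : ℤ} {D : ℕ}

theorem eventually_genPos (h : FunClass C t₀ 𝓕) {V : T → ℤ → Vec r}
    (hV : ∀ i s, C fun t => V t i s) {k : ℤ} (h0 : GenPos A (V t₀) k) :
    ∀ᶠ t in 𝓕, GenPos A (V t) k := by
  unfold GenPos
  rw [Finset.eventually_all]
  intro j₀ hj₀
  exact h.eventually_linearIndependent (fun _ s => hV _ s) (h0 j₀ hj₀)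

theorem eventually_window (h : FunClass C t₀ 𝓕) {W : T → ℤ → Vec r}
    (hW : ∀ i s, C fun t => W t i s) {k : ℤ}
    (h0 : LinearIndependent ℝ (fun i : Fin (r + 1) => W t₀ (k + ((i : ℕ) : ℤ)))) :
    ∀ᶠ t in 𝓕, LinearIndependent ℝ (fun i : Fin (r + 1) => W t (k + ((i : ℕ) : ℤ))) :=
  h.eventually_linearIndependent (fun _ s => hW _ s) h0

theorem nrow (h : FunClass C t₀ 𝓕) {V : T → ℤ → Vec r} (hV : ∀ i s, C fun t => V t i s)
    (hi_mem : hi ∈ A) {k : ℤ} (h0 : GenPos A (V t₀) k) (j : ℤ) :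
    C fun t => Pentagram.nrow A hi (V t) j k := by
  unfold Pentagram.nrow
  split_ifs with hj
  · exact h.lsq (fun s _ => hV _ s) (fun s => hV _ s)
      ((colMat_injective_iff _ _ _).2 (h0 hi hi_mem)) _
  · exact h.const _
  · exact h.const _

theorem solveNat (h : FunClass C t₀ 𝓕) {α : T → ℕ → ℕ → ℝ} (hα : ∀ s k, C fun t => α t s k)
    (h0 : ∀ k, α t₀ (D + 1) k ≠ 0) (init : ℕ → Vec r) (i : ℕ) (s : Fin (r + 1)) :
    C fun t => Pentagram.solveNat D (α t) init i s := by
  induction i using Nat.strong_induction_on with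
  | _ i ih =>
    by_cases hi : i ≤ D
    · simp only [solveNat_of_le hi]
      exact h.const _
    · obtain ⟨k, rfl⟩ : ∃ k, i = k + (D + 1) := ⟨i - (D + 1), by omega⟩
      simp only [solveNat_add, Pi.smul_apply, Finset.sum_apply, smul_eq_mul]
      exact h.mul (h.neg (h.inv (hα _ _) (h0 k)))
        (h.sum _ fun x _ => h.mul (hα _ _) (ih _ (by omega)))

theorem fundSol (h : FunClass C t₀ 𝓕) (hA : IsSpan A lo hi D) {a : T → ℤ → ℤ → ℝ}
    (ha : ∀ j ∈ A, ∀ k, C fun t => a t j k) (hlo : ∀ k, a t₀ lo k ≠ 0)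
    (hhi : ∀ k, a t₀ hi k ≠ 0) (i : ℤ) (s : Fin (D + 1)) :
    C fun t => Pentagram.fundSol A lo D (a t) i s := by
  have hh := hA.hi_eq
  unfold Pentagram.fundSol
  split_ifs with h0
  · refine h.solveNat (α := fun t s k => if lo + (s : ℤ) ∈ A then a t (lo + s) (k - lo) else 0)
      (fun s k => ?_) (fun k => ?_) _ _ _
    · split_ifs with hs
      · exact ha _ hs _
      · exact h.const 0
    · have : lo + ((D + 1 : ℕ) : ℤ) = hi := by push_cast; omega
      simp only [this]
      rw [if_pos hA.hi_mem]; exact hhi _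
  · refine h.solveNat (α := fun t s k => if lo + D + 1 - (s : ℤ) ∈ A then
      a t (lo + D + 1 - s) (-1 - k - lo) else 0) (fun s k => ?_) (fun k => ?_) _ _ _
    · split_ifs with hs
      · exact ha _ hs _
      · exact h.const 0
    · have : lo + D + 1 - ((D + 1 : ℕ) : ℤ) = lo := by push_cast; omega
      simp only [this]
      rw [if_pos hA.lo_mem]; exact hlo _

theorem pent (h : FunClass C t₀ 𝓕) {Ap : Finset ℤ} {a : T → ℤ → ℤ → ℝ} {V : T → ℤ → Vec r}
    (ha : ∀ j ∈ Ap, ∀ k, C fun t => a t j k) (hV : ∀ i s, C fun t => V t i s) (k : ℤ)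
    (s : Fin (r + 1)) : C fun t => Pentagram.pent Ap (a t) (V t) k s := by
  simp only [Pentagram.pent, Finset.sum_apply, Pi.smul_apply, smul_eq_mul]
  exact h.sum _ fun j hj => h.mul (ha j hj k) (hV _ _)

end Sequences

end FunClass

/-! ### Continuity of the corrugation map -/

section Continuity

variable {n : ℕ} {A : Finset ℤ} {lo hi : ℤ} {D d r : ℕ}

theorem exists_sections {v₀ : ℤ → RP r} {V₀ : ℤ → Vec r} (h : IsLift V₀ v₀) :
    ∃ s : ℤ → RP r → Vec r, (∀ i p, s i p ≠ 0 ∧ pt (s i p) = p) ∧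
      (∀ i, ContinuousAt (s i) (v₀ i)) ∧ ∀ i, s i (v₀ i) = V₀ i := by
  have := fun i => exists_section (h i).1
  choose s h1 h2 h3 using this
  refine ⟨s, h1, fun i => ?_, fun i => ?_⟩
  · rw [← (h i).2]; exact h2 i
  · rw [← (h i).2]; exact h3 i

theorem exists_lifts {T : Type*} [TopologicalSpace T] {t₀ : T} {v : T → ℤ → RP r}
    (hv : ∀ i, ContinuousAt (fun t => v t i) t₀) {V₀ : ℤ → Vec r} (h : IsLift V₀ (v t₀)) :
    ∃ V : T → ℤ → Vec r, (∀ t, IsLift (V t) (v t)) ∧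
      (∀ i s, ContinuousAt (fun t => V t i s) t₀) ∧ V t₀ = V₀ := by
  obtain ⟨s, h1, h2, h3⟩ := exists_sections h
  refine ⟨fun t i => s i (v t i), fun t i => h1 i _, fun i j => ?_, funext h3⟩
  exact (continuous_apply j).continuousAt.comp (ContinuousAt.comp (h2 i) (hv i))

theorem continuousAt_coord_generic (v₀ : GenericPolygon n A d) (i : ℤ) :
    ContinuousAt (fun v : GenericPolygon n A d => v.1 i) v₀ :=
  ((continuous_apply i).comp continuous_subtype_val).continuousAt

theorem continuousAt_coord_corrugated (w₀ : CorrugatedPolygon n A D) (i : ℤ) :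
    ContinuousAt (fun w : CorrugatedPolygon n A D => w.1 i) w₀ :=
  ((continuous_apply i).comp continuous_subtype_val).continuousAt

theorem continuousAt_corrugated_iff {T : Type*} [TopologicalSpace T] {t₀ : T}
    {w : T → CorrugatedPolygon n A D} :
    ContinuousAt w t₀ ↔ ∀ i, ContinuousAt (fun t => (w t).1 i) t₀ :=
  IsInducing.subtypeVal.continuousAt_iff.trans continuousAt_pi

theorem continuousAt_pt_of_coord {T : Type*} [TopologicalSpace T] {t₀ : T} {x : T → Vec r}
    (hx : ∀ s, ContinuousAt (fun t => x t s) t₀) (h0 : x t₀ ≠ 0) :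
    ContinuousAt (fun t => pt (x t)) t₀ :=
  ContinuousAt.comp (continuousAt_pt h0) (continuousAt_pi.2 hx)

/-- The normalized rows are rational in the lift and the fundamental solution is rational in the
rows, while the lift can be chosen continuous at any given polygon. -/
theorem continuous_corrugation (h : IsData n A lo hi D d) : Continuous (corrugation h) := by
  refine (isOpenQuotientMap_genericCls n A d).isQuotientMap.continuous_iff.2 ?_
  rw [continuous_iff_continuousAt]
  intro v₀
  obtain ⟨V₀, hV₀⟩ := exists_isLift v₀.1
  obtain ⟨V, hV, hVc, rfl⟩ := exists_lifts (T := GenericPolygon n A d)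
    (v := fun v => v.1) (continuousAt_coord_generic v₀) hV₀
  let w : GenericPolygon n A d → CorrugatedPolygon n A D := fun v =>
    ⟨_, fundSol_mem_corrugated h (hV v) v.2.2 v.2.1⟩
  have hw : corrugation h ∘ GenericPolygon.cls = CorrugatedPolygon.cls ∘ w := by
    ext1 v
    exact (corrugation_eq_iff h v (w v)).2 (fundSol_projection h (hV v) v.2.2).2
  rw [hw]
  refine (isOpenQuotientMap_corrugatedCls n A D).continuous.continuousAt.comp ?_
  rw [continuousAt_corrugated_iff]
  intro i
  have hg := (inGeneralPosition_iff hV₀).1 v₀.2.2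
  have hsol := (fundSol_projection h hV₀ v₀.2.2).1
  have hc := funClass_continuousAt v₀
  refine continuousAt_pt_of_coord (fun s => ?_) (hsol.isLift i).1
  exact hc.fundSol h.toIsSpan (fun j _ k => hc.nrow hVc h.hi_mem (hg k) j)
    (hsol.ne _ h.lo_mem) (hsol.ne _ h.hi_mem) i s

end Continuity

end Pentagram

namespace Pentagram

/-! ### Open maps with finite fibers are generically coverings -/

section Covering

variable {X Y : Type*} [TopologicalSpace X] [TopologicalSpace Y] {F : X → Y} {O₁ : Set Y}

theorem isOpen_image_of_nhds_le (hopen : ∀ x, F x ∈ O₁ → 𝓝 (F x) ≤ map F (𝓝 x)) {W : Set X}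
    (hW : IsOpen W) (hWO : W ⊆ F ⁻¹' O₁) : IsOpen (F '' W) := by
  rw [isOpen_iff_mem_nhds]
  rintro _ ⟨x, hx, rfl⟩
  exact hopen x (hWO hx) (image_mem_map (hW.mem_nhds hx))

/-- Separate the points over `y` by disjoint open sets. Openness puts at least one point of every
nearby fiber into each of them, and equality of cardinalities leaves room for exactly one, so these
sets are the sheets. -/
theorem isEvenlyCovered_of_ncard [T2Space X] (hF : Continuous F)
    (hopen : ∀ x, F x ∈ O₁ → 𝓝 (F x) ≤ map F (𝓝 x)) {y : Y} {U₀ : Set Y} (hU₀ : IsOpen U₀)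
    (hy : y ∈ U₀) (hUO : U₀ ⊆ O₁) (hfin : ∀ z ∈ U₀, (F ⁻¹' {z}).Finite)
    (hcard : ∀ z ∈ U₀, (F ⁻¹' {z}).ncard = (F ⁻¹' {y}).ncard) :
    IsEvenlyCovered F y (F ⁻¹' {y}) := by
  obtain ⟨U, hU, hdisj⟩ := (hfin y hy).t2_separation
  have : Finite (F ⁻¹' {y}) := hfin y hy
  let U' : F ⁻¹' {y} → Set X := fun x => U x ∩ F ⁻¹' U₀
  have hU' : ∀ x, IsOpen (U' x) := fun x => (hU x).2.inter (hU₀.preimage hF)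
  have hU'O : ∀ x, U' x ⊆ F ⁻¹' O₁ := fun x e he => hUO he.2
  have hdisj' : Pairwise (Function.onFun Disjoint U') := fun x x' hne =>
    (hdisj x.2 x'.2 (fun h => hne (Subtype.ext h))).mono Set.inter_subset_left
      Set.inter_subset_left
  let V : Set Y := U₀ ∩ ⋂ x, F '' U' x
  have hV : IsOpen V := hU₀.inter (isOpen_iInter_of_finite fun x =>
    isOpen_image_of_nhds_le hopen (hU' x) (hU'O x))
  have hyV : y ∈ V := ⟨hy, Set.mem_iInter.2 fun x =>
    ⟨x, ⟨(hU x).1, by rw [Set.mem_preimage, (x.2 : F x = y)]; exact hy⟩, x.2⟩⟩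
  have hsec : ∀ z ∈ V, ∃ s : F ⁻¹' {y} → X, (∀ x, s x ∈ U' x ∧ F (s x) = z) ∧
      ∀ e, F e = z → ∃ x, e = s x := by
    intro z hz
    have h1 : ∀ x, ∃ e, e ∈ U' x ∧ F e = z := fun x => Set.mem_iInter.1 hz.2 x
    choose s hs using h1
    have hinj : Function.Injective s := fun x x' hxx => by
      by_contra hne
      exact Set.disjoint_left.1 (hdisj' hne) (hs x).1 (hxx ▸ (hs x').1)
    refine ⟨s, hs, ?_⟩
    have hsub : Set.range s ⊆ F ⁻¹' {z} := by
      rintro _ ⟨x, rfl⟩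
      exact (hs x).2
    have heq := Set.eq_of_subset_of_ncard_le hsub (by
      rw [hcard z hz.1, ← Set.image_univ, Set.ncard_image_of_injective _ hinj, Set.ncard_univ,
        Nat.card_coe_set_eq]) (hfin z hz.1)
    intro e he
    have : e ∈ F ⁻¹' {z} := he
    rw [← heq] at this
    obtain ⟨x, hx⟩ := this
    exact ⟨x, hx.symm⟩
  have hdisc : DiscreteTopology (F ⁻¹' {y}) := inferInstance
  -- Over the reals the fiber may be empty; then the fibers over `V` are empty as well.
  rcases isEmpty_or_nonempty (F ⁻¹' {y}) with hemp | hne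
  · refine IsEvenlyCovered.of_preimage_eq_empty _ (hV.mem_nhds hyV) ?_
    rw [Set.eq_empty_iff_forall_notMem]
    intro e he
    obtain ⟨s, -, hs⟩ := hsec _ he
    obtain ⟨x, -⟩ := hs e rfl
    exact hemp.elim x
  · have : Nonempty X := ⟨(Classical.arbitrary (F ⁻¹' {y})).1⟩
    have hmem : ∀ x e, e ∈ U' x → F e ∈ V → ∀ s : F ⁻¹' {y} → X,
        (∀ x, s x ∈ U' x ∧ F (s x) = F e) → (∀ e', F e' = F e → ∃ x, e' = s x) → e = s x := by
      intro x e he hV s hs hs'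
      obtain ⟨x', hx'⟩ := hs' e rfl
      by_cases hxx : x' = x
      · rw [← hxx, hx']
      · exact (Set.disjoint_left.1 (hdisj' hxx) (hx' ▸ (hs x').1) he).elim
    refine IsEvenlyCovered.of_trivialization (t := hV.trivializationDiscrete
      (fun x => U' x ∩ F ⁻¹' V) V (fun x W hW => ⟨fun h => ?_, fun h => ?_⟩) (fun x => ?_)
      (fun x => ?_) ?_ ?_) hyV
    · exact (h.preimage hF).inter ((hU' x).inter (hV.preimage hF))
    · have : W = F '' (F ⁻¹' W ∩ (U' x ∩ F ⁻¹' V)) := by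
        ext z
        constructor
        · intro hz
          obtain ⟨s, hs, -⟩ := hsec z (hW hz)
          refine ⟨s x, ⟨?_, (hs x).1, ?_⟩, (hs x).2⟩
          · rw [Set.mem_preimage, (hs x).2]; exact hz
          · rw [Set.mem_preimage, (hs x).2]; exact hW hz
        · rintro ⟨e, he, rfl⟩
          exact he.1
      rw [this]
      exact isOpen_image_of_nhds_le hopen h fun e he => hU'O x he.2.1
    · intro e he e' he' hee
      obtain ⟨s, hs, hs'⟩ := hsec _ he.2
      rw [hmem x e he.1 he.2 s hs hs', hmem x e' he'.1 he'.2 s (by rwa [← hee]) (by rwa [← hee])]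
    · intro z hz
      obtain ⟨s, hs, -⟩ := hsec z hz
      refine ⟨s x, ⟨(hs x).1, ?_⟩, (hs x).2⟩
      rw [Set.mem_preimage, (hs x).2]; exact hz
    · exact fun x x' hne => (hdisj' hne).mono Set.inter_subset_left Set.inter_subset_left
    · intro e he
      obtain ⟨s, hs, hs'⟩ := hsec _ he
      obtain ⟨x, hx⟩ := hs' e rfl
      exact Set.mem_iUnion.2 ⟨x, by rw [hx]; exact (hs x).1, he⟩

/-- A continuous map on a Hausdorff space that is open over a dense open set, with fibers of
bounded cardinality there, is a covering over a smaller dense open set. -/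
theorem exists_isFiniteRamifiedCovering [T2Space X] (hF : Continuous F) (ho : IsOpen O₁)
    (hd : Dense O₁) (hpre : Dense (F ⁻¹' O₁))
    (hopen : ∀ x, F x ∈ O₁ → 𝓝 (F x) ≤ map F (𝓝 x)) {N : ℕ}
    (hN : ∀ y ∈ O₁, (F ⁻¹' {y}).encard ≤ N) : ∃ O ⊆ O₁, IsFiniteRamifiedCovering F O := by
  have hfin : ∀ y ∈ O₁, (F ⁻¹' {y}).Finite := fun y hy =>
    Set.finite_of_encard_le_coe (hN y hy)
  have hncard : ∀ y ∈ O₁, (F ⁻¹' {y}).ncard ≤ N := fun y hy => by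
    have := hN y hy
    rwa [← (hfin y hy).cast_ncard_eq, Nat.cast_le] at this
  -- Lower semicontinuity: disjoint neighbourhoods of the points over `y` have images that are
  -- neighbourhoods of `y`, so every nearby fiber meets each of them.
  have hlsc : ∀ y ∈ O₁, ∀ᶠ z in 𝓝 y, (F ⁻¹' {y}).ncard ≤ (F ⁻¹' {z}).ncard := by
    intro y hy
    obtain ⟨U, hU, hdisj⟩ := (hfin y hy).t2_separation
    have h1 : ∀ᶠ z in 𝓝 y, ∀ x ∈ F ⁻¹' {y}, z ∈ F '' U x := by
      rw [eventually_all_finite (hfin y hy)]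
      intro x hx
      have hx' : F x = y := hx
      rw [← hx'] at hy ⊢
      exact hopen x hy (image_mem_map ((hU x).2.mem_nhds (hU x).1))
    filter_upwards [h1, ho.mem_nhds hy] with z hz hzO
    choose! s hs using hz
    refine Set.ncard_le_ncard_of_injOn s (fun x hx => (hs x hx).2) ?_ (hfin z hzO)
    intro x hx x' hx' hxx
    by_contra hne
    exact Set.disjoint_left.1 (hdisj hx hx' hne) (hs x hx).1 (hxx ▸ (hs x' hx').1)
  let O : Set Y := {y | ∃ U₀ : Set Y, IsOpen U₀ ∧ y ∈ U₀ ∧ U₀ ⊆ O₁ ∧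
    ∀ z ∈ U₀, (F ⁻¹' {z}).ncard = (F ⁻¹' {y}).ncard}
  have hOO : O ⊆ O₁ := fun y ⟨U₀, _, hy, hs, _⟩ => hs hy
  have hOopen : IsOpen O := by
    rw [isOpen_iff_forall_mem_open]
    rintro y ⟨U₀, hU₀, hy, hs, hc⟩
    exact ⟨U₀, fun z hz => ⟨U₀, hU₀, hz, hs, fun z' hz' => (hc z' hz').trans (hc z hz).symm⟩,
      hU₀, hy⟩
  have hOd : Dense O := by
    rw [dense_iff_inter_open]
    intro U hU hUne
    obtain ⟨y₀, hy₀⟩ := hd.inter_open_nonempty U hU hUne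
    -- The bounded cardinality attains a maximum on any nonempty open part, and by semicontinuity it
    -- is constant near a point where the maximum is attained.
    let S : Set ℕ := (fun y => (F ⁻¹' {y}).ncard) '' (U ∩ O₁)
    have hSb : BddAbove S := ⟨N, by rintro _ ⟨y, hy, rfl⟩; exact hncard y hy.2⟩
    obtain ⟨y, hy, hmax⟩ := Nat.sSup_mem (⟨_, y₀, hy₀, rfl⟩ : S.Nonempty) hSb
    obtain ⟨U₁, hU₁, hU₁o, hyU₁⟩ := mem_nhds_iff.1 (hlsc y hy.2)
    refine ⟨y, hy.1, U₁ ∩ (U ∩ O₁), hU₁o.inter (hU.inter ho), ⟨hyU₁, hy⟩, fun z hz => hz.2.2, ?_⟩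
    intro z hz
    refine le_antisymm ?_ (hU₁ hz.1)
    have := le_csSup hSb ⟨z, hz.2, rfl⟩
    rwa [← hmax] at this
  refine ⟨O, hOO, hF, hOopen, hOd, ?_, ?_, N, fun y hy => hN y (hOO hy)⟩
  · rw [dense_iff_inter_open]
    intro U hU hUne
    obtain ⟨x, hxU, hxO⟩ := hpre.inter_open_nonempty U hU hUne
    -- The image of a neighbourhood of `x` is a neighbourhood of `F x`, so it meets the dense set
    -- `O`.
    have h1 : F '' (U ∩ F ⁻¹' O₁) ∈ 𝓝 (F x) := hopen x hxO
      (image_mem_map ((hU.inter (ho.preimage hF)).mem_nhds ⟨hxU, hxO⟩))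
    obtain ⟨_, ⟨e, he, rfl⟩, hO⟩ := mem_closure_iff_nhds.1 (hOd (F x)) _ h1
    exact ⟨e, he.1, hO⟩
  · rintro y ⟨U₀, hU₀, hy, hs, hc⟩
    exact isEvenlyCovered_of_ncard hF hopen hU₀ hy hs (fun z hz => hfin z (hs hz)) hc

end Covering

/-! ### The space of generic polygons is Hausdorff -/

section Hausdorff

variable {n : ℕ} {A : Finset ℤ} {lo hi : ℤ} {D d : ℕ}

/-- Homogeneous coordinates of `V i` in the projective frame `V j`, `j ∈ A`. -/
def frameCoord (A : Finset ℤ) (hi : ℤ) (V : ℤ → Vec d) (i : ℤ) (j : {j // j ∈ A.erase hi}) : ℝ :=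
  -- Dividing by the row makes `V hi` the unit point of the frame. A change of lift then multiplies
  -- all coordinates of `V i` by one common factor.
  lsq (colMat (A.erase hi) V 0) (V i) j / nrow A hi V j 0

theorem frameCoord_eq (hcard : A.card = d + 2) (hi_mem : hi ∈ A) {V : ℤ → Vec d}
    (hg : ∀ k, GenPos A V k) (i : ℤ) :
    V i = ∑ j, (frameCoord A hi V i j * nrow A hi V j 0) • V j := by
  have hspan := span_eq_top_of_genPos hcard hi_mem (hg 0)
  have hmem : V i ∈ Submodule.span ℝ (Set.range fun j : {j // j ∈ A.erase hi} => V (0 + j.1)) := by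
    rw [hspan]; trivial
  obtain ⟨c, hc⟩ := (Submodule.mem_span_range_iff_exists_fun ℝ).1 hmem
  have hl : lsq (colMat (A.erase hi) V 0) (V i) = c :=
    lsq_eq ((colMat_injective_iff _ _ _).2 (hg 0 hi hi_mem)) (by rw [colMat_mulVec, hc])
  have hne := (rel_nrow_of_card hcard hi_mem hg).2
  conv_lhs => rw [← hc]
  refine Finset.sum_congr rfl fun j _ => ?_
  rw [frameCoord, hl, div_mul_cancel₀ _ (hne _ (Finset.mem_of_mem_erase j.2) _), zero_add]

theorem frameCoord_unique (hcard : A.card = d + 2) (hi_mem : hi ∈ A) {V : ℤ → Vec d}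
    (hg : ∀ k, GenPos A V k) {i : ℤ} {x : {j // j ∈ A.erase hi} → ℝ}
    (hx : V i = ∑ j, (x j * nrow A hi V j 0) • V j) : frameCoord A hi V i = x := by
  have hne := (rel_nrow_of_card hcard hi_mem hg).2
  have hl : lsq (colMat (A.erase hi) V 0) (V i) = fun j => x j * nrow A hi V j 0 :=
    lsq_eq ((colMat_injective_iff _ _ _).2 (hg 0 hi hi_mem)) (by
      rw [colMat_mulVec, hx]; simp only [zero_add])
  ext j
  rw [frameCoord, hl, mul_div_cancel_right₀ _ (hne _ (Finset.mem_of_mem_erase j.2) _)]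

/-- Two generic polygons are equivalent if and only if their frame coordinates are
proportional. -/
theorem projEquiv_iff_frameCoord (hcard : A.card = d + 2) (hi_mem : hi ∈ A) {V V' : ℤ → Vec d}
    {v v' : ℤ → RP d} (hV : IsLift V v) (hV' : IsLift V' v')
    (hg : ∀ k, GenPos A V k) (hg' : ∀ k, GenPos A V' k) :
    ProjEquiv v v' ↔ ∀ i j j', frameCoord A hi V i j * frameCoord A hi V' i j' =
      frameCoord A hi V i j' * frameCoord A hi V' i j := by
  obtain ⟨hrel, hne⟩ := rel_nrow_of_card hcard hi_mem hg
  obtain ⟨hrel', hne'⟩ := rel_nrow_of_card hcard hi_mem hg'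
  rw [projEquiv_iff hV hV']
  constructor
  · rintro ⟨g, hgV⟩
    choose c hc hcV using hgV
    have hrow := nrow_eq hi_mem (hg' 0) (x := fun j => nrow A hi V j 0 * c hi / c j) (by
      have : ∀ j, (nrow A hi V j 0 * c hi / c j) • V' (0 + j) =
          c hi • g (nrow A hi V j 0 • V (0 + j)) := fun j => by
        rw [zero_add, hcV j, smul_smul, map_smul, smul_smul, mul_comm (nrow A hi V j 0),
          div_mul_cancel₀ _ (hc j)]
      simp only [this, ← Finset.smul_sum, ← map_sum, hrel 0, map_zero, smul_zero]) (by
        rw [nrow_hi, mul_div_assoc, div_self (hc hi), mul_one])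
    have hfc : ∀ i, frameCoord A hi V' i = fun j => c i / c hi * frameCoord A hi V i j := by
      intro i
      apply frameCoord_unique hcard hi_mem hg'
      conv_lhs => rw [hcV i, frameCoord_eq hcard hi_mem hg i, map_sum, Finset.smul_sum]
      refine Finset.sum_congr rfl fun j _ => ?_
      rw [hrow j (Finset.mem_of_mem_erase j.2), hcV j, map_smul, smul_smul, smul_smul]
      congr 1
      have := hc j
      have := hc hi
      field_simp
    intro i j j'
    rw [hfc i]
    ring
  · intro h
    have e : ∀ {U : ℤ → Vec d} (hU : ∀ k, GenPos A U k),
        ∃ b : Module.Basis {j // j ∈ A.erase hi} ℝ (Vec d), ∀ j, b j = nrow A hi U j 0 • U j := by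
      intro U hU
      have hneU := (rel_nrow_of_card hcard hi_mem hU).2
      have hli := (hU 0 hi hi_mem).units_smul (fun j : {j // j ∈ A.erase hi} =>
        Units.mk0 (nrow A hi U j 0) (hneU _ (Finset.mem_of_mem_erase j.2) 0))
      have hcd : Fintype.card {j // j ∈ A.erase hi} = Module.finrank ℝ (Vec d) := by
        rw [Fintype.card_coe, Finset.card_erase_of_mem hi_mem, hcard]; simp
      have : Nonempty {j // j ∈ A.erase hi} := by
        rw [← Fintype.card_pos_iff, hcd]; simp
      refine ⟨basisOfLinearIndependentOfCardEqFinrank hli hcd, fun j => ?_⟩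
      rw [coe_basisOfLinearIndependentOfCardEqFinrank]
      simp [Units.smul_def]
    obtain ⟨b, hb⟩ := e hg
    obtain ⟨b', hb'⟩ := e hg'
    refine ⟨b.equiv b' (Equiv.refl _), fun i => ?_⟩
    have h1 : V i = ∑ j, frameCoord A hi V i j • b j := by
      conv_lhs => rw [frameCoord_eq hcard hi_mem hg i]
      simp only [hb, smul_smul]
    have h2 : V' i = ∑ j, frameCoord A hi V' i j • b' j := by
      conv_lhs => rw [frameCoord_eq hcard hi_mem hg' i]
      simp only [hb', smul_smul]
    obtain ⟨j₀, hj₀⟩ : ∃ j, frameCoord A hi V i j ≠ 0 := by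
      by_contra hcon
      push Not at hcon
      exact (hV i).1 (by rw [h1]; simp [hcon])
    have h3 : V' i = (frameCoord A hi V' i j₀ / frameCoord A hi V i j₀) •
        b.equiv b' (Equiv.refl _) (V i) := by
      rw [h1, h2, map_sum, Finset.smul_sum]
      refine Finset.sum_congr rfl fun j _ => ?_
      rw [map_smul, Module.Basis.equiv_apply, Equiv.refl_apply, smul_smul]
      congr 1
      have := h i j₀ j
      field_simp
      linarith
    refine ⟨_, ?_, h3⟩
    intro h0
    exact (hV' i).1 (by rw [h3, h0, zero_smul])

/-- Inequivalence means that some 2 × 2 minor of frame coordinates is nonzero, which is an open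
condition on pairs of polygons; hence the complement of the relation is open. -/
theorem t2Space_genericClass (h : IsData n A lo hi D d) : T2Space (GenericClass n A d) := by
  rw [t2Space_iff_of_isOpenQuotientMap (isOpenQuotientMap_genericCls n A d),
    ← isOpen_compl_iff, isOpen_iff_mem_nhds]
  rintro p₀ hp₀
  obtain ⟨V₁, hV₁⟩ := exists_isLift p₀.1.1
  obtain ⟨V₂, hV₂⟩ := exists_isLift p₀.2.1
  obtain ⟨V, hV, hVc, rfl⟩ := exists_lifts
    (T := GenericPolygon n A d × GenericPolygon n A d) (t₀ := p₀) (v := fun p => p.1.1)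
    (fun i => (continuousAt_coord_generic p₀.1 i).comp continuousAt_fst) hV₁
  obtain ⟨V', hV', hVc', rfl⟩ := exists_lifts
    (T := GenericPolygon n A d × GenericPolygon n A d) (t₀ := p₀) (v := fun p => p.2.1)
    (fun i => (continuousAt_coord_generic p₀.2 i).comp continuousAt_snd) hV₂
  have hg : ∀ p k, GenPos A (V p) k := fun p => (inGeneralPosition_iff (hV p)).1 p.1.2.2
  have hg' : ∀ p k, GenPos A (V' p) k := fun p => (inGeneralPosition_iff (hV' p)).1 p.2.2.2
  have hiff : ∀ p : GenericPolygon n A d × GenericPolygon n A d, p.1.cls = p.2.cls ↔ _ :=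
    fun p => Quotient.eq.trans (projEquiv_iff_frameCoord h.card h.hi_mem (hV p) (hV' p) (hg p)
      (hg' p))
  have hne : ¬ p₀.1.cls = p₀.2.cls := hp₀
  rw [hiff] at hne
  push Not at hne
  obtain ⟨i, j, j', hne⟩ := hne
  have hc := funClass_continuousAt p₀
  have hfc : ∀ {U : GenericPolygon n A d × GenericPolygon n A d → ℤ → Vec d},
      (∀ i s, ContinuousAt (fun p => U p i s) p₀) → (∀ k, GenPos A (U p₀) k) →
      ∀ j, ContinuousAt (fun p => frameCoord A hi (U p) i j) p₀ := by
    intro U hU hgU j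
    exact hc.div (hc.lsq (fun s _ => hU _ s) (fun s => hU _ s)
      ((colMat_injective_iff _ _ _).2 (hgU 0 hi h.hi_mem)) _)
      (hc.nrow hU h.hi_mem (hgU 0) _)
      ((rel_nrow_of_card h.card h.hi_mem hgU).2 _ (Finset.mem_of_mem_erase j.2) _)
  have hev := hc.ne (hc.sub (hc.mul (hfc hVc (hg p₀) j) (hfc hVc' (hg' p₀) j'))
    (hc.mul (hfc hVc (hg p₀) j') (hfc hVc' (hg' p₀) j))) (sub_ne_zero.2 hne)
  filter_upwards [hev] with p hp hpe
  exact hp (sub_eq_zero.2 ((hiff p).1 hpe i j j'))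

end Hausdorff

end Pentagram

namespace Pentagram

/-! ### The greatest common divisor of the differences -/

/-- `G` is the greatest common divisor of the differences of elements of `A`, and is coprime
to `n`. -/
structure Period (n : ℕ) (A : Finset ℤ) (G : ℕ) : Prop where
  pos : 0 < G
  dvd : ∀ i ∈ A, ∀ j ∈ A, (G : ℤ) ∣ i - j
  mem_iff : ∀ S : Set ℤ, (∀ i ∈ A, ∀ j ∈ A, ∀ x ∈ S, x + (i - j) ∈ S) →
    ∀ x : ℤ, x + G ∈ S ↔ x ∈ S
  coprime : Nat.Coprime n G

/-- The subgroup of ℤ generated by the differences is cyclic, and G is the absolute value of a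
generator. A set stable under the differences is invariant under the whole subgroup. -/
theorem exists_period {n : ℕ} {A : Finset ℤ} (hA : ∃ i ∈ A, ∃ j ∈ A, i ≠ j)
    (hcop : ∀ c : ℕ, c ∣ n → (∀ i ∈ A, ∀ j ∈ A, (c : ℤ) ∣ i - j) → c = 1) :
    ∃ G, Period n A G := by
  let Δ : Set ℤ := {x | ∃ i ∈ A, ∃ j ∈ A, x = i - j}
  let H := AddSubgroup.closure Δ
  obtain ⟨g, hg⟩ := Int.subgroup_cyclic H
  have hdvd : ∀ i ∈ A, ∀ j ∈ A, (g.natAbs : ℤ) ∣ i - j := by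
    intro i hi j hj
    have : i - j ∈ H := AddSubgroup.subset_closure ⟨i, hi, j, hj, rfl⟩
    rw [hg, AddSubgroup.mem_closure_singleton] at this
    obtain ⟨c, hc⟩ := this
    rw [Int.natAbs_dvd, ← hc, smul_eq_mul]
    exact dvd_mul_left _ _
  have hmem : ∀ S : Set ℤ, (∀ i ∈ A, ∀ j ∈ A, ∀ x ∈ S, x + (i - j) ∈ S) →
      ∀ h ∈ H, ∀ x, x + h ∈ S ↔ x ∈ S := by
    intro S hS h hh
    induction hh using AddSubgroup.closure_induction with
    | mem x hx =>
      obtain ⟨i, hi, j, hj, rfl⟩ := hx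
      refine fun x => ⟨fun h => ?_, hS i hi j hj x⟩
      have := hS j hj i hi _ h
      rwa [show x + (i - j) + (j - i) = x by ring] at this
    | zero => simp
    | add x y _ _ h1 h2 => intro z; rw [← add_assoc, h2, h1]
    | neg x _ h1 => intro z; rw [← h1]; simp
  have hgH : (g.natAbs : ℤ) ∈ H := by
    have : g ∈ H := by rw [hg]; exact AddSubgroup.mem_closure_singleton_self g
    rcases Int.natAbs_eq g with h | h
    · rwa [← h]
    · rw [← neg_neg (g.natAbs : ℤ), ← h]; exact H.neg_mem this
  refine ⟨g.natAbs, ?_, hdvd, fun S hS => hmem S hS _ hgH, ?_⟩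
  · obtain ⟨i, hi, j, hj, hij⟩ := hA
    rw [Nat.pos_iff_ne_zero]
    intro h0
    have := hdvd i hi j hj
    rw [h0] at this
    exact hij (sub_eq_zero.1 (by simpa using this))
  · refine hcop _ (Nat.gcd_dvd_left _ _) fun i hi j hj => ?_
    exact (Int.natCast_dvd_natCast.2 (Nat.gcd_dvd_right _ _)).trans (hdvd i hi j hj)

theorem Period.periodic {n G : ℕ} {A : Finset ℤ} (hG : Period n A G) {α : Type*} {e : ℤ → α}
    (he : ∀ k, ∀ i ∈ A, ∀ j ∈ A, e (k + i) = e (k + j)) : Function.Periodic e G := by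
  intro x
  refine (hG.mem_iff {y | e y = e x} (fun i hi j hj y hy => ?_) x).2 rfl
  have := he (y - j) i hi j hj
  rw [sub_add_cancel] at this
  change e (y + (i - j)) = e x
  rw [← hy, ← this]
  congr 1
  ring

theorem periodic_of_dvd {α : Type*} {e : ℤ → α} {G : ℕ} (he : Function.Periodic e G) {x y : ℤ}
    (h : (G : ℤ) ∣ x - y) : e x = e y := by
  obtain ⟨c, hc⟩ := h
  rw [← sub_add_cancel x y, hc, add_comm, mul_comm]
  exact he.int_mul c y

/-- By Bézout, 1 is an integral combination of n and G, so a sequence with both periods has period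
1. -/
theorem Period.const_of_periodic {n G : ℕ} {A : Finset ℤ} (hG : Period n A G) {α : Type*}
    {e : ℤ → α} (hn : Function.Periodic e n) (he : Function.Periodic e G) (x y : ℤ) :
    e x = e y := by
  have h1 : Function.Periodic e 1 := by
    have hb := Nat.gcd_eq_gcd_ab n G
    rw [hG.coprime] at hb
    push_cast at hb
    rw [hb, mul_comm (n : ℤ), mul_comm (G : ℤ)]
    exact (hn.int_mul _).add_period (he.int_mul _)
  have := h1.int_mul (x - y) y
  rw [← this]
  simp

/-! ### Monodromies -/

section Mono

variable {n G : ℕ} {A : Finset ℤ} {lo hi : ℤ} {D : ℕ} {a : ℤ → ℤ → ℝ} {W : ℤ → Vec D}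

/-- The indices k + j with j ∈ A are congruent modulo G, so the factor `e` is the same for all terms
of a row. -/
theorem Period.smul_row {n G : ℕ} {A : Finset ℤ} (hG : Period n A G) {E : Type*} [AddCommGroup E]
    [Module ℝ E] {V : ℤ → E} (hV : Rel A a V) {e : ℤ → ℝ}
    (he : Function.Periodic e G) : Rel A a (fun i => e i • V i) := by
  intro k
  rcases A.eq_empty_or_nonempty with rfl | ⟨j₀, hj₀⟩
  · simp
  · have : ∀ j ∈ A, a j k • e (k + j) • V (k + j) = e (k + j₀) • a j k • V (k + j) := by
      intro j hj
      rw [periodic_of_dvd he (x := k + j) (y := k + j₀) (by simpa using hG.dvd j hj j₀ hj₀),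
        smul_comm]
    rw [Finset.sum_congr rfl this, ← Finset.smul_sum, hV k, smul_zero]

/-- Multiplication of the vertices by a `G`-periodic sequence is induced by a linear map. -/
theorem Period.exists_diag (hG : Period n A G) (hA : IsSpan A lo hi D) (h : IsSol A a W)
    {e : ℤ → ℝ} (he : Function.Periodic e G) :
    ∃ Γ : Module.End ℝ (Vec D), ∀ i, Γ (W i) = e i • W i := by
  obtain ⟨Γ, hΓ⟩ := h.exists_linearMap hA (hG.smul_row h.rel he)
  exact ⟨Γ, fun i => (hΓ i).symm⟩

/-- `M` induces a projective transformation that shifts the sequence by `n`. -/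
def IsMono {r : ℕ} (n : ℕ) (W : ℤ → Vec r) (M : Module.End ℝ (Vec r)) : Prop :=
  ∃ c : ℤ → ℝ, (∀ i, c i ≠ 0) ∧ ∀ i, M (W i) = c i • W (i + n)

theorem IsMono.smul {M : Module.End ℝ (Vec D)} (h : IsMono n W M) {β : ℤ → ℝ}
    (hβ : ∀ i, β i ≠ 0) : IsMono n (fun i => β i • W i) M := by
  obtain ⟨c, hc, hM⟩ := h
  refine ⟨fun i => β i * c i / β (i + n), fun i => div_ne_zero (mul_ne_zero (hβ i) (hc i)) (hβ _),
    fun i => ?_⟩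
  rw [map_smul, hM, smul_smul, smul_smul, div_mul_cancel₀ _ (hβ _)]

theorem IsMono.conj {M : Module.End ℝ (Vec D)} (h : IsMono n W M) (g : Vec D ≃ₗ[ℝ] Vec D) :
    IsMono n (fun i => g (W i)) (g.conj M) := by
  obtain ⟨c, hc, hM⟩ := h
  refine ⟨c, hc, fun i => ?_⟩
  simp [LinearEquiv.conj_apply, hM]

/-- `M` carries the relation at k to a relation at k + n, which is unique up to a factor. -/
theorem row_ratio (h : IsSol A a W) (hA : IsSpan A lo hi D) {M : Module.End ℝ (Vec D)} {c : ℤ → ℝ}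
    (hc : ∀ i, c i ≠ 0)
    (hM : ∀ i, M (W i) = c i • W (i + n)) (k : ℤ) :
    ∃ μ, μ ≠ 0 ∧ ∀ j ∈ A, a j k * c (k + j) = μ * a j (k + n) := by
  obtain ⟨μ, hμ⟩ := (h.genPos hA (k + n)).proportional (x := fun j => a j k * c (k + j)) (by
    have := h.rel.map M k
    simp only [hM, smul_smul] at this
    rw [← this]
    exact Finset.sum_congr rfl fun j _ => by rw [add_right_comm]) (h.rel (k + n))
    ⟨hi, hA.hi_mem, h.ne _ hA.hi_mem _⟩
  refine ⟨μ, ?_, hμ⟩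
  rintro rfl
  have := hμ hi hA.hi_mem
  rw [zero_mul] at this
  exact mul_ne_zero (h.ne _ hA.hi_mem _) (hc _) this

/-- By `row_ratio` the quotient of the two scalings is constant on each set k + A, hence G-periodic.
This is the whole ambiguity of the monodromy. -/
theorem IsMono.exists_diag (hG : Period n A G) (hA : IsSpan A lo hi D) (h : IsSol A a W)
    {M M' : Module.End ℝ (Vec D)} (hM : IsMono n W M) (hM' : IsMono n W M') :
    ∃ (e : ℤ → ℝ) (Γ : Module.End ℝ (Vec D)), (∀ i, e i ≠ 0) ∧ Function.Periodic e G ∧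
      (∀ i, Γ (W i) = e i • W i) ∧ M' = M * Γ := by
  obtain ⟨c, hc, hM⟩ := hM
  obtain ⟨c', hc', hM'⟩ := hM'
  have he : Function.Periodic (fun i => c' i / c i) G := by
    refine hG.periodic fun k i hi j hj => ?_
    obtain ⟨μ, hμ0, hμ⟩ := row_ratio h hA hc hM k
    obtain ⟨μ', hμ0', hμ'⟩ := row_ratio h hA hc' hM' k
    have key : ∀ i ∈ A, c' (k + i) / c (k + i) = μ' / μ := by
      intro i hi
      have h1 := hμ i hi
      have h2 := hμ' i hi
      have h3 := h.ne i hi k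
      rw [div_eq_div_iff (hc _) hμ0]
      apply mul_left_cancel₀ h3
      linear_combination μ * h2 - μ' * h1
    rw [key i hi, key j hj]
  obtain ⟨Γ, hΓ⟩ := hG.exists_diag hA h he
  refine ⟨_, Γ, fun i => div_ne_zero (hc' i) (hc i), he, hΓ, ?_⟩
  refine linearMap_ext_of_window h.window fun i => ?_
  rw [Module.End.mul_apply, hΓ, map_smul, hM, hM', smul_smul, div_mul_cancel₀ _ (hc i)]

theorem IsMono.pow_apply {M : Module.End ℝ (Vec D)} (h : IsMono n W M) (l : ℕ) (i : ℤ) :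
    ∃ c : ℝ, (M ^ l) (W i) = c • W (i + l * n) := by
  obtain ⟨c, hc, hM⟩ := h
  induction l with
  | zero => exact ⟨1, by simp⟩
  | succ l ih =>
    obtain ⟨x, hx⟩ := ih
    refine ⟨x * c (i + l * n), ?_⟩
    rw [pow_succ', Module.End.mul_apply, hx, map_smul, hM, smul_smul]
    congr 2
    push_cast
    ring

/-- The space splits into the spans of the W_i with i in a fixed residue class modulo G. `M ^ l`
moves the classes by l n, which is nonzero modulo G when G ∤ l, so its diagonal blocks vanish. -/
theorem IsMono.trace_pow_eq_zero (hG : Period n A G) (hA : IsSpan A lo hi D) (h : IsSol A a W)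
    {M : Module.End ℝ (Vec D)} (hM : IsMono n W M) {l : ℕ} (hl : ¬ G ∣ l) :
    LinearMap.trace ℝ _ (M ^ l) = 0 := by
  have hper : ∀ r : ℕ, Function.Periodic (fun i : ℤ => if (G : ℤ) ∣ i - r then (1 : ℝ) else 0) G := by
    intro r i
    have : (G : ℤ) ∣ i + G - r ↔ (G : ℤ) ∣ i - r := by
      rw [show i + (G : ℤ) - r = i - r + G by ring]
      exact dvd_add_self_right
    simp only [this]
  choose Γ hΓ using fun r : ℕ => hG.exists_diag hA h (hper r)
  have hsum : ∑ r ∈ Finset.range G, Γ r = 1 := by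
    refine linearMap_ext_of_window h.window fun i => ?_
    rw [LinearMap.sum_apply, Module.End.one_apply]
    have hGp : (0 : ℤ) < G := by exact_mod_cast hG.pos
    rw [Finset.sum_eq_single_of_mem (i % G).toNat]
    · rw [hΓ, if_pos, one_smul]
      rw [Int.toNat_of_nonneg (Int.emod_nonneg _ hGp.ne')]
      exact Int.dvd_self_sub_emod
    · have := Int.emod_lt_of_pos i hGp
      have := Int.emod_nonneg i hGp.ne'
      rw [Finset.mem_range]; omega
    · intro r hr hne
      rw [hΓ, if_neg, zero_smul]
      intro hdvd
      apply hne
      have h2 : i % G = r := by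
        obtain ⟨c, hc⟩ := hdvd
        rw [show i = r + G * c by omega, Int.add_mul_emod_self_left]
        exact Int.emod_eq_of_lt (by positivity) (by exact_mod_cast Finset.mem_range.1 hr)
      omega
  have hidem : ∀ r, Γ r * Γ r = Γ r := by
    intro r
    refine linearMap_ext_of_window h.window fun i => ?_
    rw [Module.End.mul_apply, hΓ, map_smul, hΓ, smul_smul]
    congr 1
    split_ifs <;> simp
  have hzero : ∀ r, Γ r * (M ^ l * Γ r) = 0 := by
    intro r
    refine linearMap_ext_of_window h.window fun i => ?_
    obtain ⟨c, hc⟩ := hM.pow_apply l i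
    rw [Module.End.mul_apply, Module.End.mul_apply, hΓ, map_smul, hc, map_smul, map_smul, hΓ]
    by_cases h1 : (G : ℤ) ∣ i - r
    · rw [if_neg (c := (G : ℤ) ∣ i + l * n - r)]
      · simp
      · intro h2
        have h3 : (G : ℤ) ∣ l * n := by
          have := dvd_sub h2 h1
          rwa [show i + (l : ℤ) * n - r - (i - r) = l * n by ring] at this
        have h4 : G ∣ l * n := by exact_mod_cast h3
        exact hl (hG.coprime.symm.dvd_of_dvd_mul_right h4)
    · rw [if_neg h1]; simp
  calc LinearMap.trace ℝ _ (M ^ l) = LinearMap.trace ℝ _ (M ^ l * ∑ r ∈ Finset.range G, Γ r) := by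
        rw [hsum, mul_one]
    _ = ∑ r ∈ Finset.range G, LinearMap.trace ℝ _ (M ^ l * Γ r) := by
        rw [Finset.mul_sum, map_sum]
    _ = 0 := Finset.sum_eq_zero fun r _ => by
        rw [← hidem r, ← mul_assoc, LinearMap.trace_mul_comm, hzero, map_zero]

theorem IsMono.pow_diag_apply {M : Module.End ℝ (Vec D)} (hM : IsMono n W M) {e : ℤ → ℝ}
    {Γ : Module.End ℝ (Vec D)} (hΓ : ∀ i, Γ (W i) = e i • W i) (l : ℕ) (i : ℤ) :
    ((M * Γ) ^ l) (W i) = (∏ s ∈ Finset.range l, e (i + s * n)) • (M ^ l) (W i) := by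
  induction l with
  | zero => simp
  | succ l ih =>
    obtain ⟨c, hc⟩ := hM.pow_apply l i
    rw [pow_succ', Module.End.mul_apply, ih, pow_succ' M, Module.End.mul_apply M (M ^ l), hc,
      Finset.prod_range_succ]
    simp only [map_smul, Module.End.mul_apply, hΓ, smul_smul]
    congr 1
    ring

/-- Both sides are products over a full period, since n is invertible modulo G. This common value is
the norm of `e`. -/
theorem Period.prod_const (hG : Period n A G) {e : ℤ → ℝ} (he : Function.Periodic e G) (x y : ℤ) :
    ∏ s ∈ Finset.range G, e (x + s * n) = ∏ s ∈ Finset.range G, e (y + s * n) := by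
  refine hG.const_of_periodic (e := fun x => ∏ s ∈ Finset.range G, e (x + s * n)) ?_ ?_ x y
  · intro x
    have h1 := Finset.prod_range_succ (fun s : ℕ => e (x + s * n)) G
    have h2 := Finset.prod_range_succ' (fun s : ℕ => e (x + s * n)) G
    have h3 : e (x + (G : ℕ) * n) = e (x + (0 : ℕ) * n) :=
      periodic_of_dvd he ⟨n, by push_cast; ring⟩
    simp only [h3] at h1
    -- Shifting by n replaces the first factor by an equal one. Cancelling it requires it to be
    -- nonzero; if it is zero, both products vanish.
    by_cases h0 : e (x + (0 : ℕ) * n) = 0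
    · have e1 : ∏ s ∈ Finset.range G, e (x + s * n) = 0 :=
        Finset.prod_eq_zero (Finset.mem_range.2 hG.pos) h0
      refine Eq.trans ?_ e1.symm
      refine Finset.prod_eq_zero (i := G - 1) (Finset.mem_range.2 (by have := hG.pos; omega)) ?_
      rw [← h0]
      refine periodic_of_dvd he ⟨n, ?_⟩
      have := hG.pos
      push_cast [Nat.cast_sub this]
      ring
    · refine mul_right_cancel₀ h0 (Eq.trans ?_ h1)
      rw [h2]
      congr 1
      refine Finset.prod_congr rfl fun s _ => ?_
      congr 1
      push_cast
      ring
  · intro x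
    refine Finset.prod_congr rfl fun s _ => ?_
    exact periodic_of_dvd he ⟨1, by ring⟩

/-- Moving the diagonal factors past `M` collects the norm of `e` after G steps. -/
theorem IsMono.pow_diag_eq (hG : Period n A G) (h : IsSol A a W) {M : Module.End ℝ (Vec D)}
    (hM : IsMono n W M) {e : ℤ → ℝ} (he : Function.Periodic e G)
    {Γ : Module.End ℝ (Vec D)} (hΓ : ∀ i, Γ (W i) = e i • W i) :
    (M * Γ) ^ G = (∏ s ∈ Finset.range G, e (s * n)) • M ^ G := by
  refine linearMap_ext_of_window h.window fun i => ?_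
  rw [hM.pow_diag_apply hΓ, LinearMap.smul_apply, hG.prod_const he i 0]
  simp

/-- The discriminant of the characteristic polynomial, as the determinant of the trace form. -/
def disc (M : Module.End ℝ (Vec D)) : ℝ :=
  (Matrix.of fun i j : Fin (D + 1) => LinearMap.trace ℝ (Vec D) (M ^ ((i : ℕ) + j))).det

theorem disc_conj (M : Module.End ℝ (Vec D)) (g : Vec D ≃ₗ[ℝ] Vec D) : disc (g.conj M) = disc M := by
  unfold disc
  congr 2
  ext i j
  have : g.conj M ^ ((i : ℕ) + j) = g.conj (M ^ ((i : ℕ) + j)) :=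
    (map_pow (g.conjAlgEquiv ℝ) M _).symm
  rw [this, LinearMap.trace_conj']

/-- The hypothesis says that the power sums behave as if all eigenvalues were multiplied by ω; rows
and columns of the Hankel matrix of traces then scale by powers of ω. -/
theorem disc_ne_zero_of_trace {M M' : Module.End ℝ (Vec D)} {ω : ℂ} (hω : ω ≠ 0)
    (h : ∀ l : ℕ, (LinearMap.trace ℝ _ (M' ^ l) : ℂ) = ω ^ l * LinearMap.trace ℝ _ (M ^ l))
    (h0 : disc M ≠ 0) : disc M' ≠ 0 := by
  have key : ∀ M : Module.End ℝ (Vec D), (disc M : ℂ) =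
      (Matrix.of fun i j : Fin (D + 1) => (LinearMap.trace ℝ (Vec D) (M ^ ((i : ℕ) + j)) : ℂ)).det := by
    intro M
    exact RingHom.map_det Complex.ofRealHom _
  have e : (Matrix.of fun i j : Fin (D + 1) => (LinearMap.trace ℝ (Vec D) (M' ^ ((i : ℕ) + j)) : ℂ)) =
      Matrix.diagonal (fun i : Fin (D + 1) => ω ^ (i : ℕ)) *
      (Matrix.of fun i j : Fin (D + 1) => (LinearMap.trace ℝ (Vec D) (M ^ ((i : ℕ) + j)) : ℂ)) *
      Matrix.diagonal (fun i : Fin (D + 1) => ω ^ (i : ℕ)) := by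
    ext i j
    rw [Matrix.mul_diagonal, Matrix.diagonal_mul, Matrix.of_apply, Matrix.of_apply, h, pow_add]
    ring
  have hne : (disc M' : ℂ) ≠ 0 := by
    rw [key, e, Matrix.det_mul, Matrix.det_mul, ← key, Matrix.det_diagonal]
    have : ∏ i : Fin (D + 1), ω ^ (i : ℕ) ≠ 0 := Finset.prod_ne_zero_iff.2 fun i _ => pow_ne_zero _ hω
    exact mul_ne_zero (mul_ne_zero this (by exact_mod_cast h0)) this
  exact_mod_cast hne

/-- Whether the discriminant of the monodromy vanishes does not depend on the monodromy. -/
theorem IsMono.disc_ne_zero (hG : Period n A G) (hA : IsSpan A lo hi D) (h : IsSol A a W)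
    {M M' : Module.End ℝ (Vec D)} (hM : IsMono n W M) (hM' : IsMono n W M') (h0 : disc M ≠ 0) :
    disc M' ≠ 0 := by
  obtain ⟨e, Γ, he0, he, hΓ, rfl⟩ := hM.exists_diag hG hA h hM'
  set E : ℝ := ∏ s ∈ Finset.range G, e (s * n) with hE
  have hE0 : E ≠ 0 := Finset.prod_ne_zero_iff.2 fun s _ => he0 _
  -- The norm E may be negative, so its G-th root is taken in ℂ. Traces of powers not divisible by G
  -- vanish on both sides, and the others scale by powers of E = ω^G.
  obtain ⟨ω, hω⟩ := IsAlgClosed.exists_pow_nat_eq (E : ℂ) hG.pos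
  refine disc_ne_zero_of_trace (ω := ω) ?_ (fun l => ?_) h0
  · rintro rfl
    rw [zero_pow hG.pos.ne'] at hω
    exact hE0 (by exact_mod_cast hω.symm)
  · by_cases hl : G ∣ l
    · obtain ⟨q, rfl⟩ := hl
      rw [pow_mul, hM.pow_diag_eq hG h he hΓ, ← hE, smul_pow, map_smul, pow_mul ω, hω, ← pow_mul]
      simp
    · rw [hM.trace_pow_eq_zero hG hA h hl, hM'.trace_pow_eq_zero hG hA h hl]
      simp

end Mono

end Pentagram

namespace Pentagram

/-! ### Invariant subspaces of endomorphisms with nonzero discriminant -/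

section Coprime

open Polynomial

variable {D d : ℕ}

/-- Each M^i q(M) is nilpotent and has trace zero, so the coefficient vector of `q` lies in the
kernel of the trace form. -/
theorem disc_eq_zero_of_aeval {M : Module.End ℝ (Vec D)} {q : ℝ[X]} (hq : q ≠ 0)
    (hdeg : q.natDegree < D + 1) (h : aeval M q * aeval M q = 0) : disc M = 0 := by
  by_contra hdisc
  apply hq
  have hx : (fun i : Fin (D + 1) => q.coeff i) = 0 := by
    refine Matrix.eq_zero_of_mulVec_eq_zero hdisc ?_
    ext i
    have : ∑ j : Fin (D + 1), LinearMap.trace ℝ (Vec D) (M ^ ((i : ℕ) + j)) * q.coeff j =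
        LinearMap.trace ℝ _ (M ^ (i : ℕ) * aeval M q) := by
      rw [aeval_eq_sum_range' hdeg, Finset.mul_sum, map_sum, Finset.sum_range]
      refine Finset.sum_congr rfl fun j _ => ?_
      rw [mul_smul_comm, map_smul, pow_add, smul_eq_mul, mul_comm]
    refine this.trans ?_
    refine (LinearMap.isNilpotent_trace_of_isNilpotent ⟨2, ?_⟩).eq_zero
    have hc : Commute (aeval M q) (M ^ (i : ℕ)) := by
      have := (Commute.all q (X ^ (i : ℕ))).map (aeval M)
      simpa using this
    rw [pow_two, mul_assoc, ← mul_assoc (aeval M q), hc.eq, mul_assoc, h, mul_zero, mul_zero]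
  ext i
  by_cases hi : i < D + 1
  · exact congrFun hx ⟨i, hi⟩
  · rw [coeff_eq_zero_of_natDegree_lt (by omega), coeff_zero]

variable {M : Module.End ℝ (Vec D)} {g : Module.End ℝ (Vec d)} {P : Vec D →ₗ[ℝ] Vec d}

theorem aeval_comm_of_comm {E F : Type*} [AddCommGroup E] [Module ℝ E] [AddCommGroup F]
    [Module ℝ F] {M : Module.End ℝ E} {g : Module.End ℝ F} {P : E →ₗ[ℝ] F}
    (h : ∀ x, P (M x) = g (P x)) (q : ℝ[X]) (x : E) :
    P (aeval M q x) = aeval g q (P x) := by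
  have hpow : ∀ (l : ℕ) (x : E), P ((M ^ l) x) = (g ^ l) (P x) := by
    intro l
    induction l with
    | zero => simp
    | succ l ih => intro x; rw [pow_succ, pow_succ, Module.End.mul_apply, ih, h]; rfl
  rw [aeval_eq_sum_range, aeval_eq_sum_range, LinearMap.sum_apply, LinearMap.sum_apply, map_sum]
  refine Finset.sum_congr rfl fun i _ => ?_
  rw [LinearMap.smul_apply, LinearMap.smul_apply, map_smul, hpow]

theorem mapsTo_ker (h : ∀ x, P (M x) = g (P x)) :
    ∀ x ∈ LinearMap.ker P, M x ∈ LinearMap.ker P := fun x hx => by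
  rw [LinearMap.mem_ker] at hx ⊢
  rw [h, hx, map_zero]

theorem aeval_minpoly_apply {E : Type*} [AddCommGroup E] [Module ℝ E] (A : Module.End ℝ E)
    (x : E) : aeval A (minpoly ℝ A) x = 0 := by
  have := minpoly.aeval ℝ A
  rw [this, LinearMap.zero_apply]

/-- The restriction of `M` to the kernel of the projection `P`. -/
def kerRestrict (h : ∀ x, P (M x) = g (P x)) : Module.End ℝ (LinearMap.ker P) :=
  M.restrict (mapsTo_ker h)

theorem coe_aeval_kerRestrict (h : ∀ x, P (M x) = g (P x)) (q : ℝ[X]) (x : LinearMap.ker P) :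
    (aeval (kerRestrict h) q x : Vec D) = aeval M q x :=
  aeval_comm_of_comm (P := (LinearMap.ker P).subtype) (fun _ => rfl) q x

/-- If the minimal polynomials on the kernel and on the quotient are r s and r s', put q = r s s'.
Both divide q, so q(M) maps everything into ker P and kills ker P, that is, q(M)² = 0. A nonconstant
r makes deg q < D + 1, which contradicts the nonzero discriminant. -/
theorem isCoprime_minpoly (h : ∀ x, P (M x) = g (P x)) (hP : Function.Surjective P)
    (hM : disc M ≠ 0) : IsCoprime (minpoly ℝ (kerRestrict h)) (minpoly ℝ g) := by
  set A := kerRestrict h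
  by_contra hco
  set r := gcd (minpoly ℝ A) (minpoly ℝ g) with hr
  have hru : ¬ IsUnit r := fun hu => hco ((gcd_isUnit_iff _ _).1 hu)
  obtain ⟨s, hs⟩ : r ∣ minpoly ℝ A := gcd_dvd_left _ _
  obtain ⟨s', hs'⟩ : r ∣ minpoly ℝ g := gcd_dvd_right _ _
  have h1 : minpoly ℝ A ≠ 0 := minpoly.ne_zero (Algebra.IsIntegral.isIntegral A)
  have h2 : minpoly ℝ g ≠ 0 := minpoly.ne_zero (Algebra.IsIntegral.isIntegral g)
  have hr0 : r ≠ 0 := by rintro h0; rw [h0, zero_mul] at hs; exact h1 hs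
  have hs0 : s ≠ 0 := by rintro h0; rw [h0, mul_zero] at hs; exact h1 hs
  have hs0' : s' ≠ 0 := by rintro h0; rw [h0, mul_zero] at hs'; exact h2 hs'
  refine hM (disc_eq_zero_of_aeval (q := r * s * s') (mul_ne_zero (mul_ne_zero hr0 hs0) hs0') ?_ ?_)
  · have d1 : (minpoly ℝ A).natDegree ≤ Module.finrank ℝ (LinearMap.ker P) := by
      rw [← LinearMap.charpoly_natDegree A]
      exact natDegree_le_of_dvd (LinearMap.minpoly_dvd_charpoly A) (LinearMap.charpoly_monic A).ne_zero
    have d2 : (minpoly ℝ g).natDegree ≤ Module.finrank ℝ (Vec d) := by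
      rw [← LinearMap.charpoly_natDegree g]
      exact natDegree_le_of_dvd (LinearMap.minpoly_dvd_charpoly g) (LinearMap.charpoly_monic g).ne_zero
    have d3 := P.finrank_range_add_finrank_ker
    rw [LinearMap.range_eq_top.2 hP, finrank_top] at d3
    have d4 : Module.finrank ℝ (Vec D) = D + 1 := by simp
    have d5 : 0 < r.natDegree := by
      rw [Nat.pos_iff_ne_zero]
      intro h0
      rw [natDegree_eq_zero] at h0
      obtain ⟨c, hc⟩ := h0
      apply hru
      rw [← hc, isUnit_C, isUnit_iff_ne_zero]
      rintro rfl
      exact hr0 (by rw [← hc, C_0])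
    have d6 : (minpoly ℝ g).natDegree = r.natDegree + s'.natDegree := by
      conv_lhs => rw [hs']
      exact natDegree_mul hr0 hs0'
    rw [← hs, natDegree_mul h1 hs0']
    omega
  · have hq1 : ∀ x ∈ LinearMap.ker P, aeval M (r * s * s') x = 0 := by
      intro x hx
      rw [← hs, mul_comm, map_mul, Module.End.mul_apply, ← coe_aeval_kerRestrict h _ ⟨x, hx⟩,
        aeval_minpoly_apply, ZeroMemClass.coe_zero, map_zero]
    refine LinearMap.ext fun x => hq1 _ ?_
    rw [LinearMap.mem_ker, aeval_comm_of_comm h, mul_right_comm, ← hs', map_mul,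
      minpoly.aeval, zero_mul, LinearMap.zero_apply]

theorem aeval_eq_zero_of_isCoprime {F : Type*} [AddCommGroup F] [Module ℝ F]
    {g : Module.End ℝ F} {q : ℝ[X]}
    (h : IsCoprime q (minpoly ℝ g)) {y : F} (hy : aeval g q y = 0) : y = 0 := by
  obtain ⟨u, v, huv⟩ := h
  have := congrArg (fun p => aeval g p y) huv
  simp only [map_add, map_mul, minpoly.aeval, mul_zero, add_zero, Module.End.mul_apply, hy,
    map_zero, map_one, Module.End.one_apply] at this
  exact this.symm

/-- The kernel of a compatible projection is recovered from a polynomial, which makes fibers finite.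
On the quotient this polynomial acts injectively, by coprimality. -/
theorem ker_eq_ker_aeval (h : ∀ x, P (M x) = g (P x)) (hP : Function.Surjective P)
    (hM : disc M ≠ 0) :
    LinearMap.ker P = LinearMap.ker (aeval M (minpoly ℝ (kerRestrict h))) := by
  ext x
  constructor
  · intro hx
    rw [LinearMap.mem_ker, ← coe_aeval_kerRestrict h _ ⟨x, hx⟩, aeval_minpoly_apply,
      ZeroMemClass.coe_zero]
  · intro hx
    rw [LinearMap.mem_ker] at hx ⊢
    refine aeval_eq_zero_of_isCoprime (isCoprime_minpoly h hP hM) ?_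
    rw [← aeval_comm_of_comm h, hx, map_zero]

/-- Infinitesimal deformations of an invariant projection are unobstructed. -/
theorem exists_sylvester (h : ∀ x, P (M x) = g (P x)) (hP : Function.Surjective P)
    (hM : disc M ≠ 0) (T : Vec D →ₗ[ℝ] Vec d) :
    ∃ (p : Vec D →ₗ[ℝ] Vec d) (ν : Module.End ℝ (Vec d)),
      ∀ x, p (M x) - g (p x) - ν (P x) = T x := by
  let A := kerRestrict h
  -- The Sylvester operator S ↦ S A - g S. A kernel element intertwines A and g, whose minimal
  -- polynomials are coprime, so it is zero; in finite dimension Φ is then onto.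
  let Φ : Module.End ℝ (LinearMap.ker P →ₗ[ℝ] Vec d) :=
    { toFun := fun S => S ∘ₗ A - g ∘ₗ S
      map_add' := fun S S' => by
        rw [LinearMap.add_comp, LinearMap.comp_add]; abel
      map_smul' := fun c S => by
        rw [LinearMap.smul_comp, LinearMap.comp_smul, RingHom.id_apply, smul_sub] }
  have hinj : Function.Injective Φ := by
    rw [injective_iff_map_eq_zero]
    intro S hS
    have hSA : ∀ x, S (A x) = g (S x) := fun x => sub_eq_zero.1 (LinearMap.congr_fun hS x)
    ext1 x
    refine aeval_eq_zero_of_isCoprime (isCoprime_minpoly h hP hM) ?_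
    exact (aeval_comm_of_comm hSA _ x).symm.trans
      ((congrArg S (aeval_minpoly_apply A x)).trans (map_zero S))
  obtain ⟨S, hS⟩ := (LinearMap.injective_iff_surjective.1 hinj) (T ∘ₗ (LinearMap.ker P).subtype)
  obtain ⟨p, hp⟩ := LinearMap.exists_extend S
  obtain ⟨R, hR⟩ := P.exists_rightInverse_of_surjective (LinearMap.range_eq_top.2 hP)
  have hpS : ∀ x : LinearMap.ker P, p x = S x := fun x => LinearMap.congr_fun hp x
  have hPR : ∀ y, P (R y) = y := fun y => LinearMap.congr_fun hR y
  have hker : ∀ x ∈ LinearMap.ker P, p (M x) - g (p x) - T x = 0 := by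
    intro x hx
    have := LinearMap.congr_fun hS ⟨x, hx⟩
    rw [hpS ⟨x, hx⟩, show M x = (A ⟨x, hx⟩ : Vec D) from rfl, hpS]
    exact sub_eq_zero.2 this
  -- The defect of `p` vanishes on ker P, so it factors through P; the factor is ν.
  refine ⟨p, (p ∘ₗ M - g ∘ₗ p - T) ∘ₗ R, fun x => ?_⟩
  have hx := hker (x - R (P x)) (by rw [LinearMap.mem_ker, map_sub, hPR, sub_self])
  simp only [map_sub] at hx
  simp only [LinearMap.comp_apply, LinearMap.sub_apply]
  have h3 : p (M x) - g (p x) - (p (M (R (P x))) - g (p (R (P x))) - T (R (P x))) - T x = 0 := by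
    rw [← hx]; abel
  exact sub_eq_zero.1 h3

end Coprime

/-- Invariant projections persist under perturbation of an endomorphism with nonzero
discriminant. -/
theorem eventually_exists_projection {D d : ℕ} {M₀ : Vec D →L[ℝ] Vec D} {g₀ : Vec d →L[ℝ] Vec d}
    {P₀ : Vec D →L[ℝ] Vec d} (h : P₀.comp M₀ = g₀.comp P₀) (hP : Function.Surjective P₀)
    (hM : disc (M₀ : Module.End ℝ (Vec D)) ≠ 0)
    {N : Set ((Vec D →L[ℝ] Vec d) × (Vec d →L[ℝ] Vec d))} (hN : N ∈ 𝓝 (P₀, g₀)) :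
    ∀ᶠ M in 𝓝 M₀, ∃ p ∈ N, p.1.comp M = p.2.comp p.1 := by
  let X := (Vec D →L[ℝ] Vec D) × (Vec D →L[ℝ] Vec d) × (Vec d →L[ℝ] Vec d)
  -- Ψ(M, p, γ) = (M, p M - γ p) is a submersion at the given triple by `exists_sylvester`, hence
  -- open there; the targets (M, 0) with M near M₀ are attained near the triple.
  let Ψ : X → (Vec D →L[ℝ] Vec D) × (Vec D →L[ℝ] Vec d) := fun x =>
    (x.1, x.2.1.comp x.1 - x.2.2.comp x.2.1)
  have hΨ : HasStrictFDerivAt Ψ _ (M₀, P₀, g₀) :=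
    (hasStrictFDerivAt_fst (𝕜 := ℝ) (p := ((M₀, P₀, g₀) : X))).prodMk
      (((hasStrictFDerivAt_snd (𝕜 := ℝ) (p := ((M₀, P₀, g₀) : X))).fst.clm_comp
        hasStrictFDerivAt_fst).sub
        ((hasStrictFDerivAt_snd (𝕜 := ℝ) (p := ((M₀, P₀, g₀) : X))).snd.clm_comp
        (hasStrictFDerivAt_snd (𝕜 := ℝ) (p := ((M₀, P₀, g₀) : X))).fst))
  have hmap := hΨ.map_nhds_eq_of_surj (LinearMap.range_eq_top.2 fun ⟨m, T⟩ => by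
    obtain ⟨p, ν, hpν⟩ := exists_sylvester (M := (M₀ : Module.End ℝ (Vec D)))
      (g := (g₀ : Module.End ℝ (Vec d))) (P := (P₀ : Vec D →ₗ[ℝ] Vec d))
      (fun x => DFunLike.congr_fun h x) hP hM (T - P₀.comp m : Vec D →L[ℝ] Vec d)
    refine ⟨(m, LinearMap.toContinuousLinearMap p, LinearMap.toContinuousLinearMap ν), ?_⟩
    refine Prod.ext rfl ?_
    ext1 x
    have := hpν x
    simp only [ContinuousLinearMap.coe_coe, _root_.sub_apply,
      ContinuousLinearMap.comp_apply] at this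
    change P₀ (m x) + p (M₀ x) - (g₀ (p x) + ν (P₀ x)) = T x
    rw [← sub_eq_zero, ← sub_eq_zero.2 this]
    abel)
  have h0 : Ψ (M₀, P₀, g₀) = (M₀, 0) := by simp [Ψ, h]
  rw [h0] at hmap
  have hmem : Prod.snd ⁻¹' N ∈ 𝓝 ((M₀, P₀, g₀) : X) := continuous_snd.continuousAt hN
  have himg := hmap ▸ image_mem_map hmem
  have : ContinuousAt (fun M : Vec D →L[ℝ] Vec D => (M, (0 : Vec D →L[ℝ] Vec d))) M₀ := by fun_prop
  filter_upwards [this himg] with M hM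
  obtain ⟨x, hx, hxM⟩ := hM
  obtain ⟨h1, h2⟩ := Prod.ext_iff.1 hxM
  refine ⟨x.2, hx, ?_⟩
  rw [← sub_eq_zero]
  rw [← show x.1 = M from h1]
  exact h2

end Pentagram

namespace Pentagram

/-! ### Quasi-periodic lifts -/

section QuasiPeriodic

variable {n G : ℕ} {A : Finset ℤ} {lo hi : ℤ} {D d r : ℕ} {a : ℤ → ℤ → ℝ}

theorem forall_of_shift (hn : 0 < n) {Q : ℤ → Prop} (h : ∀ k, Q (k + n) ↔ Q k)
    (h0 : ∀ k ∈ Finset.Ico (0 : ℤ) n, Q k) (k : ℤ) : Q k := by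
  have hp : Function.Periodic Q n := fun k => propext (h k)
  have hn' : (0 : ℤ) < n := by exact_mod_cast hn
  rw [periodic_of_dvd hp (x := k) (y := k % n) Int.dvd_self_sub_emod]
  exact h0 _ (Finset.mem_Ico.2 ⟨Int.emod_nonneg _ hn'.ne', Int.emod_lt_of_pos _ hn'⟩)

theorem zpow_add_one_apply {E : Type*} [AddCommGroup E] [Module ℝ E] (g : E ≃ₗ[ℝ] E) (q : ℤ)
    (x : E) : (g ^ (q + 1)) x = g ((g ^ q) x) := by
  rw [add_comm, zpow_one_add]; rfl

theorem pt_zpow {v : ℤ → RP r} {g : Vec r ≃ₗ[ℝ] Vec r} (hg : ∀ i, v (i + n) = projTransf g (v i))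
    {x : Vec r} (hx : x ≠ 0) {i : ℤ} (h : pt x = v i) (q : ℤ) : pt ((g ^ q) x) = v (i + q * n) := by
  have hne : ∀ q : ℤ, (g ^ q) x ≠ 0 := fun q => (LinearEquiv.map_ne_zero_iff _).2 hx
  induction q using Int.induction_on with
  | zero => simpa using h
  | succ q ih =>
    rw [zpow_add_one_apply, ← projTransf_pt g (hne _), ih, ← hg]
    congr 1; ring
  | pred q ih =>
    have hinj : Function.Injective (projTransf g) := Projectivization.map_injective _ g.injective
    apply hinj
    rw [projTransf_pt g (hne _), ← zpow_add_one_apply, sub_add_cancel, ih, ← hg]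
    congr 1; ring

/-- A twisted polygon has a quasi-periodic lift. -/
theorem exists_quasiPeriodic_lift (hn : 0 < n) {v : ℤ → RP r} (hv : IsTwisted n v) :
    ∃ (V : ℤ → Vec r) (g : Vec r ≃ₗ[ℝ] Vec r), IsLift V v ∧ ∀ i, V (i + n) = g (V i) := by
  obtain ⟨V', hV'⟩ := exists_isLift v
  obtain ⟨g, hg⟩ := hv
  have hn' : (n : ℤ) ≠ 0 := by exact_mod_cast hn.ne'
  -- An arbitrary lift over one period is propagated by powers of the monodromy.
  refine ⟨fun i => (g ^ (i / n)) (V' (i % n)), g, fun i => ⟨?_, ?_⟩, fun i => ?_⟩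
  · exact (LinearEquiv.map_ne_zero_iff _).2 (hV' _).1
  · rw [pt_zpow hg (hV' _).1 (hV' _).2]
    congr 1
    have := Int.emod_add_mul_ediv i n
    linarith
  · simp only [Int.add_emod_right]
    rw [Int.add_ediv_of_dvd_right (dvd_refl _), Int.ediv_self hn', zpow_add_one_apply]

theorem nrow_periodic (hi_mem : hi ∈ A) {V : ℤ → Vec r} {g : Vec r ≃ₗ[ℝ] Vec r}
    (hg : ∀ i, V (i + n) = g (V i)) (hV : ∀ k, GenPos A V k) (hrel : Rel A (nrow A hi V) V)
    (j k : ℤ) : nrow A hi V j (k + n) = nrow A hi V j k := by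
  by_cases hj : j ∈ A
  · refine (nrow_eq hi_mem (hV k) (x := fun j => nrow A hi V j (k + n)) ?_ (nrow_hi _ _ _ _) j hj).symm
    apply g.injective
    rw [map_zero, map_sum, ← hrel (k + n)]
    refine Finset.sum_congr rfl fun j _ => ?_
    rw [map_smul, ← hg, add_right_comm]
  · have : j ∉ A.erase hi := fun h => hj (Finset.mem_of_mem_erase h)
    have hne : j ≠ hi := fun h => hj (h ▸ hi_mem)
    simp [nrow, hj, hne]

theorem IsSol.exists_monodromy (hA : IsSpan A lo hi D) {W : ℤ → Vec D} (h : IsSol A a W)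
    (ha : ∀ j ∈ A, ∀ k, a j (k + n) = a j k) :
    ∃ M : Vec D ≃ₗ[ℝ] Vec D, ∀ i, W (i + n) = M (W i) := by
  refine h.exists_linearEquiv hA (W' := fun i => W (i + n)) ⟨fun k => ?_, h.ne, fun k => ?_⟩
  · rw [← h.rel (k + n)]
    exact Finset.sum_congr rfl fun j hj => by rw [ha j hj, add_right_comm]
  · simpa only [add_right_comm] using h.window (k + n)

theorem isMono_of_eq {W : ℤ → Vec D} {M : Vec D ≃ₗ[ℝ] Vec D} (h : ∀ i, W (i + n) = M (W i)) :
    IsMono n W M.toLinearMap :=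
  ⟨fun _ => 1, fun _ => one_ne_zero, fun i => by rw [one_smul, h]; rfl⟩

theorem IsMono.surjective {W : ℤ → Vec D} {M : Module.End ℝ (Vec D)} (h : IsMono n W M)
    (hW : ∀ k, LinearIndependent ℝ (fun i : Fin (D + 1) => W (k + ((i : ℕ) : ℤ)))) :
    Function.Surjective M := by
  obtain ⟨c, hc, hM⟩ := h
  rw [← LinearMap.range_eq_top, eq_top_iff,
    ← (hW n).span_eq_top_of_card_eq_finrank' (by simp), Submodule.span_le]
  rintro _ ⟨i, rfl⟩
  refine ⟨(c (i : ℕ))⁻¹ • W (i : ℕ), ?_⟩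
  rw [map_smul, hM, smul_smul, inv_mul_cancel₀ (hc _), one_smul, add_comm]

/-- A generic polygon, the corresponding corrugated polygon and their monodromies. -/
theorem exists_model (h : IsData n A lo hi D d) {v : ℤ → RP d} (ht : IsTwisted n v)
    (hv : InGeneralPosition A v) :
    ∃ (V : ℤ → Vec d) (g : Vec d ≃ₗ[ℝ] Vec d) (M : Vec D ≃ₗ[ℝ] Vec D) (P : Vec D →ₗ[ℝ] Vec d),
      IsLift V v ∧ (∀ i, V (i + n) = g (V i)) ∧
      (∀ j k, nrow A hi V j (k + n) = nrow A hi V j k) ∧ Rel A (nrow A hi V) V ∧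
      IsSol A (nrow A hi V) (fundSol A lo D (nrow A hi V)) ∧
      (∀ i, fundSol A lo D (nrow A hi V) (i + n) = M (fundSol A lo D (nrow A hi V) i)) ∧
      Function.Surjective P ∧ (∀ i, V i = P (fundSol A lo D (nrow A hi V) i)) ∧
      ∀ x, P (M x) = g (P x) := by
  obtain ⟨V, g, hV, hg⟩ := exists_quasiPeriodic_lift h.n_pos ht
  have hgen := (inGeneralPosition_iff hV).1 hv
  obtain ⟨hrel, hne⟩ := rel_nrow_of_card h.card h.hi_mem hgen
  have hper := nrow_periodic h.hi_mem hg hgen hrel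
  have hsol := isSol_fundSol h.toIsSpan hne
  obtain ⟨M, hM⟩ := hsol.exists_monodromy h.toIsSpan (n := n) fun j _ k => hper j k
  obtain ⟨P, hP⟩ := hsol.exists_linearMap h.toIsSpan hrel
  refine ⟨V, g, M, P, hV, hg, hper, hrel, hsol, hM,
    surjective_of_genPos h.card h.hi_mem (hgen 0) hP, hP, fun x => ?_⟩
  exact LinearMap.congr_fun (f := P ∘ₗ M.toLinearMap) (g := g.toLinearMap ∘ₗ P)
    (linearMap_ext_of_window hsol.window fun i => by
      simp [← hM, ← hP, hg]) x

end QuasiPeriodic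

/-! ### The locus of nonzero discriminant -/

section SepSet

variable {n G : ℕ} {A : Finset ℤ} {lo hi : ℤ} {D d : ℕ}

/-- The classes of corrugated polygons with a monodromy of nonzero discriminant. -/
def sepSet (n : ℕ) (A : Finset ℤ) (D : ℕ) : Set (CorrugatedClass n A D) :=
  {y | ∃ w : CorrugatedPolygon n A D, y = w.cls ∧ ∃ (W : ℤ → Vec D) (M : Module.End ℝ (Vec D)),
    IsLift W w.1 ∧ IsMono n W M ∧ disc M ≠ 0}

/-- Another representative or lift conjugates the monodromy or rescales the vectors, and
`IsMono.disc_ne_zero` covers another choice of monodromy; so any one of them decides membership. -/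
theorem mem_sepSet_iff (hG : Period n A G) (hA : IsSpan A lo hi D) {w : CorrugatedPolygon n A D}
    {W : ℤ → Vec D} (hW : IsLift W w.1) {M : Module.End ℝ (Vec D)} (hM : IsMono n W M) :
    w.cls ∈ sepSet n A D ↔ disc M ≠ 0 := by
  constructor
  · rintro ⟨w', hww, W', M', hW', hM', h0⟩
    have hp : ProjEquiv w'.1 w.1 := Quotient.exact hww.symm
    obtain ⟨g, hg⟩ := hp.exists_isLift hW'
    obtain ⟨β, hβ, hβW⟩ := hg.exists_smul hW
    have hsol := isSol_nrow hA.hi_mem hW w.2.2.1 w.2.2.2.1 w.2.2.2.2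
    refine IsMono.disc_ne_zero hG hA hsol (M := g.conj M') ?_ hM ?_
    · have := (hM'.conj g).smul hβ
      rwa [← funext hβW] at this
    · rwa [disc_conj]
  · intro h
    exact ⟨w, rfl, W, M, hW, hM, h⟩

theorem continuous_disc : Continuous fun M : Vec D →L[ℝ] Vec D =>
    disc (M : Module.End ℝ (Vec D)) := by
  unfold disc
  refine Continuous.matrix_det (continuous_matrix fun i j => ?_)
  let τ : (Vec D →L[ℝ] Vec D) →ₗ[ℝ] ℝ := LinearMap.trace ℝ (Vec D) ∘ₗ ContinuousLinearMap.coeLM ℝ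
  have hτ : Continuous τ := τ.continuous_of_finiteDimensional
  have : ∀ M : Vec D →L[ℝ] Vec D, LinearMap.trace ℝ (Vec D)
      ((M : Module.End ℝ (Vec D)) ^ ((i : ℕ) + j)) = τ (M ^ ((i : ℕ) + j)) := by
    intro M
    rw [← ContinuousLinearMap.toLinearMap_pow]
    rfl
  simp only [Matrix.of_apply, this]
  exact hτ.comp (continuous_pow _)

/-- Monodromies extend continuously to nearby polygons. -/
theorem exists_mono_family (hG : Period n A G) (hA : IsSpan A lo hi D)
    (w₀ : CorrugatedPolygon n A D) {W₀ : ℤ → Vec D} (hW₀ : IsLift W₀ w₀.1)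
    {M₀ : Module.End ℝ (Vec D)} (hM₀ : IsMono n W₀ M₀) :
    ∃ (W : CorrugatedPolygon n A D → ℤ → Vec D)
      (M : CorrugatedPolygon n A D → (Vec D →L[ℝ] Vec D)), (∀ w, IsLift (W w) w.1) ∧
      (∀ w, IsMono n (W w) (M w : Module.End ℝ (Vec D))) ∧
      (∀ i s, ContinuousAt (fun w => W w i s) w₀) ∧ ContinuousAt M w₀ ∧ W w₀ = W₀ ∧
      (M w₀ : Module.End ℝ (Vec D)) = M₀ := by
  obtain ⟨W, hW, hWc, rfl⟩ := exists_lifts (T := CorrugatedPolygon n A D) (v := fun w => w.1)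
    (continuousAt_coord_corrugated w₀) hW₀
  have hsol := fun w => isSol_nrow hA.hi_mem (hW w) w.2.2.1 w.2.2.2.1 w.2.2.2.2
  have htw : ∀ w : CorrugatedPolygon n A D, ∃ (M : Module.End ℝ (Vec D)) (c : ℤ → ℝ),
      (∀ i, c i ≠ 0) ∧ ∀ i, M (W w i) = c i • W w (i + n) := by
    intro w
    obtain ⟨g, hg⟩ := (isTwisted_iff (hW w)).1 w.2.1
    choose c hc hgc using hg
    refine ⟨g.toLinearMap, fun i => (c i)⁻¹, fun i => inv_ne_zero (hc i), fun i => ?_⟩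
    rw [hgc, smul_smul, inv_mul_cancel₀ (hc i), one_smul]
    rfl
  choose M' c' hc' hM' using htw
  obtain ⟨c₀, hc₀, hcM₀⟩ := hM₀
  have hGpos : (0 : ℤ) < G := by exact_mod_cast hG.pos
  -- The monodromies `M'` are chosen without any continuity. A G-periodic correction makes their
  -- scalings equal to `c₀` at the indices 0, …, G - 1.
  let γ : CorrugatedPolygon n A D → ℤ → ℝ := fun w i => c₀ (i % G) / c' w (i % G)
  have hγ : ∀ w i, γ w i ≠ 0 := fun w i => div_ne_zero (hc₀ _) (hc' w _)
  have hγp : ∀ w, Function.Periodic (γ w) G := fun w i => by simp [γ]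
  choose Γ hΓ using fun w => hG.exists_diag hA (hsol w) (hγp w)
  let c : CorrugatedPolygon n A D → ℤ → ℝ := fun w i => γ w i * c' w i
  have hc : ∀ w i, c w i ≠ 0 := fun w i => mul_ne_zero (hγ w i) (hc' w i)
  have hM : ∀ w i, (M' w * Γ w) (W w i) = c w i • W w (i + n) := fun w i => by
    rw [Module.End.mul_apply, hΓ, map_smul, hM', smul_smul]
  have hcs : ∀ w, ∀ i : ℤ, 0 ≤ i → i < G → c w i = c₀ i := fun w i h1 h2 => by
    simp only [c, γ, Int.emod_eq_of_lt h1 h2]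
    exact div_mul_cancel₀ _ (hc' w i)
  have hcc : ∀ i, ContinuousAt (fun w => c w i) w₀ := by
    let S : Set ℤ := {i | ContinuousAt (fun w => c w i) w₀}
    have hstep : ∀ i ∈ A, ∀ j ∈ A, ∀ x ∈ S, x + (i - j) ∈ S := by
      intro i hi' j hj x hx
      have hfc := funClass_continuousAt w₀
      have hg := (hsol w₀).genPos hA
      have hn := fun j k => hfc.nrow hWc hA.hi_mem (hg k) j
      -- Eliminating the factor of `row_ratio` expresses the scaling at x + (i - j) through the one
      -- at x and the rows, so continuity spreads along all differences.
      have hform : ∀ w, c w (x + (i - j)) =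
          c w x * nrow A hi (W w) j (x - j) * nrow A hi (W w) i (x - j + n) /
          (nrow A hi (W w) i (x - j) * nrow A hi (W w) j (x - j + n)) := by
        intro w
        obtain ⟨μ, hμ0, hμ⟩ := row_ratio (hsol w) hA (hc w) (hM w) (x - j)
        have e1 := hμ i hi'
        have e2 := hμ j hj
        have n1 := (hsol w).ne i hi' (x - j)
        have n2 := (hsol w).ne j hj (x - j + n)
        rw [show x - j + i = x + (i - j) by ring] at e1
        rw [sub_add_cancel] at e2
        rw [eq_div_iff (mul_ne_zero n1 n2)]
        linear_combination nrow A hi (W w) j (x - j + n) * e1 -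
          nrow A hi (W w) i (x - j + n) * e2
      change ContinuousAt (fun w => c w (x + (i - j))) w₀
      simp only [hform]
      exact ((ContinuousAt.mul (show ContinuousAt (fun w => c w x) w₀ from hx) (hn _ _)).mul (hn _ _)).div ((hn _ _).mul (hn _ _))
        (mul_ne_zero ((hsol w₀).ne i hi' _) ((hsol w₀).ne j hj _))
    intro i
    refine forall_of_shift (n := G) hG.pos (Q := fun i => i ∈ S) (hG.mem_iff S hstep) ?_ i
    intro k hk
    rw [Finset.mem_Ico] at hk
    change ContinuousAt (fun w => c w k) w₀
    simp only [hcs _ k hk.1 hk.2]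
    exact continuousAt_const
  have hmono : ∀ w, IsMono n (W w) (M' w * Γ w) := fun w => ⟨c w, hc w, hM w⟩
  -- The corrected monodromy is determined by its values on the basis W 0, …, W D; its matrix is Z
  -- Y⁻¹.
  let Y : CorrugatedPolygon n A D → Matrix (Fin (D + 1)) (Fin (D + 1)) ℝ := fun w =>
    Matrix.of fun s i => W w ((i : ℕ) : ℤ) s
  let Z : CorrugatedPolygon n A D → Matrix (Fin (D + 1)) (Fin (D + 1)) ℝ := fun w =>
    Matrix.of fun s i => c w ((i : ℕ) : ℤ) * W w (((i : ℕ) : ℤ) + n) s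
  have hYdet : ∀ w, IsUnit (Y w).det := by
    intro w
    rw [← Matrix.isUnit_iff_isUnit_det, ← Matrix.linearIndependent_cols_iff_isUnit]
    have := (hsol w).window 0
    simp only [zero_add] at this
    exact this
  have hmat : ∀ w, LinearMap.toMatrix' (M' w * Γ w) = Z w * (Y w)⁻¹ := by
    intro w
    have key : LinearMap.toMatrix' (M' w * Γ w) * Y w = Z w := ?_
    · rw [← key, Matrix.mul_assoc, Matrix.mul_nonsing_inv _ (hYdet w), Matrix.mul_one]
    ext s i
    have := congrFun (hM w ((i : ℕ) : ℤ)) s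
    rw [← LinearMap.toMatrix'_mulVec] at this
    exact this
  refine ⟨W, fun w => LinearMap.toContinuousLinearMap (M' w * Γ w), hW, hmono, hWc, ?_, rfl, ?_⟩
  · have hfc := funClass_continuousAt w₀
    let T : Matrix (Fin (D + 1)) (Fin (D + 1)) ℝ →ₗ[ℝ] (Vec D →L[ℝ] Vec D) :=
      (LinearMap.toContinuousLinearMap (𝕜 := ℝ) (E := Vec D) (F' := Vec D)).toLinearMap ∘ₗ
        (Matrix.toLin' (R := ℝ) (m := Fin (D + 1)) (n := Fin (D + 1))).toLinearMap
    have hT : Continuous T := T.continuous_of_finiteDimensional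
    have : (fun w => LinearMap.toContinuousLinearMap (M' w * Γ w)) =
        fun w => T (Z w * (Y w)⁻¹) := by
      ext1 w
      rw [← hmat w]
      simp [T]
    rw [this]
    refine hT.continuousAt.comp ?_
    refine continuousAt_pi.2 fun s => continuousAt_pi.2 fun i => ?_
    exact hfc.matrixMul (fun s i => hfc.mul (hcc _) (hWc _ _))
      (fun s i => hfc.matrixInv (fun s i => hWc _ _) (hYdet w₀).ne_zero s i) s i
  · obtain ⟨e, Γ', he0, he, hΓ', heq⟩ := IsMono.exists_diag hG hA (hsol w₀) ⟨c₀, hc₀, hcM₀⟩ (hmono w₀)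
    have hec : ∀ i, c w₀ i = e i * c₀ i := by
      intro i
      have := hM w₀ i
      rw [heq, Module.End.mul_apply, hΓ', map_smul, hcM₀, smul_smul] at this
      exact (smul_left_injective ℝ (hW w₀ (i + n)).1 this).symm
    have he1 : ∀ i, e i = 1 := by
      intro i
      rw [periodic_of_dvd he (x := i) (y := i % G) Int.dvd_self_sub_emod]
      have h1 := hec (i % G)
      rw [hcs w₀ _ (Int.emod_nonneg _ hGpos.ne') (Int.emod_lt_of_pos _ hGpos)] at h1
      exact (mul_right_cancel₀ (hc₀ _) (by rw [one_mul]; exact h1)).symm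
    refine linearMap_ext_of_window (hsol w₀).window fun i => ?_
    rw [hcM₀]
    refine (hM w₀ i).trans ?_
    rw [hec, he1, one_mul]

theorem nhds_corrugatedCls (w : CorrugatedPolygon n A D) :
    𝓝 w.cls = map CorrugatedPolygon.cls (𝓝 w) :=
  ((isOpenQuotientMap_corrugatedCls n A D).isOpenMap.map_nhds_eq
    (isOpenQuotientMap_corrugatedCls n A D).continuous.continuousAt).symm

theorem isOpen_sepSet (hG : Period n A G) (hA : IsSpan A lo hi D) : IsOpen (sepSet n A D) := by
  rw [isOpen_iff_mem_nhds]
  rintro _ ⟨w₀, rfl, W₀, M₀, hW₀, hM₀, h0⟩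
  obtain ⟨W, M, hW, hM, -, hMc, -, rfl⟩ := exists_mono_family hG hA w₀ hW₀ hM₀
  rw [nhds_corrugatedCls]
  have : ContinuousAt (fun w => disc (M w : Module.End ℝ (Vec D))) w₀ :=
    continuous_disc.continuousAt.comp hMc
  change ∀ᶠ w in 𝓝 w₀, CorrugatedPolygon.cls w ∈ sepSet n A D
  filter_upwards [this.eventually_ne h0] with w hw
  exact (mem_sepSet_iff hG hA (hW w) (hM w)).2 hw

theorem genPos_shift {r : ℕ} {V : ℤ → Vec r} {g : Module.End ℝ (Vec r)} (hg : Function.Injective g)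
    {c : ℤ → ℝ} (hc : ∀ i, c i ≠ 0) (h : ∀ i, g (V i) = c i • V (i + n)) (k : ℤ) :
    GenPos A V (k + n) ↔ GenPos A V k := by
  refine forall₂_congr fun j₀ _ => ?_
  have e1 : LinearIndependent ℝ (fun j : {j : ℤ // j ∈ A.erase j₀} => g (V (k + j.1))) ↔
      LinearIndependent ℝ (fun j : {j : ℤ // j ∈ A.erase j₀} => V (k + j.1)) :=
    g.linearIndependent_iff (LinearMap.ker_eq_bot.2 hg)
  rw [← e1]
  simp only [h]
  have e2 := LinearIndependent.units_smul_iff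
    (v := fun j : {j : ℤ // j ∈ A.erase j₀} => V (k + j.1 + n))
    (w := fun j : {j : ℤ // j ∈ A.erase j₀} => Units.mk0 (c (k + j.1)) (hc _)) (R := ℝ)
  simp only [add_right_comm k _ (n : ℤ)] at e2 ⊢
  exact e2.symm

/-- Over the locus of nonzero discriminant, the corrugation map is open. -/
theorem nhds_le_map_corrugation (hG : Period n A G) (h : IsData n A lo hi D d)
    (x : GenericClass n A d) (hx : corrugation h x ∈ sepSet n A D) :
    𝓝 (corrugation h x) ≤ map (corrugation h) (𝓝 x) := by
  obtain ⟨v, rfl⟩ := Quotient.exists_rep x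
  obtain ⟨V, g, M, P, hV, hg, hper, hrel, hsol, hM, hP, hVP, hPM⟩ := exists_model h v.2.1 v.2.2
  set W₀ := fundSol A lo D (nrow A hi V)
  let w₀ : CorrugatedPolygon n A D := ⟨_, fundSol_mem_corrugated h hV v.2.2 v.2.1⟩
  have hFw : corrugation h v.cls = w₀.cls :=
    (corrugation_eq_iff h v w₀).2 (fundSol_projection h hV v.2.2).2
  have hFw' : corrugation h (Quotient.mk _ v) = w₀.cls := hFw
  rw [hFw'] at hx ⊢
  have hW₀ : IsLift W₀ w₀.1 := hsol.isLift
  have hdisc := (mem_sepSet_iff hG h.toIsSpan hW₀ (isMono_of_eq hM)).1 hx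
  obtain ⟨W, Mf, hW, hMf, hWc, hMc, hWe, hMe⟩ :=
    exists_mono_family hG h.toIsSpan w₀ hW₀ (isMono_of_eq hM)
  intro S hS
  rw [nhds_corrugatedCls]
  have hS' : (GenericPolygon.cls (n := n) (A := A) (d := d)) ⁻¹' (corrugation h ⁻¹' S) ∈ 𝓝 v :=
    (isOpenQuotientMap_genericCls n A d).continuous.continuousAt hS
  obtain ⟨U, hU, hUS⟩ := mem_nhds_induced Subtype.val v _ |>.1 hS'
  let T := CorrugatedPolygon n A D × (Vec D →L[ℝ] Vec d) × (Vec d →L[ℝ] Vec d)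
  let P₀ : Vec D →L[ℝ] Vec d := LinearMap.toContinuousLinearMap P
  let g₀ : Vec d →L[ℝ] Vec d := LinearMap.toContinuousLinearMap g.toLinearMap
  let t₀ : T := (w₀, P₀, g₀)
  let Vt : T → ℤ → Vec d := fun t i => t.2.1 (W t.1 i)
  have hVt₀ : Vt t₀ = V := by
    ext1 i
    rw [hVP i]
    simp [Vt, t₀, hWe, P₀]
  have hVtc : ∀ i, ContinuousAt (fun t => Vt t i) t₀ := by
    intro i
    have h1 : ContinuousAt (fun t : T => W t.1 i) t₀ :=
      ContinuousAt.comp (f := fun t : T => t.1) (g := fun w => W w i)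
        (continuousAt_pi.2 fun s => hWc i s) continuousAt_fst
    exact (ContinuousAt.clm_apply (by fun_prop) h1)
  have hcl := funClass_continuousAt t₀
  have hVtc' : ∀ i s, ContinuousAt (fun t => Vt t i s) t₀ := fun i s =>
    continuousAt_pi.1 (hVtc i) s
  have hgen := (inGeneralPosition_iff hV).1 v.2.2
  have ev1 : ∀ᶠ t in 𝓝 t₀, ∀ k ∈ Finset.Ico (0 : ℤ) n, GenPos A (Vt t) k := by
    rw [Finset.eventually_all]
    intro k _
    exact hcl.eventually_genPos hVtc' (by rw [hVt₀]; exact hgen k)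
  have ev2 : ∀ᶠ t in 𝓝 t₀, (fun i => pt (Vt t i)) ∈ U := by
    have : ContinuousAt (fun t => fun i => pt (Vt t i)) t₀ := by
      refine continuousAt_pi.2 fun i => continuousAt_pt_of_coord (hVtc' i) ?_
      rw [hVt₀]; exact (hV i).1
    refine this.eventually_mem ?_
    have e : (fun i => pt (Vt t₀ i)) = v.1 := by
      ext1 i; rw [hVt₀, (hV i).2]
    rw [e]; exact hU
  have ev := ev1.and ev2
  -- The condition is split into one on the corrugated polygon and one on the pair (projection,
  -- monodromy), so that the pair may be found after the polygon is fixed.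
  rw [nhds_prod_eq, eventually_prod_iff] at ev
  obtain ⟨pa, hpa, pb, hpb, hab⟩ := ev
  have ev3 := eventually_exists_projection (M₀ := Mf w₀) (g₀ := g₀) (P₀ := P₀)
    (by ext1 x
        have := hPM x
        have e : (Mf w₀ x) = M x := LinearMap.congr_fun hMe x
        simp [P₀, g₀, e, this]) hP (by rw [hMe]; exact hdisc) hpb
  change ∀ᶠ w in 𝓝 w₀, CorrugatedPolygon.cls w ∈ S
  filter_upwards [hpa, hMc.eventually ev3] with w hw1 hw2
  obtain ⟨⟨p, γ⟩, hp, hpγ⟩ := hw2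
  obtain ⟨hgp, hUv⟩ := hab hw1 hp
  have hn0 : (0 : ℤ) ∈ Finset.Ico (0 : ℤ) n :=
    Finset.mem_Ico.2 ⟨le_refl _, by exact_mod_cast h.n_pos⟩
  have hpsurj : Function.Surjective p := surjective_of_genPos h.card h.hi_mem (hgp 0 hn0)
    (W := W w) (P := (p : Vec D →ₗ[ℝ] Vec d)) (fun i => rfl)
  have hsolw := isSol_nrow h.hi_mem (hW w) w.2.2.1 w.2.2.2.1 w.2.2.2.2
  -- From γ p = p M, where p and M are surjective.
  have hγsurj : Function.Surjective γ := by
    have : Function.Surjective (γ ∘ p) := by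
      have e : γ ∘ p = p ∘ Mf w := by
        ext1 x; exact (DFunLike.congr_fun hpγ x).symm
      rw [e]
      exact hpsurj.comp ((hMf w).surjective hsolw.window)
    exact this.of_comp
  have hγinj : Function.Injective (γ : Module.End ℝ (Vec d)) :=
    LinearMap.injective_iff_surjective.2 hγsurj
  obtain ⟨c, hc, hcM⟩ := hMf w
  have hshift : ∀ i, (γ : Module.End ℝ (Vec d)) (p (W w i)) = c i • p (W w (i + n)) := by
    intro i
    have := DFunLike.congr_fun hpγ (W w i)
    refine this.symm.trans ?_
    rw [← map_smul, ← hcM]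
    rfl
  have hgp' : ∀ k, GenPos A (fun i => p (W w i)) k :=
    forall_of_shift h.n_pos (genPos_shift hγinj hc hshift) hgp
  have hne : ∀ i, p (W w i) ≠ 0 := by
    intro i
    have h2 : 1 < A.card := by rw [h.card]; omega
    obtain ⟨j, hj, hjne⟩ := Finset.exists_mem_ne h2 hi
    have := (hgp' (i - hi) j hj).ne_zero ⟨hi, Finset.mem_erase.2 ⟨hjne.symm, h.hi_mem⟩⟩
    simpa using this
  have hlift := isLift_pt hne
  let v' : GenericPolygon n A d := ⟨fun i => pt (p (W w i)), by
    refine ⟨(isTwisted_iff hlift).2 ⟨LinearEquiv.ofBijective (γ : Module.End ℝ (Vec d))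
      ⟨hγinj, hγsurj⟩, fun i => ⟨(c i)⁻¹, inv_ne_zero (hc i), ?_⟩⟩,
      (inGeneralPosition_iff hlift).2 hgp'⟩
    change p (W w (i + n)) = (c i)⁻¹ • (γ : Module.End ℝ (Vec d)) (p (W w i))
    rw [hshift, smul_smul, inv_mul_cancel₀ (hc i), one_smul]⟩
  have hv' : corrugation h v'.cls = w.cls := (corrugation_eq_iff h v' w).2
    (isProjectionOf_of_isLift (hW w) (P := (p : Vec D →ₗ[ℝ] Vec d)) hpsurj hlift)
  have : v' ∈ GenericPolygon.cls ⁻¹' (corrugation h ⁻¹' S) := hUS hUv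
  change w.cls ∈ S
  rw [← hv']
  exact this

end SepSet

end Pentagram

namespace Pentagram

/-! ### The fibers of the corrugation map -/

section Fibers

open Polynomial

variable {n G : ℕ} {A : Finset ℤ} {lo hi : ℤ} {D d : ℕ} {W : ℤ → Vec D}

theorem exists_linearEquiv_of_ker_eq {P P' : Vec D →ₗ[ℝ] Vec d} (hP : Function.Surjective P)
    (hP' : Function.Surjective P') (h : LinearMap.ker P = LinearMap.ker P') :
    ∃ g : Vec d ≃ₗ[ℝ] Vec d, ∀ x, P' x = g (P x) := by
  let q := P.quotKerEquivOfSurjective hP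
  let q' := P'.quotKerEquivOfSurjective hP'
  refine ⟨q.symm.trans ((Submodule.quotEquivOfEq _ _ h).trans q'), fun x => ?_⟩
  have : q.symm (P x) = Submodule.Quotient.mk x := by
    rw [LinearEquiv.symm_apply_eq]; rfl
  simp only [LinearEquiv.trans_apply, this]
  rfl

theorem eq_of_map_roots_eq {p q : ℝ[X]} (hp : p.Monic) (hq : q.Monic)
    (h : (p.map (algebraMap ℝ ℂ)).roots = (q.map (algebraMap ℝ ℂ)).roots) : p = q := by
  apply map_injective _ (algebraMap ℝ ℂ).injective
  rw [(IsAlgClosed.splits (p.map (algebraMap ℝ ℂ))).eq_prod_roots_of_monic (hp.map _),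
    (IsAlgClosed.splits (q.map (algebraMap ℝ ℂ))).eq_prod_roots_of_monic (hq.map _), h]

/-- The classes of projections of `W` that are compatible with the monodromy `M`. -/
def projectionsOf (n : ℕ) (A : Finset ℤ) (d : ℕ) (W : ℤ → Vec D) (M : Module.End ℝ (Vec D)) :
    Set (GenericClass n A d) :=
  {x | ∃ (v : GenericPolygon n A d) (P : Vec D →ₗ[ℝ] Vec d) (g : Module.End ℝ (Vec d)),
    x = v.cls ∧ Function.Surjective P ∧ IsLift (fun i => P (W i)) v.1 ∧ ∀ x, P (M x) = g (P x)}

/-- A compatible projection is determined by its kernel, and the kernel by a divisor of the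
characteristic polynomial, that is, by a submultiset of its at most D + 1 complex roots. -/
theorem encard_projectionsOf_le {M : Module.End ℝ (Vec D)} (hM : disc M ≠ 0) :
    (projectionsOf n A d W M).encard ≤ ((2 ^ (D + 1) : ℕ) : ℕ∞) := by
  let R : Multiset ℂ := (M.charpoly.map (algebraMap ℝ ℂ)).roots
  have hp0 : M.charpoly.map (algebraMap ℝ ℂ) ≠ 0 := (M.charpoly_monic.map _).ne_zero
  have key : ∀ x ∈ projectionsOf n A d W M, ∃ s : Multiset ℂ, s ≤ R ∧
      ∃ (v : GenericPolygon n A d) (P : Vec D →ₗ[ℝ] Vec d) (q : ℝ[X]), x = v.cls ∧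
        Function.Surjective P ∧ IsLift (fun i => P (W i)) v.1 ∧ q.Monic ∧
        (q.map (algebraMap ℝ ℂ)).roots = s ∧ LinearMap.ker P = LinearMap.ker (aeval M q) := by
    rintro x ⟨v, P, g, hx, hP, hv, hPM⟩
    have hmon : (minpoly ℝ (kerRestrict hPM)).Monic :=
      minpoly.monic (Algebra.IsIntegral.isIntegral (kerRestrict hPM))
    have hdvd : minpoly ℝ (kerRestrict hPM) ∣ M.charpoly := by
      apply minpoly.dvd
      refine LinearMap.ext fun y => Subtype.ext ?_
      rw [coe_aeval_kerRestrict, LinearMap.aeval_self_charpoly]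
      rfl
    exact ⟨((minpoly ℝ (kerRestrict hPM)).map (algebraMap ℝ ℂ)).roots,
      roots.le_of_dvd hp0 (Polynomial.map_dvd _ hdvd), v, P, minpoly ℝ (kerRestrict hPM), hx, hP,
      hv, hmon, rfl, ker_eq_ker_aeval hPM hP hM⟩
  choose! κ hκ hκ' using key
  have hinj : Set.InjOn κ (projectionsOf n A d W M) := by
    intro x hx y hy hxy
    obtain ⟨v, P, q, rfl, hP, hv, hq, hqs, hk⟩ := hκ' x hx
    obtain ⟨v', P', q', rfl, hP', hv', hq', hqs', hk'⟩ := hκ' y hy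
    have hqq : q = q' := eq_of_map_roots_eq hq hq' (by rw [hqs, hqs', hxy])
    obtain ⟨g, hg⟩ := exists_linearEquiv_of_ker_eq hP hP' (by rw [hk, hk', hqq])
    refine Quotient.sound ((projEquiv_iff hv hv').2 ⟨g, fun i => ⟨1, one_ne_zero, ?_⟩⟩)
    rw [one_smul, hg]
  refine (Set.encard_le_encard_of_injOn (t := (R.powerset.toFinset : Set (Multiset ℂ)))
    (fun x hx => ?_) hinj).trans ?_
  · exact Finset.mem_coe.2 (Multiset.mem_toFinset.2 (Multiset.mem_powerset.2 (hκ x hx)))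
  · rw [Set.encard_coe_eq_coe_finsetCard, Nat.cast_le]
    refine (Multiset.toFinset_card_le _).trans ?_
    rw [Multiset.card_powerset]
    refine Nat.pow_le_pow_right two_pos ((card_roots' _).trans ?_)
    rw [natDegree_map, LinearMap.charpoly_natDegree]
    simp

/-- A multiplicative cocycle with trivial norm is a coboundary. -/
theorem Period.exists_coboundary (hG : Period n A G) {φ : ℤ → ℝ} (hφ : ∀ i, φ i ≠ 0)
    (hp : Function.Periodic φ G) (h1 : ∏ s ∈ Finset.range G, φ (s * n) = 1) :
    ∃ γ : ℤ → ℝ, (∀ i, γ i ≠ 0) ∧ Function.Periodic γ G ∧ ∀ i, γ (i + n) = γ i * φ i := by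
  have hGpos : (0 : ℤ) < G := by exact_mod_cast hG.pos
  -- ν is an inverse of n modulo G, so ν i is the position of i in the cycle 0, n, 2n, … of
  -- residues.
  obtain ⟨ν, hν⟩ : ∃ ν : ℤ, (G : ℤ) ∣ ν * n - 1 := by
    have hb := Nat.gcd_eq_gcd_ab n G
    rw [hG.coprime] at hb
    push_cast at hb
    exact ⟨n.gcdA G, -n.gcdB G, by rw [hb]; ring⟩
  -- The partial products of φ along this cycle solve the equation; closing up after G steps is the
  -- hypothesis that the norm is 1.
  let p : ℕ → ℝ := fun t => ∏ s ∈ Finset.range t, φ (s * n)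
  have hγp : Function.Periodic (fun i : ℤ => p ((ν * i) % G).toNat) G := fun i => by
    simp [mul_add]
  refine ⟨fun i => p ((ν * i) % G).toNat, fun i => Finset.prod_ne_zero_iff.2 fun s _ => hφ _,
    hγp, fun i => ?_⟩
  obtain ⟨t, ht⟩ : ∃ t : ℕ, (t : ℤ) = (ν * i) % G :=
    ⟨((ν * i) % G).toNat, Int.toNat_of_nonneg (Int.emod_nonneg _ hGpos.ne')⟩
  have htG : t < G := by
    have := Int.emod_lt_of_pos (ν * i) hGpos
    omega
  have e1 : (ν * (i + n)) % G = (t + 1) % G := by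
    obtain ⟨c, hc⟩ := hν
    rw [show ν * (i + n) = ν * i + 1 + G * c by rw [← hc]; ring, Int.add_mul_emod_self_left,
      Int.add_emod, ← ht, Int.add_emod_emod]
  have e2 : φ (t * n) = φ i := by
    refine periodic_of_dvd hp ?_
    obtain ⟨c, hc⟩ := hν
    have h3 : (G : ℤ) ∣ ν * i - t := by rw [ht]; exact Int.dvd_self_sub_emod
    obtain ⟨c', hc'⟩ := h3
    refine ⟨c * i - c' * n, ?_⟩
    linear_combination i * hc - n * hc'
  change p ((ν * (i + n)) % G).toNat = p ((ν * i) % G).toNat * φ i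
  rw [e1, ← ht, Int.toNat_natCast, ← e2]
  have e3 : p (t + 1) = p t * φ (t * n) := Finset.prod_range_succ _ _
  rcases Nat.lt_or_ge (t + 1) G with h | h
  · rw [Int.emod_eq_of_lt (by positivity) (by exact_mod_cast h), ← e3]
    congr 1
  · have hG1 : t + 1 = G := by omega
    rw [← e3, hG1]
    have : ((t : ℤ) + 1) % G = 0 := by
      rw [← hG1]; push_cast; exact Int.emod_self
    rw [this]
    exact h1.symm

theorem IsMono.mul_diag {M Γ : Module.End ℝ (Vec D)} {σ : ℤ → ℝ} (h : IsMono n W M)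
    (hσ : ∀ i, σ i ≠ 0) (hΓ : ∀ i, Γ (W i) = σ i • W i) : IsMono n W (M * Γ) := by
  obtain ⟨c, hc, hM⟩ := h
  refine ⟨fun i => σ i * c i, fun i => mul_ne_zero (hσ i) (hc i), fun i => ?_⟩
  rw [Module.End.mul_apply, hΓ, map_smul, hM, smul_smul]

/-- The monodromy of a generic projection of `W` lifts to a monodromy of `W`. -/
theorem exists_mono_of_projection {a : ℤ → ℤ → ℝ} (h : IsData n A lo hi D d) (hW : IsSol A a W)
    {P : Vec D →ₗ[ℝ] Vec d} {v : ℤ → RP d} (hv : IsLift (fun i => P (W i)) v)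
    (ht : IsTwisted n v) (hg : InGeneralPosition A v) :
    ∃ (M : Module.End ℝ (Vec D)) (g : Vec d ≃ₗ[ℝ] Vec d), IsMono n W M ∧
      ∀ x, P (M x) = g (P x) := by
  obtain ⟨g, hgc⟩ := (isTwisted_iff hv).1 ht
  choose c hc hcP using hgc
  have hgP : ∀ i, P ((c i)⁻¹ • W (i + n)) = g (P (W i)) := fun i => by
    rw [map_smul, hcP, smul_smul, inv_mul_cancel₀ (hc i), one_smul]
  have hgen := (inGeneralPosition_iff hv).1 hg
  -- This rescaled shift projects to g(P(W i)), which satisfies the rows of `W`. By `Rel.of_map` it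
  -- satisfies them upstairs, so it is a linear image of `W`.
  have hrel : Rel A a (fun i => (c i)⁻¹ • W (i + n)) := by
    have hsh : Rel A (fun j k => a j (k + n)) (fun i => W (i + n)) := fun k => by
      simpa only [add_right_comm] using hW.rel (k + n)
    refine Rel.of_map P (hsh.smul (fun i => inv_ne_zero (hc i)) (fun _ => 1))
      (fun k => ⟨hi, h.hi_mem, ?_⟩) (fun k => ?_) ?_
    · exact div_ne_zero (mul_ne_zero one_ne_zero (hW.ne _ h.hi_mem _)) (inv_ne_zero (hc _))
    · simp only [hgP]
      exact (genPos_iff.2 fun j₀ hj₀ x hx => genPos_iff.1 (hgen k) j₀ hj₀ x (by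
        apply g.injective
        rw [map_zero, ← hx, map_sum]
        exact Finset.sum_congr rfl fun j _ => map_smul _ _ _))
    · simp only [hgP]
      exact (hW.rel.map P).map g.toLinearMap
  obtain ⟨M, hM⟩ := hW.exists_linearMap h.toIsSpan hrel
  refine ⟨M, g, ⟨fun i => (c i)⁻¹, fun i => inv_ne_zero (hc i), fun i => (hM i).symm⟩, fun x => ?_⟩
  exact LinearMap.congr_fun (f := P ∘ₗ M) (g := g.toLinearMap ∘ₗ P)
    (linearMap_ext_of_window hW.window fun i => by
      rw [LinearMap.comp_apply, ← hM i]
      exact hgP i) x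

/-- A real positive G-th root exists only for positive numbers, so a sequence of norm -1 serves as
the normal form for negative norms. -/
theorem Period.exists_sign (hG : Period n A G) : ∃ σ : ℤ → ℝ, (∀ i, σ i ≠ 0) ∧
    Function.Periodic σ G ∧ ∏ s ∈ Finset.range G, σ (s * n) = -1 := by
  refine ⟨fun i => if (G : ℤ) ∣ i then -1 else 1, fun i => by
    dsimp only
    split_ifs <;> norm_num, ?_, ?_⟩
  · intro i
    simp
  · rw [Finset.prod_eq_single_of_mem 0 (Finset.mem_range.2 hG.pos)]
    · simp
    · intro s hs hs0
      refine if_neg fun hdvd => ?_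
      have h2 : G ∣ s * n := by exact_mod_cast hdvd
      have h3 := Nat.le_of_dvd (Nat.pos_of_ne_zero hs0) (hG.coprime.symm.dvd_of_dvd_mul_right h2)
      have := Finset.mem_range.1 hs
      omega

/-- The normal forms of the monodromies of generic projections. -/
theorem mem_projectionsOf {a : ℤ → ℤ → ℝ} (hG : Period n A G) (h : IsData n A lo hi D d)
    (hW : IsSol A a W) {M : Module.End ℝ (Vec D)} (hM : IsMono n W M)
    {v : GenericPolygon n A d} {P : Vec D →ₗ[ℝ] Vec d}
    (hv : IsLift (fun i => P (W i)) v.1)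
    {e σ : ℤ → ℝ} {Γ Γσ : Module.End ℝ (Vec D)} (he0 : ∀ i, e i ≠ 0) (he : Function.Periodic e G)
    (hΓ : ∀ i, Γ (W i) = e i • W i) {g : Vec d ≃ₗ[ℝ] Vec d} (hg : ∀ x, P ((M * Γ) x) = g (P x))
    (hσ0 : ∀ i, σ i ≠ 0) (hσ : Function.Periodic σ G) (hΓσ : ∀ i, Γσ (W i) = σ i • W i)
    (hsign : 0 < (∏ s ∈ Finset.range G, σ (s * n)) / ∏ s ∈ Finset.range G, e (s * n)) :
    v.cls ∈ projectionsOf n A d W (M * Γσ) := by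
  obtain ⟨z, hz0, hz⟩ : ∃ z : ℝ, 0 < z ∧
      z ^ G = (∏ s ∈ Finset.range G, σ (s * n)) / ∏ s ∈ Finset.range G, e (s * n) :=
    ⟨_, Real.rpow_pos_of_pos hsign _, Real.rpow_inv_natCast_pow hsign.le hG.pos.ne'⟩
  have hE0 : ∏ s ∈ Finset.range G, e (s * n) ≠ 0 := Finset.prod_ne_zero_iff.2 fun s _ => he0 _
  have hS0 : ∏ s ∈ Finset.range G, σ (s * n) ≠ 0 := Finset.prod_ne_zero_iff.2 fun s _ => hσ0 _
  -- By the choice of z the sequence z e / σ has norm 1. Rescaling `W` by the resulting γ changes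
  -- the lift of `v` but not `v`, and replaces the factor e of the monodromy by σ.
  obtain ⟨γ, hγ0, hγ, hγn⟩ := hG.exists_coboundary (φ := fun i => z * e i / σ i)
    (fun i => div_ne_zero (mul_ne_zero hz0.ne' (he0 i)) (hσ0 i))
    (fun i => by simp only [he i, hσ i]) (by
      rw [Finset.prod_div_distrib, Finset.prod_mul_distrib, Finset.prod_const, Finset.card_range,
        hz]
      field_simp)
  obtain ⟨Γ', hΓ'⟩ := hG.exists_diag h.toIsSpan hW hγ
  have hlift : IsLift (fun i => (P ∘ₗ Γ') (W i)) v.1 := by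
    have : (fun i => (P ∘ₗ Γ') (W i)) = fun i => γ i • P (W i) := by
      ext1 i; rw [LinearMap.comp_apply, hΓ', map_smul]
    rw [this]
    exact hv.smul hγ0
  obtain ⟨c, hc, hcM⟩ := hM
  refine ⟨v, P ∘ₗ Γ', z • g.toLinearMap, rfl, surjective_of_genPos h.card h.hi_mem
    ((inGeneralPosition_iff hlift).1 v.2.2 0) fun _ => rfl, hlift, fun x => ?_⟩
  refine LinearMap.congr_fun (f := (P ∘ₗ Γ') ∘ₗ (M * Γσ)) (g := (z • g.toLinearMap) ∘ₗ P ∘ₗ Γ')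
    (linearMap_ext_of_window hW.window fun i => ?_) x
  have h1 := hg (W i)
  rw [Module.End.mul_apply, hΓ, map_smul, hcM, map_smul, map_smul] at h1
  simp only [LinearMap.comp_apply, Module.End.mul_apply, hΓσ, map_smul, hcM, hΓ', hγn,
    LinearMap.smul_apply, LinearEquiv.coe_coe, ← h1, smul_smul]
  congr 1
  field_simp [hσ0 i]

/-- The monodromy of a polygon over `w` is that of `w` times a periodic factor; the sign of its norm
decides between the normal forms M and M Γσ, each allowing at most 2^(D+1) classes. -/
theorem encard_fiber_le (hG : Period n A G) (h : IsData n A lo hi D d)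
    {y : CorrugatedClass n A D} (hy : y ∈ sepSet n A D) :
    (corrugation h ⁻¹' {y}).encard ≤ ((2 ^ (D + 1) + 2 ^ (D + 1) : ℕ) : ℕ∞) := by
  obtain ⟨w, rfl, W, M, hW, hM, hdisc⟩ := hy
  have hsol := isSol_nrow h.hi_mem hW w.2.2.1 w.2.2.2.1 w.2.2.2.2
  obtain ⟨σ, hσ0, hσ, hσ1⟩ := hG.exists_sign
  obtain ⟨Γσ, hΓσ⟩ := hG.exists_diag h.toIsSpan hsol hσ
  have hMσ := hM.mul_diag hσ0 hΓσ
  have hsub : corrugation h ⁻¹' {w.cls} ⊆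
      projectionsOf n A d W M ∪ projectionsOf n A d W (M * Γσ) := by
    intro x hx
    obtain ⟨v, rfl⟩ := Quotient.exists_rep x
    have hproj : IsProjectionOf w.1 v.1 := (corrugation_eq_iff h v w).1 hx
    obtain ⟨P, -, hv⟩ := hproj.exists_isLift hW
    obtain ⟨M', g, hM', hg⟩ := exists_mono_of_projection h hsol hv v.2.1 v.2.2
    obtain ⟨e, Γ, he0, he, hΓ, rfl⟩ := hM.exists_diag hG h.toIsSpan hsol hM'
    have hE0 : ∏ s ∈ Finset.range G, e (s * n) ≠ 0 := Finset.prod_ne_zero_iff.2 fun s _ => he0 _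
    rcases lt_or_gt_of_ne hE0 with hE | hE
    · right
      exact mem_projectionsOf hG h hsol hM hv he0 he hΓ hg hσ0 hσ hΓσ
        (by rw [hσ1]; exact div_pos_of_neg_of_neg (by norm_num) hE)
    · left
      have := mem_projectionsOf hG h hsol hM hv he0 he hΓ hg (σ := fun _ => 1)
        (fun _ => one_ne_zero) (fun _ => rfl) (Γσ := 1) (fun i => (one_smul ℝ _).symm)
        (by rw [Finset.prod_const_one]; exact one_div_pos.2 hE)
      rwa [mul_one] at this
  refine (Set.encard_le_encard hsub).trans ((Set.encard_union_le _ _).trans ?_)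
  rw [Nat.cast_add]
  exact add_le_add (encard_projectionsOf_le hdisc)
    (encard_projectionsOf_le (hM.disc_ne_zero hG h.toIsSpan hsol hMσ hdisc))

end Fibers

end Pentagram

namespace Pentagram

/-! ### Products of difference operators -/

section Operators

variable {S S' : Finset ℤ} {b c x : ℤ → ℤ → ℝ}

theorem opMul_eq_sum_left (hb : ∀ j ∉ S, ∀ k, b j k = 0) (x : ℤ → ℤ → ℝ) (j k : ℤ) :
    opMul b x j k = ∑ i ∈ S, b i k * x (j - i) (k + i) := by
  refine finsum_eq_sum_of_support_subset _ fun i hi => ?_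
  by_contra hiS
  exact hi (by simp only [hb i hiS, zero_mul])

theorem opMul_eq_sum_right (hc : ∀ j ∉ S, ∀ k, c j k = 0) (x : ℤ → ℤ → ℝ) (j k : ℤ) :
    opMul x c j k = ∑ l ∈ S, x (j - l) k * c l (k + j - l) := by
  unfold opMul
  rw [← finsum_comp_equiv (Equiv.subLeft j)]
  have : ∀ l : ℤ, x ((Equiv.subLeft j) l) k * c (j - (Equiv.subLeft j) l)
      (k + (Equiv.subLeft j) l) = x (j - l) k * c l (k + j - l) := fun l => by
    simp only [Equiv.subLeft_apply, sub_sub_cancel, add_sub_assoc]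
  simp only [this]
  refine finsum_eq_sum_of_support_subset _ fun i hi => ?_
  by_contra hiS
  exact hi (by simp only [hc i hiS, mul_zero])

/-- With finitely supported outer factors all sums are finite, so nothing is required of `x`. -/
theorem opMul_assoc (hb : ∀ j ∉ S, ∀ k, b j k = 0) (hc : ∀ j ∉ S', ∀ k, c j k = 0)
    (x : ℤ → ℤ → ℝ) : opMul (opMul b x) c = opMul b (opMul x c) := by
  ext j k
  rw [opMul_eq_sum_right hc, opMul_eq_sum_left hb]
  simp only [opMul_eq_sum_right hc, opMul_eq_sum_left hb, Finset.sum_mul, Finset.mul_sum]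
  rw [Finset.sum_comm]
  refine Finset.sum_congr rfl fun i _ => Finset.sum_congr rfl fun l _ => ?_
  rw [show j - l - i = j - i - l by ring, show k + i + (j - i) - l = k + j - l by ring, mul_assoc]

theorem opOne_eq_zero : ∀ j ∉ ({0} : Finset ℤ), ∀ k, opOne j k = 0 := fun _ hj _ =>
  if_neg fun h => hj (Finset.mem_singleton.2 h)

theorem opOne_opMul (x : ℤ → ℤ → ℝ) : opMul opOne x = x := by
  ext j k
  rw [opMul_eq_sum_left opOne_eq_zero]
  simp [opOne]

theorem opMul_opOne (x : ℤ → ℤ → ℝ) : opMul x opOne = x := by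
  ext j k
  rw [opMul_eq_sum_right opOne_eq_zero]
  simp [opOne]

/-- An operator with nonvanishing lowest coefficient is not a zero divisor. -/
theorem eq_zero_of_opMul_eq_zero {μ : ℤ} (hμ : μ ∈ S) (hle : ∀ j ∈ S, μ ≤ j)
    (hb : ∀ j ∉ S, ∀ k, b j k = 0) (hne : ∀ k, b μ k ≠ 0) {N : ℤ} (hN : ∀ j < N, ∀ k, x j k = 0)
    (h : opMul b x = 0) : x = 0 := by
  have key : ∀ s : ℕ, ∀ j < N + s, ∀ k, x j k = 0 := by
    intro s
    induction s with
    | zero => simpa using hN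
    | succ s ih =>
      intro j hj k
      push_cast at hj
      rcases lt_or_eq_of_le (show j ≤ N + s by omega) with hlt | heq
      · exact ih j hlt k
      · have h1 := congrFun (congrFun h (j + μ)) (k - μ)
        rw [opMul_eq_sum_left hb, Finset.sum_eq_single_of_mem μ hμ] at h1
        · rw [add_sub_cancel_right, sub_add_cancel] at h1
          exact (mul_eq_zero.1 h1).resolve_left (hne _)
        · intro i hi hiμ
          have := hle i hi
          rw [ih _ (by omega), mul_zero]
  ext j k
  exact key (j - N + 1).toNat j (by omega) k

/-- The coefficients of the inverse of an operator with lowest exponent `μ`. -/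
def invNat (S : Finset ℤ) (μ : ℤ) (b : ℤ → ℤ → ℝ) : ℕ → ℤ → ℝ
  | s, k => ((if s = 0 then 1 else 0) - ∑ i ∈ S, if _h : μ < i ∧ i - μ ≤ s then
      b i (k - μ) * invNat S μ b (s - (i - μ).toNat) (k - μ + i) else 0) / b μ (k - μ)
termination_by s => s
decreasing_by omega

theorem exists_rightInverse {μ : ℤ} (hμ : μ ∈ S) (hle : ∀ j ∈ S, μ ≤ j)
    (hb : ∀ j ∉ S, ∀ k, b j k = 0) (hne : ∀ k, b μ k ≠ 0) :
    ∃ I : ℤ → ℤ → ℝ, (∀ j < -μ, ∀ k, I j k = 0) ∧ opMul b I = opOne := by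
  let I : ℤ → ℤ → ℝ := fun j k => if 0 ≤ j + μ then invNat S μ b (j + μ).toNat k else 0
  have hI : ∀ j < -μ, ∀ k, I j k = 0 := fun j hj k => if_neg (by omega)
  refine ⟨I, hI, ?_⟩
  ext j k
  rw [opMul_eq_sum_left hb]
  rcases lt_or_ge j 0 with hj | hj
  · rw [opOne, if_neg hj.ne]
    refine Finset.sum_eq_zero fun i hi => ?_
    have := hle i hi
    rw [hI _ (by omega), mul_zero]
  · have e1 : I (j - μ) (k + μ) = invNat S μ b j.toNat (k + μ) := by
      have : j - μ + μ = j := by ring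
      simp only [I, this, if_pos hj]
    have e2 : b μ k * I (j - μ) (k + μ) = opOne j k - ∑ i ∈ S, if μ < i ∧ i - μ ≤ (j.toNat : ℤ) then
        b i k * invNat S μ b (j.toNat - (i - μ).toNat) (k + i) else 0 := by
      rw [e1, invNat, add_sub_cancel_right, mul_div_cancel₀ _ (hne k), opOne]
      have : j.toNat = 0 ↔ j = 0 := by omega
      simp only [this, dite_eq_ite]
    rw [← Finset.add_sum_erase S _ hμ, e2, ← Finset.add_sum_erase S _ hμ,
      if_neg (fun h => lt_irrefl _ h.1), zero_add, sub_add_eq_add_sub, add_sub_assoc,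
      ← Finset.sum_sub_distrib, Finset.sum_eq_zero, add_zero]
    intro i hi
    have h1 := hle i (Finset.mem_of_mem_erase hi)
    have h2 := Finset.ne_of_mem_erase hi
    by_cases h3 : i - μ ≤ (j.toNat : ℤ)
    · rw [if_pos ⟨by omega, h3⟩]
      have : (j - i + μ).toNat = j.toNat - (i - μ).toNat := by omega
      simp only [I, this]
      rw [if_pos (by omega), sub_self]
    · rw [if_neg (fun h => h3 h.2), hI _ (by omega), mul_zero, sub_zero]

/-- An operator with nonvanishing lowest coefficient is invertible. -/
theorem exists_inverse {n : ℕ} {μ : ℤ} (hμ : μ ∈ S) (hle : ∀ j ∈ S, μ ≤ j)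
    (hb : ∀ j ∉ S, ∀ k, b j k = 0) (hne : ∀ k, b μ k ≠ 0) (hper : ∀ j k, b j (k + n) = b j k) :
    ∃ I : ℤ → ℤ → ℝ, IsPseudoDiff n I ∧ opMul b I = opOne ∧ opMul I b = opOne := by
  obtain ⟨I, hI, hbI⟩ := exists_rightInverse hμ hle hb hne
  refine ⟨I, ⟨⟨-μ, hI⟩, fun j k => ?_⟩, hbI, ?_⟩
  · have := eq_zero_of_opMul_eq_zero (x := fun j k => I j (k + n) - I j k) hμ hle hb hne (N := -μ)
      (fun j hj k => by rw [hI j hj, hI j hj, sub_self]) (by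
        ext j k
        have h1 := congrFun (congrFun hbI j) (k + n)
        have h2 := congrFun (congrFun hbI j) k
        rw [opMul_eq_sum_left hb] at h1 h2 ⊢
        simp only [mul_sub, Finset.sum_sub_distrib, h2]
        simp only [hper, add_right_comm k (n : ℤ)] at h1
        rw [h1]
        exact sub_self _)
    exact sub_eq_zero.1 (congrFun (congrFun this j) k)
  -- `b` annihilates I b - 1 from the left because b I = 1.
  · have := eq_zero_of_opMul_eq_zero (x := fun j k => opMul I b j k - opOne j k) hμ hle hb hne
      (N := min 0 (μ - μ)) (fun j hj k => ?_) (by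
        ext j k
        have h1 := congrFun (congrFun (opMul_assoc hb hb I) j) k
        rw [hbI, opOne_opMul, opMul_eq_sum_left hb] at h1
        have h2 := congrFun (congrFun (opMul_opOne b) j) k
        rw [opMul_eq_sum_left hb] at h2 ⊢
        simp only [mul_sub, Finset.sum_sub_distrib, ← h1, h2]
        exact sub_self _)
    · ext j k
      exact sub_eq_zero.1 (congrFun (congrFun this j) k)
    · rw [opMul_eq_sum_right hb, opOne, if_neg (by omega), sub_zero]
      refine Finset.sum_eq_zero fun l hl => ?_
      have := hle l hl
      rw [hI _ (by omega), zero_mul]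

theorem opPart_eq_zero (S : Finset ℤ) (a : ℤ → ℤ → ℝ) : ∀ j ∉ S, ∀ k, opPart S a j k = 0 :=
  fun _ hj _ => if_neg hj

end Operators

/-! ### A polygon and its corrugation have the same Lax operator -/

section SameLax

variable {n : ℕ} {Ap Am : Finset ℤ} {lo hi : ℤ} {D d : ℕ}

theorem isQuasiPeriodicLift_of_isLift {r : ℕ} {V : ℤ → Vec r} {v : ℤ → RP r} (h : IsLift V v)
    {g : Vec r ≃ₗ[ℝ] Vec r} (hg : ∀ i, V (i + n) = g (V i)) : IsQuasiPeriodicLift n v V :=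
  ⟨fun i => ⟨(h i).1, by rw [← pt_eq_mk, (h i).2]⟩, g, hg⟩

theorem IsQuasiPeriodicLift.isLift {r : ℕ} {V : ℤ → Vec r} {v : ℤ → RP r}
    (h : IsQuasiPeriodicLift n v V) : IsLift V v := fun i => by
  obtain ⟨h0, h1⟩ := h.1 i
  exact ⟨h0, by rw [pt_eq_mk h0, h1]⟩

/-- The periodic operator of a quasi-periodic lift of `v` also annihilates its fundamental solution,
so the two Lax operators are literally equal and the conjugation is trivial. -/
theorem sameLax_of_corrugation (h : IsData n (Ap ∪ Am) lo hi D d) (hm : Am.Nonempty)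
    {v : GenericPolygon n (Ap ∪ Am) d} {w : CorrugatedPolygon n (Ap ∪ Am) D}
    (hvw : corrugation h v.cls = w.cls) : SameLax n Ap Am v.1 w.1 := by
  obtain ⟨V, g, M, P, hV, hg, hper, hrel, hsol, hM, hP, hVP, hPM⟩ := exists_model h v.2.1 v.2.2
  set a := nrow (Ap ∪ Am) hi V
  set W₀ := fundSol (Ap ∪ Am) lo D a
  let w₀ : CorrugatedPolygon n (Ap ∪ Am) D := ⟨_, fundSol_mem_corrugated h hV v.2.2 v.2.1⟩
  have hFw : corrugation h v.cls = w₀.cls :=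
    (corrugation_eq_iff h v w₀).2 (fundSol_projection h hV v.2.2).2
  have hww : ProjEquiv w₀.1 w.1 := Quotient.exact (hFw.symm.trans hvw)
  obtain ⟨f, hf⟩ := hww.exists_isLift (V := W₀) hsol.isLift
  have hsupp : ∀ j ∉ Ap ∪ Am, ∀ k, a j k = 0 := by
    intro j hj k
    have h1 : j ∉ (Ap ∪ Am).erase hi := fun h => hj (Finset.mem_of_mem_erase h)
    have h2 : j ≠ hi := fun h' => hj (h' ▸ h.hi_mem)
    simp only [a, nrow, dif_neg h1, if_neg h2]
  have hne : ∀ k, ∃ j, a j k ≠ 0 := fun k => ⟨hi, hsol.ne hi h.hi_mem k⟩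
  have hμ := Am.min'_mem hm
  obtain ⟨I, hI, hI1, hI2⟩ := exists_inverse (b := opPart Am a) (n := n) hμ
    (fun j hj => Am.min'_le j hj) (opPart_eq_zero Am a)
    (fun k => by
      rw [opPart, if_pos hμ]
      exact hsol.ne _ (Finset.mem_union_right _ hμ) k)
    (fun j k => by simp only [opPart, hper])
  refine ⟨opMul I (opPart Ap a), opMul I (opPart Ap a), ⟨a, I, ⟨hsupp, hper, hne, V,
    isQuasiPeriodicLift_of_isLift hV hg, hrel⟩, hI, hI1, hI2, rfl⟩, ⟨a, I, ⟨hsupp, hper, hne,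
    fun i => f (W₀ i), isQuasiPeriodicLift_of_isLift hf (g := (f.symm.trans M).trans f)
      (fun i => by simp [hM]), hsol.rel.map f.toLinearMap⟩, hI, hI1, hI2, rfl⟩,
    fun _ => 1, 1, one_ne_zero, fun _ => one_ne_zero, fun _ => (one_mul _).symm, fun j k => ?_⟩
  rw [one_mul, div_one]

end SameLax

end Pentagram

namespace Pentagram

/-! ### Coprimality of the two parts of an operator -/

section Cop

variable {n : ℕ} {A Ap Am : Finset ℤ} {lo hi : ℤ} {D d : ℕ} {b : ℤ → ℤ → ℝ}

/-- The matrix of the equations `∑ b j (s - j) * r (s - j) = 0`, the sum being over `j ∈ Ap` or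
over `j ∈ Am`, for `s ∈ [l, l + D]`. -/
def copMat (Ap Am : Finset ℤ) (hi : ℤ) (D : ℕ) (b : ℤ → ℤ → ℝ) (l : ℤ) :
    Matrix (Fin (D + 1) × Bool) (Fin (2 * D + 2)) ℝ :=
  -- The unknowns are the values of r on [l - hi, l + D - lo], which number 2 D + 2. The 2 (D + 1)
  -- equations thus form a square system, an analogue of the Sylvester matrix.
  Matrix.of fun s m => if (s.1 : ℤ) + hi - ((m : ℕ) : ℤ) ∈ (if s.2 then Ap else Am) then
    b (s.1 + hi - (m : ℕ)) (l - hi + (m : ℕ)) else 0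

/-- The equations of `copMat` have only the zero solution. -/
def Cop (Ap Am : Finset ℤ) (hi : ℤ) (D : ℕ) (b : ℤ → ℤ → ℝ) (l : ℤ) : Prop :=
  Function.Injective (copMat Ap Am hi D b l).mulVec

theorem copMat_mulVec (hA : IsSpan (Ap ∪ Am) lo hi D) (b : ℤ → ℤ → ℝ) (l : ℤ) (r : ℤ → ℝ)
    (s : Fin (D + 1)) (ε : Bool) :
    (copMat Ap Am hi D b l).mulVec (fun m => r (l - hi + (m : ℕ))) (s, ε) =
      ∑ j ∈ (if ε then Ap else Am), b j (l + s - j) * r (l + s - j) := by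
  have hh := hA.hi_eq
  have hsub : (if ε then Ap else Am) ⊆ Ap ∪ Am := by
    split_ifs
    · exact Finset.subset_union_left
    · exact Finset.subset_union_right
  have hs := s.2
  simp only [Matrix.mulVec, dotProduct, copMat, Matrix.of_apply, ite_mul, zero_mul]
  rw [← Finset.sum_filter]
  refine Finset.sum_bij (fun m _ => (s : ℤ) + hi - ((m : ℕ) : ℤ)) ?_ ?_ ?_ ?_
  · intro m hm
    exact (Finset.mem_filter.1 hm).2
  · intro m _ m' _ h
    ext; omega
  · intro j hj
    have h1 := hA.lo_le j (hsub hj)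
    have h2 := hA.le_hi j (hsub hj)
    have e : (s : ℤ) + hi - ((((s : ℤ) + hi - j).toNat : ℕ) : ℤ) = j := by omega
    exact ⟨⟨((s : ℤ) + hi - j).toNat, by omega⟩,
      Finset.mem_filter.2 ⟨Finset.mem_univ _, e.symm ▸ hj⟩, e⟩
  · intro m _
    rw [show l + (s : ℤ) - (s + hi - (m : ℕ)) = l - hi + (m : ℕ) by ring]

theorem cop_iff (hA : IsSpan (Ap ∪ Am) lo hi D) {l : ℤ} : Cop Ap Am hi D b l ↔ ∀ r : ℤ → ℝ,
    (∀ s, l ≤ s → s ≤ l + D → ∑ j ∈ Ap, b j (s - j) * r (s - j) = 0 ∧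
      ∑ j ∈ Am, b j (s - j) * r (s - j) = 0) →
    ∀ m, l - hi ≤ m → m ≤ l + D - lo → r m = 0 := by
  have hh := hA.hi_eq
  have hinj : Cop Ap Am hi D b l ↔ ∀ x, (copMat Ap Am hi D b l).mulVec x = 0 → x = 0 :=
    injective_iff_map_eq_zero (Matrix.mulVecLin (copMat Ap Am hi D b l))
  rw [hinj]
  constructor
  · intro h r hr m h1 h2
    have := h (fun m => r (l - hi + (m : ℕ))) (by
      ext ⟨s, ε⟩
      have hs := s.2
      rw [copMat_mulVec hA]
      have := hr (l + s) (by omega) (by omega)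
      cases ε
      · exact this.2
      · exact this.1)
    have := congrFun this ⟨(m - (l - hi)).toNat, by omega⟩
    have e : l - hi + (((m - (l - hi)).toNat : ℕ) : ℤ) = m := by omega
    simpa only [e, Pi.zero_apply] using this
  · intro h x hx
    let r : ℤ → ℝ := fun m => if hm : (m - (l - hi)).toNat < 2 * D + 2 then
      x ⟨(m - (l - hi)).toNat, hm⟩ else 0
    have hxr : x = fun m : Fin (2 * D + 2) => r (l - hi + (m : ℕ)) := by
      ext m
      have e : (l - hi + (m : ℕ) - (l - hi)).toNat = m := by omega
      simp only [r, e, m.2, dif_pos]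
    have hr := h r (fun s h1 h2 => by
      obtain ⟨t, rfl⟩ : ∃ t : ℕ, s = l + t := ⟨(s - l).toNat, by omega⟩
      have ht : t < D + 1 := by omega
      rw [hxr] at hx
      have h3 := congrFun hx (⟨t, ht⟩, true)
      have h4 := congrFun hx (⟨t, ht⟩, false)
      rw [copMat_mulVec hA] at h3 h4
      exact ⟨h3, h4⟩)
    rw [hxr]
    ext m
    have := m.2
    exact hr _ (by omega) (by omega)

/-- Coprimality is invariant under changes of scale. -/
theorem Cop.gauge (hA : IsSpan (Ap ∪ Am) lo hi D) {l : ℤ} (h : Cop Ap Am hi D b l)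
    {b' : ℤ → ℤ → ℝ} {t β : ℤ → ℝ} (ht : ∀ k, t k ≠ 0)
    (hb : ∀ j ∈ Ap ∪ Am, ∀ k, b' j k * β (k + j) = t k * b j k) : Cop Ap Am hi D b' l := by
  rw [cop_iff hA] at h ⊢
  intro r hr m h1 h2
  have := h (fun m => t m * r m) (fun s hs1 hs2 => ?_) m h1 h2
  · exact (mul_eq_zero.1 this).resolve_left (ht m)
  · have key : ∀ S ⊆ Ap ∪ Am, ∑ j ∈ S, b' j (s - j) * r (s - j) = 0 →
        ∑ j ∈ S, b j (s - j) * (t (s - j) * r (s - j)) = 0 := by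
      intro S hS h0
      rw [← mul_zero (β s), ← h0, Finset.mul_sum]
      refine Finset.sum_congr rfl fun j hj => ?_
      have := hb j (hS hj) (s - j)
      rw [sub_add_cancel] at this
      linear_combination -r (s - j) * this
    exact ⟨key Ap Finset.subset_union_left (hr s hs1 hs2).1,
      key Am Finset.subset_union_right (hr s hs1 hs2).2⟩

theorem IsSol.row_eq {a b : ℤ → ℤ → ℝ} (hA : IsSpan A lo hi D) {W : ℤ → Vec D} (ha : IsSol A a W)
    {β : ℤ → ℝ} (hb : IsSol A b (fun i => β i • W i)) :
    ∃ t : ℤ → ℝ, (∀ k, t k ≠ 0) ∧ ∀ j ∈ A, ∀ k, b j k * β (k + j) = t k * a j k := by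
  have : ∀ k, ∃ t : ℝ, ∀ j ∈ A, b j k * β (k + j) = t * a j k := fun k =>
    (ha.genPos hA k).proportional (by
      have := hb.rel k
      simpa only [smul_smul] using this) (ha.rel k) ⟨hi, hA.hi_mem, ha.ne _ hA.hi_mem k⟩
  choose t ht using this
  refine ⟨t, fun k h0 => ?_, fun j hj k => ht k j hj⟩
  have h1 := ht k hi hA.hi_mem
  rw [h0, zero_mul] at h1
  have h2 : β (k + hi) ≠ 0 := by
    intro h
    have := ne_zero_of_window (W := fun i => β i • W i) hb.window (k + hi)
    simp [h] at this
  exact mul_ne_zero (hb.ne _ hA.hi_mem k) h2 h1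

/-- The classes of corrugated polygons whose operators have coprime parts. -/
def copSet (n : ℕ) (Ap Am : Finset ℤ) (hi : ℤ) (D : ℕ) : Set (CorrugatedClass n (Ap ∪ Am) D) :=
  {y | ∃ w : CorrugatedPolygon n (Ap ∪ Am) D, y = w.cls ∧ ∃ (W : ℤ → Vec D) (a : ℤ → ℤ → ℝ),
    IsLift W w.1 ∧ IsSol (Ap ∪ Am) a W ∧ ∀ l, Cop Ap Am hi D a l}

theorem cop_of_mem_copSet (hA : IsSpan (Ap ∪ Am) lo hi D) {w : CorrugatedPolygon n (Ap ∪ Am) D}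
    (h : w.cls ∈ copSet n Ap Am hi D) {W : ℤ → Vec D} (hW : IsLift W w.1)
    (hb : IsSol (Ap ∪ Am) b W) (l : ℤ) : Cop Ap Am hi D b l := by
  obtain ⟨w', hww, W', a, hW', ha, hcop⟩ := h
  have hp : ProjEquiv w'.1 w.1 := Quotient.exact hww.symm
  obtain ⟨g, hg⟩ := hp.exists_isLift hW'
  obtain ⟨β, -, hβW⟩ := hg.exists_smul hW
  rw [funext hβW] at hb
  obtain ⟨t, ht, htb⟩ := (ha.map g).row_eq hA hb
  exact (hcop l).gauge hA ht htb

theorem cop_shift (hA : IsSpan (Ap ∪ Am) lo hi D) {W : ℤ → Vec D}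
    (hb : IsSol (Ap ∪ Am) b W) {M : Vec D ≃ₗ[ℝ] Vec D} {c : ℤ → ℝ} (hc : ∀ i, c i ≠ 0)
    (hM : ∀ i, W (i + n) = c i • M (W i)) (l : ℤ) :
    Cop Ap Am hi D b (l + n) ↔ Cop Ap Am hi D b l := by
  have hsh : ∀ q : ℤ, Cop Ap Am hi D b (l + q) ↔ Cop Ap Am hi D (fun j k => b j (k + q)) l := by
    intro q
    rw [cop_iff hA, cop_iff hA]
    constructor
    · intro h r hr m h1 h2
      have := h (fun m => r (m - q)) (fun s h3 h4 => ?_) (m + q) (by omega) (by omega)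
      · simpa using this
      · have h5 := hr (s - q) (by omega) (by omega)
        have e1 : ∀ j, s - q - j + q = s - j := fun j => by ring
        have e2 : ∀ j, s - q - j = s - j - q := fun j => by ring
        simp only [e1] at h5
        simp only [e2] at h5
        exact h5
    · intro h r hr m h1 h2
      have := h (fun m => r (m + q)) (fun s h3 h4 => ?_) (m - q) (by omega) (by omega)
      · simpa using this
      · have h5 := hr (s + q) (by omega) (by omega)
        have e1 : ∀ j, s + q - j = s - j + q := fun j => by ring
        simp only [e1] at h5
        exact h5
  have hsol' : IsSol (Ap ∪ Am) (fun j k => b j (k + n)) (fun i => c i • M (W i)) := by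
    rw [← funext hM]
    exact ⟨fun k => by simpa only [add_right_comm] using hb.rel (k + n), fun j hj k => hb.ne j hj _,
      fun k => by simpa only [add_right_comm] using hb.window (k + n)⟩
  obtain ⟨t, ht, htb⟩ := (hb.map M).row_eq hA hsol'
  rw [hsh]
  refine ⟨fun h => ?_, fun h => h.gauge hA ht htb⟩
  refine h.gauge hA (t := fun k => (t k)⁻¹) (β := fun k => (c k)⁻¹) (fun k => inv_ne_zero (ht k))
    fun j hj k => ?_
  have h1 := htb j hj k
  have h2 := ht k
  have h3 := hc (k + j)
  field_simp
  linear_combination -h1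

end Cop

theorem FunClass.eventually_cop {T : Type*} {C : (T → ℝ) → Prop} {t₀ : T} {𝓕 : Filter T}
    {Ap Am : Finset ℤ} {hi : ℤ} {D : ℕ} (h : FunClass C t₀ 𝓕) {a : T → ℤ → ℤ → ℝ}
    (ha : ∀ j ∈ Ap ∪ Am, ∀ k, C fun t => a t j k) {l : ℤ} (h0 : Cop Ap Am hi D (a t₀) l) :
    ∀ᶠ t in 𝓕, Cop Ap Am hi D (a t) l := by
  refine h.eventually_injective (B := fun t => copMat Ap Am hi D (a t) l) (fun s m => ?_) h0
  simp only [copMat, Matrix.of_apply]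
  split_ifs with h1 h2 h2
  · exact ha _ (Finset.mem_union_left _ h2) _
  · exact h.const 0
  · exact ha _ (Finset.mem_union_right _ h2) _
  · exact h.const 0

/-! ### Openness of the coprime locus, and recovery of an operator from its Lax operator. -/

section CopSet

variable {n : ℕ} {Ap Am : Finset ℤ} {lo hi : ℤ} {D d : ℕ}

theorem isOpen_copSet (hA : IsSpan (Ap ∪ Am) lo hi D) (hn : 0 < n) :
    IsOpen (copSet n Ap Am hi D) := by
  rw [isOpen_iff_mem_nhds]
  intro y hy
  obtain ⟨w₀, rfl⟩ := Quotient.exists_rep y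
  obtain ⟨W₀, hW₀⟩ := exists_isLift w₀.1
  obtain ⟨W, hW, hWc, rfl⟩ := exists_lifts (T := CorrugatedPolygon n (Ap ∪ Am) D)
    (v := fun w => w.1) (continuousAt_coord_corrugated w₀) hW₀
  have hsol := fun w => isSol_nrow hA.hi_mem (hW w) w.2.2.1 w.2.2.2.1 w.2.2.2.2
  have hcop := cop_of_mem_copSet hA hy (hW w₀) (hsol w₀)
  have hfc := funClass_continuousAt w₀
  have hev : ∀ᶠ w in 𝓝 w₀, ∀ l ∈ Finset.Ico (0 : ℤ) n,
      Cop Ap Am hi D (nrow (Ap ∪ Am) hi (W w)) l := by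
    rw [Finset.eventually_all]
    intro l _
    exact hfc.eventually_cop (a := fun w => nrow (Ap ∪ Am) hi (W w))
      (fun j _ k => hfc.nrow hWc hA.hi_mem ((hsol w₀).genPos hA k) j) (hcop l)
  change _ ∈ 𝓝 w₀.cls
  rw [nhds_corrugatedCls]
  change ∀ᶠ w in 𝓝 w₀, CorrugatedPolygon.cls w ∈ copSet n Ap Am hi D
  filter_upwards [hev] with w hw
  obtain ⟨g, hg⟩ := (isTwisted_iff (hW w)).1 w.2.1
  choose c hc hgc using hg
  exact ⟨w, rfl, W w, _, hW w, hsol w, forall_of_shift hn (cop_shift hA (hsol w) hc hgc) hw⟩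

/-- An operator that conjugates both parts of a coprime operator is a scalar. -/
theorem eq_zero_of_cop (hA : IsSpan (Ap ∪ Am) lo hi D) {b R c : ℤ → ℤ → ℝ}
    (hcop : ∀ l, Cop Ap Am hi D b l)
    (hp : opMul R (opPart Ap b) = opPart Ap c) (hm : opMul R (opPart Am b) = opPart Am c)
    {j : ℤ} (hj : j ≠ 0) (k : ℤ) : R j k = 0 := by
  have hh := hA.hi_eq
  -- The products are supported on powers in [lo, hi]; comparing coefficients outside this range
  -- gives homogeneous equations for R.
  have heq : ∀ s, (s < k + lo ∨ k + hi < s) →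
      ∑ i ∈ Ap, b i (s - i) * R (s - i - k) k = 0 ∧ ∑ i ∈ Am, b i (s - i) * R (s - i - k) k = 0 := by
    intro s hs
    have key : ∀ S ⊆ Ap ∪ Am, opMul R (opPart S b) = opPart S c →
        ∑ i ∈ S, b i (s - i) * R (s - i - k) k = 0 := by
      intro S hS h
      have h1 := congrFun (congrFun h (s - k)) k
      rw [opMul_eq_sum_right (opPart_eq_zero S b), opPart, if_neg] at h1
      · rw [← h1]
        refine Finset.sum_congr rfl fun i hi => ?_
        rw [opPart, if_pos hi, mul_comm, show s - k - i = s - i - k by ring,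
          show k + (s - k) - i = s - i by ring]
      · intro hmem
        have := hA.lo_le _ (hS hmem)
        have := hA.le_hi _ (hS hmem)
        omega
    exact ⟨key Ap Finset.subset_union_left hp, key Am Finset.subset_union_right hm⟩
  -- A window of D + 1 equations lying entirely outside the range is chosen so that k + j is its
  -- last unknown if j < 0 and its first one if j > 0.
  rcases lt_or_gt_of_ne hj with h | h
  · have := (cop_iff hA).1 (hcop (k + lo - 1 - D + j + 1)) (fun m => R (m - k) k)
      (fun s h1 h2 => heq s (Or.inl (by omega))) (k + j) (by omega) (by omega)
    simpa using this
  · have := (cop_iff hA).1 (hcop (k + hi + j)) (fun m => R (m - k) k)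
      (fun s h1 h2 => heq s (Or.inr (by omega))) (k + j) (by omega) (by omega)
    simpa using this

theorem opMul_conj {S : Finset ℤ} {b x : ℤ → ℤ → ℝ} (hb : ∀ j ∉ S, ∀ k, b j k = 0) {β : ℤ → ℝ}
    (hβ : ∀ k, β k ≠ 0) :
    opMul (fun j k => β k * b j k / β (k + j)) (fun j k => β k * x j k / β (k + j)) =
      fun j k => β k * opMul b x j k / β (k + j) := by
  ext j k
  rw [opMul_eq_sum_left (S := S) (fun j hj k => by rw [hb j hj, mul_zero, zero_div]),
    opMul_eq_sum_left hb, Finset.mul_sum, Finset.sum_div]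
  refine Finset.sum_congr rfl fun i _ => ?_
  have h1 := hβ (k + i)
  have h2 := hβ (k + j)
  rw [show k + i + (j - i) = k + j by ring]
  field_simp

/-- A generic polygon and a corrugated polygon with the same Lax operator correspond to each
other, if the parts of the operator are coprime. -/
theorem corrugation_of_sameLax (h : IsData n (Ap ∪ Am) lo hi D d)
    {v : GenericPolygon n (Ap ∪ Am) d} {w : CorrugatedPolygon n (Ap ∪ Am) D}
    (hw : w.cls ∈ copSet n Ap Am hi D) (hvw : SameLax n Ap Am v.1 w.1) :
    corrugation h v.cls = w.cls := by
  obtain ⟨L, L', ⟨a, I, ⟨ha0, -, hane, V, hV, haV⟩, -, haI, -, hL⟩,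
    ⟨b, J, ⟨hb0, -, hbne, W, hW, hbW⟩, -, -, hJb, hL'⟩, β, z, -, hβ, -, hβL⟩ := hvw
  have hV' := hV.isLift
  have hW' := hW.isLift
  have hgV := (inGeneralPosition_iff hV').1 v.2.2
  have hgW := (inGeneralPosition_iff hW').1 w.2.2.2.1
  have hmem : ∀ k, ∃ j ∈ Ap ∪ Am, b j k ≠ 0 := fun k => by
    obtain ⟨j, hj⟩ := hbne k
    exact ⟨j, by by_contra h; exact hj (hb0 j h k), hj⟩
  have hsol : IsSol (Ap ∪ Am) b W := ⟨hbW, fun j hj k => (hgW k).ne_zero (hbW k) (hmem k) j hj,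
    (consecutiveSpan_iff hW').1 w.2.2.2.2⟩
  have hcop := cop_of_mem_copSet h.toIsSpan hw hW' hsol
  let a' : ℤ → ℤ → ℝ := fun j k => β k * a j k / β (k + j)
  have hpart : ∀ S : Finset ℤ, opPart S a' = fun j k => β k * opPart S a j k / β (k + j) := by
    intro S
    ext j k
    simp only [opPart, a']
    split_ifs <;> simp
  have haL : opMul (opPart Am a) L = opPart Ap a := by
    rw [hL, ← opMul_assoc (opPart_eq_zero Am a) (opPart_eq_zero Ap a), haI, opOne_opMul]
  have haL' : opMul (opPart Am a') L' = opPart Ap a' := by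
    have : L' = fun j k => β k * L j k / β (k + j) := by ext j k; exact hβL j k
    rw [this, hpart, hpart, opMul_conj (opPart_eq_zero Am a) hβ, haL]
  -- Since J inverts the minus part of `b`, R takes that part to the minus part of `a'`; equality of
  -- the Lax operators makes it do the same for the plus parts.
  let R := opMul (opPart Am a') J
  have hRp : opMul R (opPart Ap b) = opPart Ap a' := by
    rw [opMul_assoc (opPart_eq_zero Am a') (opPart_eq_zero Ap b), ← hL', haL']
  have hRm : opMul R (opPart Am b) = opPart Am a' := by
    rw [opMul_assoc (opPart_eq_zero Am a') (opPart_eq_zero Am b), hJb, opMul_opOne]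
  have hR : ∀ j ≠ 0, ∀ k, R j k = 0 := fun j hj k => eq_zero_of_cop h.toIsSpan hcop hRp hRm hj k
  have hab : ∀ j ∈ Ap ∪ Am, ∀ k, a' j k = R 0 k * b j k := by
    have key : ∀ S : Finset ℤ, opMul R (opPart S b) = opPart S a' → ∀ j ∈ S, ∀ k,
        a' j k = R 0 k * b j k := by
      intro S hS j hj k
      have h1 := congrFun (congrFun hS j) k
      rw [opMul_eq_sum_right (opPart_eq_zero S b), Finset.sum_eq_single_of_mem j hj, opPart,
        if_pos hj, opPart, if_pos hj, sub_self, add_sub_cancel_right] at h1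
      · exact h1.symm
      · intro i _ hij
        rw [hR _ (by omega), zero_mul]
    intro j hj k
    rcases Finset.mem_union.1 hj with h1 | h1
    · exact key Ap hRp j h1 k
    · exact key Am hRm j h1 k
  have hρ : ∀ k, R 0 k ≠ 0 := by
    intro k h0
    obtain ⟨j, hj⟩ := hane k
    have hjA : j ∈ Ap ∪ Am := by by_contra h; exact hj (ha0 j h k)
    have := hab j hjA k
    rw [h0, zero_mul] at this
    exact div_ne_zero (mul_ne_zero (hβ _) hj) (hβ _) this
  have hrel' : Rel (Ap ∪ Am) a' (fun i => β i • V i) := Rel.smul haV hβ β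
  have hrel : Rel (Ap ∪ Am) b (fun i => β i • V i) := by
    intro k
    have h1 := hrel' k
    have h2 : ∑ j ∈ Ap ∪ Am, a' j k • (fun i => β i • V i) (k + j) =
        R 0 k • ∑ j ∈ Ap ∪ Am, b j k • (fun i => β i • V i) (k + j) := by
      rw [Finset.smul_sum]
      exact Finset.sum_congr rfl fun j hj => by rw [hab j hj, mul_smul]
    rw [h2] at h1
    exact (smul_eq_zero.1 h1).resolve_left (hρ k)
  obtain ⟨P, hP⟩ := hsol.exists_linearMap h.toIsSpan hrel
  have hlift := hV'.smul hβ
  have hgβ := (inGeneralPosition_iff hlift).1 v.2.2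
  refine (corrugation_eq_iff h v w).2 (isProjectionOf_of_isLift hW'
    (surjective_of_genPos h.card h.hi_mem (hgβ 0) hP) ?_)
  rwa [← funext hP]

end CopSet

end Pentagram

namespace Pentagram

/-! ### Operators with constant coefficients -/

section Constant

open Polynomial

/-- The polynomial `∑ α j X ^ (j - lo)`, the sum being over `j ∈ S`. -/
def opPoly (S : Finset ℤ) (lo : ℤ) (α : ℤ → ℝ) : ℝ[X] :=
  ∑ j ∈ S, monomial (j - lo).toNat (α j)

variable {S A Ap Am : Finset ℤ} {lo hi : ℤ} {n D d : ℕ} {α : ℤ → ℝ}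

theorem opPoly_coeff (hS : ∀ j ∈ S, lo ≤ j) {j : ℤ} (hj : j ∈ S) :
    (opPoly S lo α).coeff (j - lo).toNat = α j := by
  rw [opPoly, finsetSum_coeff, Finset.sum_eq_single_of_mem j hj]
  · exact coeff_monomial_same _ _
  · intro i hi hij
    refine coeff_monomial_of_ne _ fun h => hij ?_
    have := hS i hi
    have := hS j hj
    omega

theorem card_support_opPoly_le : (opPoly S lo α).support.card ≤ S.card := by
  have : (opPoly S lo α).support ⊆ S.image fun j => (j - lo).toNat := by
    intro m hm
    rw [mem_support_iff, opPoly, finsetSum_coeff] at hm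
    obtain ⟨j, hj, h⟩ := Finset.exists_ne_zero_of_sum_ne_zero hm
    rw [coeff_monomial] at h
    exact Finset.mem_image.2 ⟨j, hj, by by_contra hne; exact h (if_neg hne)⟩
  exact (Finset.card_le_card this).trans Finset.card_image_le

/-- Removing the leading term removes at most one sign change, and a monomial has none. -/
theorem signVariations_lt_card_support {p : ℝ[X]} (hp : p ≠ 0) :
    p.signVariations < p.support.card := by
  induction h : p.support.card using Nat.strong_induction_on generalizing p with
  | _ c ih =>
    by_cases h0 : p.eraseLead = 0
    · have : p = monomial p.natDegree p.leadingCoeff := by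
        conv_lhs => rw [← eraseLead_add_monomial_natDegree_leadingCoeff p, h0, zero_add]
      rw [this, signVariations_monomial, ← h, Finset.card_pos, support_nonempty]
      exact hp
    · have hlt := eraseLead_support_card_lt hp
      have := ih _ (by rw [← h]; exact hlt) h0 rfl
      have := signVariations_le_eraseLead_succ p
      omega

/-- A real polynomial with at most as many terms as it has positive roots vanishes. -/
theorem eq_zero_of_card_support_le {p : ℝ[X]} {R : Finset ℝ} (hpos : ∀ x ∈ R, 0 < x)
    (hR : ∀ x ∈ R, p.eval x = 0) (hcard : p.support.card ≤ R.card) : p = 0 := by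
  by_contra hp
  -- Descartes' rule: positive roots are at most as many as sign changes, hence fewer than the
  -- terms.
  have h1 := signVariations_lt_card_support hp
  have h2 := roots_countP_pos_le_signVariations p
  have h3 : R.val ≤ p.roots.filter (0 < ·) := by
    rw [Finset.val_le_iff_val_subset]
    intro x hx
    exact Multiset.mem_filter.2 ⟨(mem_roots hp).2 (hR x hx), hpos x hx⟩
  have h4 := Multiset.card_le_card h3
  rw [← Multiset.countP_eq_card_filter] at h4
  have h5 : R.val.card = R.card := rfl
  omega

theorem aeval_opPoly {K : Type*} [Field K] [Algebra ℝ K] (hS : ∀ j ∈ S, lo ≤ j) {ρ : K}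
    (hρ : ρ ≠ 0) : aeval ρ (opPoly S lo α) = ρ ^ (-lo) * ∑ j ∈ S, α j • ρ ^ j := by
  rw [opPoly, map_sum, Finset.mul_sum]
  refine Finset.sum_congr rfl fun j hj => ?_
  have := hS j hj
  rw [aeval_monomial, Algebra.smul_def, mul_left_comm, ← zpow_add₀ hρ, ← zpow_natCast]
  congr 2
  omega

/-- The shift operator on sequences. -/
def shiftEnd (E : Type*) [AddCommGroup E] [Module ℝ E] : Module.End ℝ (ℤ → E) where
  toFun V k := V (k + 1)
  map_add' _ _ := rfl
  map_smul' _ _ := rfl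

variable {E : Type*} [AddCommGroup E] [Module ℝ E]

theorem shiftEnd_pow_apply (m : ℕ) (V : ℤ → E) (k : ℤ) :
    (shiftEnd E ^ m) V k = V (k + m) := by
  induction m generalizing k with
  | zero => simp
  | succ m ih =>
    rw [pow_succ', Module.End.mul_apply]
    change (shiftEnd E ^ m) V (k + 1) = _
    rw [ih]
    congr 1
    push_cast
    ring

theorem aeval_shiftEnd_apply (p : ℝ[X]) (V : ℤ → E) (k : ℤ) :
    aeval (shiftEnd E) p V k = ∑ i ∈ Finset.range (p.natDegree + 1), p.coeff i • V (k + i) := by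
  rw [aeval_eq_sum_range, LinearMap.sum_apply, Finset.sum_apply]
  exact Finset.sum_congr rfl fun i _ => by
    rw [LinearMap.smul_apply, Pi.smul_apply, shiftEnd_pow_apply]

theorem aeval_shiftEnd_opPoly (hS : ∀ j ∈ S, lo ≤ j) (V : ℤ → E) (k : ℤ) :
    aeval (shiftEnd E) (opPoly S lo α) V k = pent S (fun j _ => α j) V (k - lo) := by
  rw [opPoly, map_sum, LinearMap.sum_apply, Finset.sum_apply]
  refine Finset.sum_congr rfl fun j hj => ?_
  have := hS j hj
  rw [aeval_monomial, Module.End.mul_apply, Module.algebraMap_end_apply, Pi.smul_apply,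
    shiftEnd_pow_apply]
  congr 2
  omega

theorem pent_union (hdisj : Disjoint Ap Am) (a : ℤ → ℤ → ℝ) (V : ℤ → E) (k : ℤ) :
    pent (Ap ∪ Am) a V k = pent Ap a V k + pent Am a V k :=
  Finset.sum_union hdisj

theorem rel_pent {B : Finset ℤ} {V : ℤ → E} (h : Rel A (fun j _ => α j) V) :
    Rel A (fun j _ => α j) (pent B (fun j _ => α j) V) := by
  intro k
  simp only [pent, Finset.smul_sum]
  rw [Finset.sum_comm]
  refine Finset.sum_eq_zero fun i _ => ?_
  have := h (k + i)
  rw [← smul_zero (α i), ← this, Finset.smul_sum]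
  refine Finset.sum_congr rfl fun j _ => ?_
  rw [smul_comm, add_right_comm]

/-- Solutions of both parts of an operator with coprime parts vanish. -/
theorem eq_sum_of_isCoprime (hdisj : Disjoint Ap Am) (hlo : ∀ j ∈ Ap ∪ Am, lo ≤ j)
    (hcop : IsCoprime (opPoly Ap lo α) (opPoly Am lo α)) :
    ∃ q : ℝ[X], ∀ {E : Type} [AddCommGroup E] [Module ℝ E] {V : ℤ → E},
      Rel (Ap ∪ Am) (fun j _ => α j) V → ∀ k, V k =
        ∑ i ∈ Finset.range (q.natDegree + 1), q.coeff i • pent Ap (fun j _ => α j) V (k + i - lo) := by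
  obtain ⟨u, v, huv⟩ := hcop
  refine ⟨u - v, fun {E} _ _ V hV k => ?_⟩
  have hp : ∀ j ∈ Ap, lo ≤ j := fun j hj => hlo j (Finset.mem_union_left _ hj)
  have hm : ∀ j ∈ Am, lo ≤ j := fun j hj => hlo j (Finset.mem_union_right _ hj)
  -- On solutions the minus part acts as the negative of the plus part, so the Bézout identity says
  -- that u - v inverts the plus part.
  have h1 : aeval (shiftEnd E) (opPoly Am lo α) V = -aeval (shiftEnd E) (opPoly Ap lo α) V := by
    ext k
    rw [Pi.neg_apply, aeval_shiftEnd_opPoly hp, aeval_shiftEnd_opPoly hm, eq_neg_iff_add_eq_zero,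
      add_comm, ← pent_union hdisj]
    exact hV (k - lo)
  have h2 := congrFun (congrArg (fun p => aeval (shiftEnd E) p V) huv) k
  simp only [map_add, map_mul, LinearMap.add_apply, Module.End.mul_apply, h1, map_neg, map_one,
    Module.End.one_apply] at h2
  rw [← sub_eq_add_neg, ← LinearMap.sub_apply, ← map_sub, aeval_shiftEnd_apply] at h2
  rw [← h2]
  exact Finset.sum_congr rfl fun i _ => by rw [aeval_shiftEnd_opPoly hp]

/-- The properties of an operator with constant coefficients that are needed for it to define
a nondegenerate polygon. -/
structure IsModelOp (n : ℕ) (Ap Am : Finset ℤ) (lo hi : ℤ) (D d : ℕ) (α : ℤ → ℝ) : Prop where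
  ne : ∀ j ∈ Ap ∪ Am, α j ≠ 0
  eq_hi : α hi = -1
  pos_roots : ∃ x : Fin (d + 1) → ℝ, Function.Injective x ∧ (∀ s, 0 < x s) ∧
    ∀ s, (opPoly (Ap ∪ Am) lo α).eval (x s) = 0
  roots : ∃ ρ : Fin (D + 1) → ℂ, (∀ s, aeval (ρ s) (opPoly (Ap ∪ Am) lo α) = 0) ∧
    Function.Injective fun s => ρ s ^ n
  coprime : IsCoprime (opPoly Ap lo α) (opPoly Am lo α)

/-- Vectors of powers of distinct positive numbers are in general position. -/
theorem genPos_zpow (hcard : A.card = d + 2) (hlo : ∀ j ∈ A, lo ≤ j) {x : Fin (d + 1) → ℝ}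
    (hx : Function.Injective x) (hpos : ∀ s, 0 < x s) {c : Fin (d + 1) → ℝ} (hc : ∀ s, c s ≠ 0)
    (k : ℤ) : GenPos A (fun (i : ℤ) (s : Fin (d + 1)) => c s * x s ^ i) k := by
  refine genPos_iff.2 fun j₀ hj₀ y hy h0 j hj => ?_
  by_cases hjj : j = j₀
  · rw [hjj, h0]
  have hlo' : ∀ j ∈ A.erase j₀, lo ≤ j := fun j hj => hlo j (Finset.mem_of_mem_erase hj)
  -- A relation without the index `j₀` is a polynomial with at most d + 1 terms that vanishes at d +
  -- 1 distinct positive numbers.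
  have hp : opPoly (A.erase j₀) lo y = 0 := by
    refine eq_zero_of_card_support_le (R := Finset.univ.image x) ?_ ?_ ?_
    · intro z hz
      obtain ⟨s, -, rfl⟩ := Finset.mem_image.1 hz
      exact hpos s
    · intro z hz
      obtain ⟨s, -, rfl⟩ := Finset.mem_image.1 hz
      have h1 := aeval_opPoly (α := y) hlo' (hpos s).ne'
      rw [coe_aeval_eq_eval] at h1
      rw [h1]
      have h2 := congrFun hy s
      rw [← Finset.add_sum_erase A _ hj₀, h0, zero_smul, zero_add, Finset.sum_apply] at h2
      have h3 : ∑ j ∈ A.erase j₀, (y j • fun s => c s * x s ^ (k + j)) s =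
          c s * x s ^ k * ∑ j ∈ A.erase j₀, y j • x s ^ j := by
        rw [Finset.mul_sum]
        refine Finset.sum_congr rfl fun j _ => ?_
        rw [Pi.smul_apply, zpow_add₀ (hpos s).ne', smul_eq_mul, smul_eq_mul]
        ring
      rw [h3] at h2
      rw [(mul_eq_zero.1 h2).resolve_left (mul_ne_zero (hc s) (zpow_ne_zero _ (hpos s).ne')),
        mul_zero]
    · refine card_support_opPoly_le.trans ?_
      rw [Finset.card_erase_of_mem hj₀, hcard, Finset.card_image_of_injective _ hx]
      simp
  have := opPoly_coeff (α := y) hlo' (Finset.mem_erase.2 ⟨hjj, hj⟩)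
  rw [← this, hp, coeff_zero]

namespace IsModelOp

variable (h : IsModelOp n Ap Am lo hi D d α) (hA : IsSpan (Ap ∪ Am) lo hi D)

include h

theorem isSol (hA : IsSpan (Ap ∪ Am) lo hi D) : IsSol (Ap ∪ Am) (fun j _ => α j)
    (fundSol (Ap ∪ Am) lo D (fun j _ => α j)) :=
  isSol_fundSol hA fun j hj _ => h.ne j hj

/-- Constant coefficients commute with the shift, so the pentagram image solves the same equation;
coprimality inverts the map. The image of the model is projectively equivalent to the model. -/
theorem exists_pent_equiv (hA : IsSpan (Ap ∪ Am) lo hi D) (hdisj : Disjoint Ap Am)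
    {W : ℤ → Vec D} (hW : IsSol (Ap ∪ Am) (fun j _ => α j) W) :
    ∃ T : Vec D ≃ₗ[ℝ] Vec D, ∀ k, pent Ap (fun j _ => α j) W k = T (W k) := by
  obtain ⟨T, hT⟩ := hW.exists_linearMap hA (rel_pent (B := Ap) hW.rel)
  obtain ⟨q, hq⟩ := eq_sum_of_isCoprime hdisj hA.lo_le h.coprime
  have hsurj : Function.Surjective T := by
    rw [← LinearMap.range_eq_top, eq_top_iff,
      ← (hW.window 0).span_eq_top_of_card_eq_finrank' (by simp), Submodule.span_le]
    rintro _ ⟨i, rfl⟩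
    change W _ ∈ LinearMap.range T
    rw [hq hW.rel]
    exact Submodule.sum_mem _ fun i _ => Submodule.smul_mem _ _ ⟨_, (hT _).symm⟩
  exact ⟨LinearEquiv.ofBijective T ⟨LinearMap.injective_iff_surjective.2 hsurj, hsurj⟩, hT⟩

/-- A solution of the finite system is extended to a global solution of the full operator. Its plus
part vanishes on a window, hence everywhere, and the Bézout identity makes the solution zero. -/
theorem cop (hA : IsSpan (Ap ∪ Am) lo hi D) (hdisj : Disjoint Ap Am) (l : ℤ) :
    Cop Ap Am hi D (fun j _ => α j) l := by
  have hh := hA.hi_eq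
  rw [cop_iff hA]
  intro r hr
  have hW := h.isSol hA
  set W := fundSol (Ap ∪ Am) lo D (fun j _ => α j)
  let k₀ : ℤ := -l - D
  -- Reversal turns the equations in s - j into difference equations in k + j.
  let r' : ℤ → ℝ := fun m => r (-m)
  have hr' : ∀ k, k₀ ≤ k → k ≤ k₀ + D → pent Ap (fun j _ => α j) r' k = 0 ∧
      pent Am (fun j _ => α j) r' k = 0 := by
    intro k h1 h2
    have := hr (-k) (by omega) (by omega)
    simp only [pent, r', smul_eq_mul, neg_add']
    exact this
  let B := basisOfLinearIndependentOfCardEqFinrank (hW.window (k₀ + lo)) (by simp)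
  let φ := B.constr ℝ (fun i : Fin (D + 1) => r' (k₀ + lo + ((i : ℕ) : ℤ)))
  let R : ℤ → ℝ := fun i => φ (W i)
  have hR : Rel (Ap ∪ Am) (fun j _ => α j) R := hW.rel.map φ
  have hR0 : ∀ t : ℕ, t < D + 1 → R (k₀ + lo + t) = r' (k₀ + lo + t) := by
    intro t ht
    have := B.constr_basis ℝ (fun i : Fin (D + 1) => r' (k₀ + lo + ((i : ℕ) : ℤ))) ⟨t, ht⟩
    rw [coe_basisOfLinearIndependentOfCardEqFinrank] at this
    exact this
  have hRr : ∀ t : ℕ, t < 2 * D + 2 → R (k₀ + lo + t) = r' (k₀ + lo + t) := by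
    intro t
    induction t using Nat.strong_induction_on with
    | _ t ih =>
      intro ht
      rcases Nat.lt_or_ge t (D + 1) with h1 | h1
      · exact hR0 t h1
      · obtain ⟨k, hk⟩ : ∃ k : ℤ, k + hi = k₀ + lo + t := ⟨k₀ + lo + t - hi, by ring⟩
        have e1 := hR k
        have e2 := hr' k (by omega) (by omega)
        have e3 : ∑ j ∈ Ap ∪ Am, α j • r' (k + j) = 0 := by
          have := pent_union hdisj (fun j _ => α j) r' k
          rw [e2.1, e2.2, add_zero] at this
          exact this
        rw [← Finset.add_sum_erase _ _ hA.hi_mem] at e1 e3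
        have e4 : ∑ j ∈ (Ap ∪ Am).erase hi, α j • R (k + j) =
            ∑ j ∈ (Ap ∪ Am).erase hi, α j • r' (k + j) := by
          refine Finset.sum_congr rfl fun j hj => ?_
          have hjA := Finset.mem_of_mem_erase hj
          have := hA.lo_le j hjA
          have h3 := hA.le_hi j hjA
          have h4 := Finset.ne_of_mem_erase hj
          obtain ⟨t', ht'⟩ : ∃ t' : ℕ, k + j = k₀ + lo + t' := ⟨(k + j - (k₀ + lo)).toNat, by omega⟩
          rw [ht', ih t' (by omega) (by omega)]
        rw [e4] at e1
        have e5 : α hi • R (k + hi) = α hi • r' (k + hi) := by linear_combination e1 - e3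
        rw [← hk]
        exact smul_right_injective ℝ (h.ne hi hA.hi_mem) e5
  have hpz : ∀ k, pent Ap (fun j _ => α j) R k = 0 := by
    refine (rel_pent (B := Ap) hR).eq_zero hA (fun _ => h.ne _ hA.lo_mem)
      (fun _ => h.ne _ hA.hi_mem) k₀ fun k h1 h2 => ?_
    rw [← (hr' k h1 h2).1]
    refine Finset.sum_congr rfl fun j hj => ?_
    have := hA.lo_le j (Finset.mem_union_left _ hj)
    have h3 := hA.le_hi j (Finset.mem_union_left _ hj)
    obtain ⟨t, ht⟩ : ∃ t : ℕ, k + j = k₀ + lo + t := ⟨(k + j - (k₀ + lo)).toNat, by omega⟩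
    rw [ht, hRr t (by omega)]
  obtain ⟨q, hq⟩ := eq_sum_of_isCoprime hdisj hA.lo_le h.coprime
  have hRz : ∀ k, R k = 0 := by
    intro k
    rw [hq hR k]
    exact Finset.sum_eq_zero fun i _ => by rw [hpz, smul_zero]
  intro m h1 h2
  obtain ⟨t, ht⟩ : ∃ t : ℕ, -m = k₀ + lo + t := ⟨(-m - (k₀ + lo)).toNat, by omega⟩
  have := hRr t (by omega)
  rw [hRz, ← ht] at this
  simpa [r'] using this.symm

/-- The geometric solutions ρ^i give complex functionals diagonalizing M with eigenvalues ρ^n. The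
discriminant is then the square of the Vandermonde determinant of these distinct numbers. -/
theorem disc_ne_zero (hA : IsSpan (Ap ∪ Am) lo hi D) {M : Module.End ℝ (Vec D)}
    (hM : ∀ i, M (fundSol (Ap ∪ Am) lo D (fun j _ => α j) i) =
      fundSol (Ap ∪ Am) lo D (fun j _ => α j) (i + n)) : disc M ≠ 0 := by
  have hW := h.isSol hA
  set W := fundSol (Ap ∪ Am) lo D (fun j _ => α j) with hWdef
  obtain ⟨ρ, hρ, hinj⟩ := h.roots
  have hρ0 : ∀ s, ρ s ≠ 0 := by
    intro s h0
    have h1 := hρ s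
    have h2 := opPoly_coeff (α := α) hA.lo_le hA.lo_mem
    rw [sub_self, Int.toNat_zero] at h2
    rw [h0, ← coeff_zero_eq_aeval_zero', h2] at h1
    exact h.ne lo hA.lo_mem ((map_eq_zero _).1 h1)
  have hrel : ∀ s, Rel (Ap ∪ Am) (fun j _ => α j) (fun i : ℤ => ρ s ^ i) := by
    intro s k
    have h1 := hρ s
    rw [aeval_opPoly hA.lo_le (hρ0 s)] at h1
    have h2 := (mul_eq_zero.1 h1).resolve_left (zpow_ne_zero _ (hρ0 s))
    rw [← mul_zero (ρ s ^ k), ← h2, Finset.mul_sum]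
    refine Finset.sum_congr rfl fun j _ => ?_
    dsimp only
    rw [zpow_add₀ (hρ0 s), mul_smul_comm]
  choose χ hχ using fun s => hW.exists_linearMap hA (hrel s)
  let C : Matrix (Fin (D + 1)) (Fin (D + 1)) ℂ := Matrix.vandermonde ρ
  have hχC : ∀ s x, χ s x = ∑ i, C s i * x i := by
    intro s x
    conv_lhs => rw [pi_eq_sum_univ' x]
    rw [map_sum]
    refine Finset.sum_congr rfl fun i _ => ?_
    have e : (Pi.single i 1 : Vec D) = W ((i : ℕ) : ℤ) := by
      ext j
      rw [hWdef, fundSol_natCast (by omega), Pi.single_apply]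
      simp only [Fin.ext_iff]
    rw [map_smul, e, ← hχ, zpow_natCast, Complex.real_smul, mul_comm]
    rfl
  have hχM : ∀ s x, χ s (M x) = ρ s ^ n * χ s x := by
    intro s x
    refine LinearMap.congr_fun (f := χ s ∘ₗ M) (g := (ρ s ^ n) • χ s)
      (linearMap_ext_of_window hW.window fun i => ?_) x
    rw [LinearMap.comp_apply, hM, ← hχ, LinearMap.smul_apply, ← hχ, smul_eq_mul, zpow_add₀ (hρ0 s),
      zpow_natCast, mul_comm]
  have hχpow : ∀ l s x, χ s ((M ^ l) x) = (ρ s ^ n) ^ l * χ s x := by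
    intro l s
    induction l with
    | zero => simp
    | succ l ih =>
      intro x
      rw [pow_succ, Module.End.mul_apply, ih, hχM, pow_succ, mul_assoc]
  have hCunit : IsUnit C.det := by
    rw [isUnit_iff_ne_zero, Matrix.det_vandermonde_ne_zero_iff]
    exact fun s s' hs => hinj (congrArg (· ^ n) hs)
  have htrace : ∀ l : ℕ, (LinearMap.trace ℝ (Vec D) (M ^ l) : ℂ) = ∑ s, (ρ s ^ n) ^ l := by
    intro l
    let N := LinearMap.toMatrix' (M ^ l)
    have hN : C * N.map (algebraMap ℝ ℂ) = Matrix.diagonal (fun s => (ρ s ^ n) ^ l) * C := by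
      ext s i
      rw [Matrix.diagonal_mul, Matrix.mul_apply]
      have h1 := hχpow l s (Pi.single i 1)
      rw [hχC, hχC] at h1
      have h2 : ∑ k, C s k * ((Pi.single i 1 : Vec D) k : ℂ) = C s i := by
        rw [Finset.sum_eq_single_of_mem i (Finset.mem_univ _), Pi.single_eq_same,
          Complex.ofReal_one, mul_one]
        intro k _ hk
        rw [Pi.single_eq_of_ne hk, Complex.ofReal_zero, mul_zero]
      rw [h2] at h1
      rw [← h1]
      refine Finset.sum_congr rfl fun k _ => ?_
      exact congrArg (fun y : ℝ => Matrix.vandermonde ρ s k * (y : ℂ))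
        (LinearMap.toMatrix'_apply (M ^ l) k i)
    have h2 : N.map (algebraMap ℝ ℂ) = C⁻¹ * Matrix.diagonal (fun s => (ρ s ^ n) ^ l) * C := by
      rw [Matrix.mul_assoc, ← hN, ← Matrix.mul_assoc, Matrix.nonsing_inv_mul _ hCunit,
        Matrix.one_mul]
    have h3 : (LinearMap.trace ℝ (Vec D) (M ^ l) : ℂ) = (N.map (algebraMap ℝ ℂ)).trace := by
      rw [LinearMap.trace_eq_matrix_trace ℝ (Pi.basisFun ℝ (Fin (D + 1))),
        LinearMap.toMatrix_eq_toMatrix']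
      exact AddMonoidHom.map_trace (algebraMap ℝ ℂ) N
    rw [h3, h2, Matrix.trace_mul_comm, ← Matrix.mul_assoc, Matrix.mul_nonsing_inv _ hCunit,
      Matrix.one_mul, Matrix.trace_diagonal]
  have hdisc : (disc M : ℂ) = (Matrix.vandermonde fun s => ρ s ^ n).det ^ 2 := by
    rw [pow_two]
    nth_rewrite 1 [← Matrix.det_transpose]
    rw [← Matrix.det_mul, disc]
    refine (RingHom.map_det Complex.ofRealHom _).trans ?_
    congr 1
    ext i j
    rw [Matrix.mul_apply]
    refine (htrace _).trans (Finset.sum_congr rfl fun s _ => ?_)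
    rw [pow_add]
    rfl
  have : (disc M : ℂ) ≠ 0 := by
    rw [hdisc]
    exact pow_ne_zero _ (Matrix.det_vandermonde_ne_zero_iff.2 hinj)
  exact_mod_cast this

/-- On V_i = (x_s^i) the plus part multiplies the s-th coordinate by a constant. It is nonzero:
otherwise both parts of the polynomial would vanish at x_s, against coprimality. -/
theorem exists_generic (hA : IsSpan (Ap ∪ Am) lo hi D) (hdisj : Disjoint Ap Am)
    (hcard : (Ap ∪ Am).card = d + 2) : ∃ x : Fin (d + 1) → ℝ, (∀ s, 0 < x s) ∧
      (∀ k, GenPos (Ap ∪ Am) (fun (i : ℤ) (s : Fin (d + 1)) => x s ^ i) k) ∧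
      Rel (Ap ∪ Am) (fun j _ => α j) (fun (i : ℤ) (s : Fin (d + 1)) => x s ^ i) ∧
      ∀ k, GenPos (Ap ∪ Am) (pent Ap (fun j _ => α j)
        (fun (i : ℤ) (s : Fin (d + 1)) => x s ^ i)) k := by
  obtain ⟨x, hx, hpos, hroot⟩ := h.pos_roots
  have hsum : ∀ (S : Finset ℤ) (k : ℤ) (s : Fin (d + 1)),
      (∑ j ∈ S, α j • (fun (i : ℤ) (s : Fin (d + 1)) => x s ^ i) (k + j)) s =
        (∑ j ∈ S, α j • x s ^ j) * x s ^ k := by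
    intro S k s
    rw [Finset.sum_apply, Finset.sum_mul]
    refine Finset.sum_congr rfl fun j _ => ?_
    simp only [Pi.smul_apply, zpow_add₀ (hpos s).ne', smul_eq_mul]
    ring
  have heval : ∀ S ⊆ Ap ∪ Am, ∀ s, (opPoly S lo α).eval (x s) =
      x s ^ (-lo) * ∑ j ∈ S, α j • x s ^ j := by
    intro S hS s
    have h1 := aeval_opPoly (α := α) (fun j hj => hA.lo_le j (hS hj)) (hpos s).ne'
    rwa [coe_aeval_eq_eval] at h1
  have hz : ∀ s, ∑ j ∈ Ap ∪ Am, α j • x s ^ j = 0 := by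
    intro s
    have h1 := heval _ subset_rfl s
    rw [hroot] at h1
    exact (mul_eq_zero.1 h1.symm).resolve_left (zpow_ne_zero _ (hpos s).ne')
  have hc : ∀ s, ∑ j ∈ Ap, α j • x s ^ j ≠ 0 := by
    intro s h0
    have h1 : ∑ j ∈ Am, α j • x s ^ j = 0 := by
      have := hz s
      rwa [Finset.sum_union hdisj, h0, zero_add] at this
    obtain ⟨u, v, huv⟩ := h.coprime
    have := congrArg (eval (x s)) huv
    rw [eval_add, eval_mul, eval_mul, heval _ Finset.subset_union_left,
      heval _ Finset.subset_union_right, h0, h1] at this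
    simp at this
  refine ⟨x, hpos, fun k => ?_, fun k => ?_, fun k => ?_⟩
  · simpa only [one_mul] using
      genPos_zpow hcard hA.lo_le hx hpos (c := fun _ => 1) (fun _ => one_ne_zero) k
  · ext s
    rw [hsum, hz, zero_mul]
    rfl
  · have : pent Ap (fun j _ => α j) (fun (i : ℤ) (s : Fin (d + 1)) => x s ^ i) =
        fun (i : ℤ) (s : Fin (d + 1)) => (∑ j ∈ Ap, α j • x s ^ j) * x s ^ i := by
      ext i s
      exact hsum Ap i s
    rw [this]
    exact genPos_zpow hcard hA.lo_le hx hpos hc k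

end IsModelOp

end Constant

end Pentagram

namespace Pentagram

/-! ### Existence of a model operator -/

section ModelOp

open Polynomial

variable {S A Ap Am : Finset ℤ} {lo hi : ℤ} {n D d : ℕ} {α : ℤ → ℝ}

theorem opPoly_mul_left (c : ℝ) : opPoly S lo (fun j => c * α j) = C c * opPoly S lo α := by
  rw [opPoly, opPoly, Finset.mul_sum]
  exact Finset.sum_congr rfl fun j _ => (C_mul_monomial).symm

theorem opPoly_update_of_mem (h : lo ∈ S) (s : ℝ) :
    opPoly S lo (fun j => α j + if j = lo then s else 0) = opPoly S lo α + C s := by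
  simp only [opPoly, map_add, Finset.sum_add_distrib]
  congr 1
  rw [Finset.sum_eq_single_of_mem lo h]
  · rw [if_pos rfl, sub_self, Int.toNat_zero, monomial_zero_left]
  · intro j _ hj
    rw [if_neg hj, map_zero]

theorem opPoly_update_of_notMem (h : lo ∉ S) (s : ℝ) :
    opPoly S lo (fun j => α j + if j = lo then s else 0) = opPoly S lo α :=
  Finset.sum_congr rfl fun j hj => by
    have : j ≠ lo := fun h' => h (h' ▸ hj)
    simp [this]

theorem opPoly_union (hdisj : Disjoint Ap Am) :
    opPoly (Ap ∪ Am) lo α = opPoly Ap lo α + opPoly Am lo α :=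
  Finset.sum_union hdisj

/-- Interpolation by polynomials with prescribed exponents at positive points. -/
theorem exists_opPoly_eval (hcard : A.card = d + 2) (hlo : ∀ j ∈ A, lo ≤ j)
    {y : Fin (d + 2) → ℝ} (hy : Function.Injective y) (hpos : ∀ i, 0 < y i)
    (z : Fin (d + 2) → ℝ) : ∃ α : ℤ → ℝ, ∀ i, (opPoly A lo α).eval (y i) = z i := by
  let ext : ({j // j ∈ A} → ℝ) → ℤ → ℝ := fun x j => if h : j ∈ A then x ⟨j, h⟩ else 0
  let Φ : ({j // j ∈ A} → ℝ) →ₗ[ℝ] (Fin (d + 2) → ℝ) :=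
    { toFun := fun x i => ∑ j, x j * y i ^ (j.1 - lo).toNat
      map_add' := fun x x' => by
        ext i; simp only [Pi.add_apply, add_mul, Finset.sum_add_distrib]
      map_smul' := fun c x => by
        ext i
        simp only [Pi.smul_apply, smul_eq_mul, Finset.mul_sum, mul_assoc, RingHom.id_apply] }
  have hΦ : ∀ x i, (opPoly A lo (ext x)).eval (y i) = Φ x i := by
    intro x i
    rw [opPoly, eval_finsetSum]
    change _ = ∑ j, x j * y i ^ (j.1 - lo).toNat
    rw [← Finset.sum_coe_sort A]
    refine Finset.sum_congr rfl fun j _ => ?_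
    rw [eval_monomial]
    simp only [ext, j.2, dif_pos]
  -- A polynomial with d + 2 terms vanishing at d + 2 positive points is zero by Descartes' rule.
  have hinj : Function.Injective Φ := by
    rw [injective_iff_map_eq_zero]
    intro x hx
    have hp : opPoly A lo (ext x) = 0 := by
      refine eq_zero_of_card_support_le (R := Finset.univ.image y) ?_ ?_ ?_
      · intro z hz
        obtain ⟨s, -, rfl⟩ := Finset.mem_image.1 hz
        exact hpos s
      · intro z hz
        obtain ⟨s, -, rfl⟩ := Finset.mem_image.1 hz
        rw [hΦ, hx]
        rfl
      · refine card_support_opPoly_le.trans ?_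
        rw [hcard, Finset.card_image_of_injective _ hy]
        simp
    ext j
    have := opPoly_coeff (α := ext x) hlo j.2
    rw [hp, coeff_zero] at this
    simp only [ext, j.2, dif_pos] at this
    exact this.symm
  have hsurj : Function.Surjective Φ :=
    (LinearMap.injective_iff_surjective_of_finrank_eq_finrank (by simp [hcard])).1 hinj
  obtain ⟨x, hx⟩ := hsurj z
  exact ⟨ext x, fun i => by rw [hΦ, hx]⟩

/-- A polynomial with alternating signs at the points `1, 2, …, d + 2` has `d + 1` positive roots. -/
theorem exists_roots_of_alternating {p : ℝ[X]} {s : ℝ} (hs : |s| < 1)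
    (hp : ∀ i : Fin (d + 2), p.eval ((i : ℕ) + 1 : ℝ) = (-1) ^ (i : ℕ) + s) :
    ∃ x : Fin (d + 1) → ℝ, Function.Injective x ∧ (∀ i, 0 < x i) ∧ ∀ i, p.eval (x i) = 0 := by
  have hs' := abs_lt.1 hs
  have key : ∀ i : Fin (d + 1), ∃ x : ℝ, x ∈ Set.Ioo ((i : ℕ) + 1 : ℝ) ((i : ℕ) + 2) ∧
      p.eval x = 0 := by
    intro i
    have h1 := hp i.castSucc
    have h2 := hp i.succ
    simp only [Fin.val_castSucc, Fin.val_succ, Nat.cast_add, Nat.cast_one, pow_succ] at h1 h2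
    rw [add_assoc, one_add_one_eq_two] at h2
    have hc : ContinuousOn (fun x => p.eval x) (Set.Icc ((i : ℕ) + 1 : ℝ) ((i : ℕ) + 2)) :=
      p.continuous.continuousOn
    have hle : ((i : ℕ) + 1 : ℝ) ≤ (i : ℕ) + 2 := by linarith
    rcases neg_one_pow_eq_or ℝ (i : ℕ) with h | h
    · rw [h] at h1 h2
      exact intermediate_value_Ioo' hle hc (show (0 : ℝ) ∈ Set.Ioo _ _ from
        ⟨by rw [h2]; linarith, by rw [h1]; linarith⟩)
    · rw [h] at h1 h2
      exact intermediate_value_Ioo hle hc (show (0 : ℝ) ∈ Set.Ioo _ _ from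
        ⟨by rw [h1]; linarith, by rw [h2]; linarith⟩)
  choose x hx hpx using key
  refine ⟨x, fun i i' h => ?_, fun i => ?_, hpx⟩
  · have h1 := hx i
    have h2 := hx i'
    rw [h] at h1
    have h3 : ((i : ℕ) : ℝ) < (i' : ℕ) + 1 := by linarith [h1.1, h2.2]
    have h4 : ((i' : ℕ) : ℝ) < (i : ℕ) + 1 := by linarith [h2.1, h1.2]
    have h5 : (i : ℕ) < (i' : ℕ) + 1 := by exact_mod_cast h3
    have h6 : (i' : ℕ) < (i : ℕ) + 1 := by exact_mod_cast h4
    ext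
    omega
  · have := (hx i).1
    have : (0 : ℝ) ≤ (i : ℕ) := Nat.cast_nonneg _
    linarith [(hx i).1]

/-- A polynomial with `d + 2` terms and `d + 1` positive roots has no vanishing coefficient. -/
theorem coeff_ne_zero_of_roots (hcard : A.card = d + 2) (h0 : opPoly A lo α ≠ 0)
    (h : ∃ x : Fin (d + 1) → ℝ, Function.Injective x ∧ (∀ i, 0 < x i) ∧
      ∀ i, (opPoly A lo α).eval (x i) = 0) : ∀ j ∈ A, α j ≠ 0 := by
  obtain ⟨x, hx, hpos, hroot⟩ := h
  intro j hj hj0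
  apply h0
  refine eq_zero_of_card_support_le (R := Finset.univ.image x) ?_ ?_ ?_
  · intro z hz
    obtain ⟨s, -, rfl⟩ := Finset.mem_image.1 hz
    exact hpos s
  · intro z hz
    obtain ⟨s, -, rfl⟩ := Finset.mem_image.1 hz
    exact hroot s
  · have : opPoly A lo α = opPoly (A.erase j) lo α := by
      rw [opPoly, ← Finset.add_sum_erase A _ hj, hj0, map_zero, zero_add]
      rfl
    rw [this]
    refine card_support_opPoly_le.trans ?_
    rw [Finset.card_erase_of_mem hj, hcard, Finset.card_image_of_injective _ hx]
    simp

theorem natDegree_opPoly (hA : IsSpan A lo hi D) (h : α hi ≠ 0) :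
    (opPoly A lo α).natDegree = D + 1 := by
  have hh := hA.hi_eq
  refine le_antisymm ?_ ?_
  · refine natDegree_sum_le_of_forall_le _ _ fun j hj => (natDegree_monomial_le _).trans ?_
    have := hA.le_hi j hj
    omega
  · refine le_natDegree_of_ne_zero ?_
    have := opPoly_coeff (α := α) hA.lo_le hA.hi_mem
    rw [show (hi - lo).toNat = D + 1 by omega] at this
    rwa [this]

/-- A root of unity that fixes all powers of the exponents is trivial. -/
theorem eq_one_of_pow (hA : IsSpan A lo hi D)
    (hcop : ∀ c : ℕ, c ∣ n → (∀ i ∈ A, ∀ j ∈ A, (c : ℤ) ∣ i - j) → c = 1) {ζ : ℂ} (hn : ζ ^ n = 1)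
    (h : ∀ j ∈ A, ζ ^ (j - lo).toNat = 1) : ζ = 1 := by
  rw [← orderOf_eq_one_iff]
  have hd : ∀ j ∈ A, (orderOf ζ : ℤ) ∣ j - lo := by
    intro j hj
    have := hA.lo_le j hj
    have h1 : (orderOf ζ : ℤ) ∣ ((j - lo).toNat : ℤ) :=
      Int.natCast_dvd_natCast.2 (orderOf_dvd_of_pow_eq_one (h j hj))
    rwa [Int.toNat_of_nonneg (by omega)] at h1
  refine hcop _ (orderOf_dvd_of_pow_eq_one hn) fun i hi j hj => ?_
  have := dvd_sub (hd i hi) (hd j hj)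
  rwa [sub_sub_sub_cancel_right] at this

/-- Start from p₀ with prescribed exponents and values (-1)^i at 1, …, d + 2. For every |s| < 1 the
polynomial p₀ + s still alternates, so it has d + 1 positive roots and no zero coefficient. All
other requirements exclude finitely many s. -/
theorem exists_isModelOp (h : IsData n (Ap ∪ Am) lo hi D d) (hdisj : Disjoint Ap Am)
    (hp : Ap.Nonempty) (hm : Am.Nonempty)
    (hcop : ∀ c : ℕ, c ∣ n → (∀ i ∈ Ap ∪ Am, ∀ j ∈ Ap ∪ Am, (c : ℤ) ∣ i - j) → c = 1) :
    ∃ α, IsModelOp n Ap Am lo hi D d α := by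
  have hA := h.toIsSpan
  obtain ⟨α₀, hα₀⟩ := exists_opPoly_eval h.card hA.lo_le
    (y := fun i : Fin (d + 2) => ((i : ℕ) + 1 : ℝ)) (fun i i' hii => by
      ext; simpa using hii) (fun i => by positivity) (fun i => (-1) ^ (i : ℕ))
  set A := Ap ∪ Am with hAdef
  let p₀ := opPoly A lo α₀
  let α' : ℝ → ℤ → ℝ := fun s j => α₀ j + if j = lo then s else 0
  have hα' : ∀ s, opPoly A lo (α' s) = p₀ + C s := fun s => opPoly_update_of_mem hA.lo_mem s
  have hroots : ∀ s : ℝ, |s| < 1 → ∃ x : Fin (d + 1) → ℝ, Function.Injective x ∧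
      (∀ i, 0 < x i) ∧ ∀ i, (opPoly A lo (α' s)).eval (x i) = 0 := by
    intro s hs
    refine exists_roots_of_alternating hs fun i => ?_
    rw [hα', eval_add, eval_C, hα₀]
  have hne : ∀ s : ℝ, |s| < 1 → ∀ j ∈ A, α' s j ≠ 0 := by
    intro s hs
    refine coeff_ne_zero_of_roots h.card (fun h0 => ?_) (hroots s hs)
    have h1 := hα₀ 0
    have h2 := congrArg (eval ((((0 : Fin (d + 2)) : ℕ) : ℝ) + 1)) (hα' s)
    rw [h0, eval_add, eval_C, h1, eval_zero] at h2
    have := (abs_lt.1 hs).1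
    simp at h2
    linarith
  have hne₀ : ∀ j ∈ A, α₀ j ≠ 0 := fun j hj => by
    have := hne 0 (by simp) j hj
    simpa [α'] using this
  -- Adding s affects only the coefficient at `lo`, so the part not containing `lo` is independent
  -- of s.
  obtain ⟨B, hBne, hloB, hBA, hB⟩ : ∃ B : Finset ℤ, B.Nonempty ∧ lo ∉ B ∧ B ⊆ A ∧
      (B = Ap ∨ B = Am) := by
    by_cases h1 : lo ∈ Ap
    · exact ⟨Am, hm, Finset.disjoint_left.1 hdisj h1, Finset.subset_union_right, Or.inr rfl⟩
    · exact ⟨Ap, hp, h1, Finset.subset_union_left, Or.inl rfl⟩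
  let P₀ : ℂ[X] := p₀.map (algebraMap ℝ ℂ)
  let Q : ℂ → ℂ[X] := fun ζ => P₀.comp (C ζ * X) - P₀
  -- Points that must not become roots: the first set excludes multiple roots, the second two roots
  -- whose ratio is an n-th root of unity, the third a common root of the two parts. The term ζ = 1
  -- contributes nothing, as the zero polynomial has an empty root multiset.
  let Z : Finset ℂ := P₀.derivative.roots.toFinset ∪
    ((nthRootsFinset n (1 : ℂ)).biUnion fun ζ => (Q ζ).roots.toFinset) ∪
    ((opPoly B lo α₀).map (algebraMap ℝ ℂ)).roots.toFinset
  obtain ⟨s, hs, hsZ⟩ : ∃ s : ℝ, |s| < 1 ∧ ∀ ρ ∈ Z, P₀.eval ρ + s ≠ 0 := by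
    have hinf : (Set.Ioo (-1 : ℝ) 1).Infinite := Set.Ioo_infinite (by norm_num)
    obtain ⟨s, hs, hsZ⟩ := hinf.exists_notMem_finset (Z.image fun ρ => (-(P₀.eval ρ)).re)
    refine ⟨s, abs_lt.2 hs, fun ρ hρ h0 => hsZ (Finset.mem_image.2 ⟨ρ, hρ, ?_⟩)⟩
    rw [neg_eq_of_add_eq_zero_right h0, Complex.ofReal_re]
  have hnotZ : ∀ ρ : ℂ, aeval ρ (opPoly A lo (α' s)) = 0 → ρ ∉ Z := by
    intro ρ hρ hZ
    apply hsZ ρ hZ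
    rw [hα', map_add, aeval_C] at hρ
    rw [eval_map_algebraMap]
    exact hρ
  have hPs : ∀ ρ : ℂ, aeval ρ (opPoly A lo (α' s)) = 0 → P₀.eval ρ = -s := by
    intro ρ hρ
    rw [hα', map_add, aeval_C] at hρ
    rw [eval_map_algebraMap]
    exact eq_neg_of_add_eq_zero_left hρ
  have hP₀coeff : ∀ j ∈ A, P₀.coeff (j - lo).toNat = α₀ j := fun j hj => by
    rw [coeff_map, opPoly_coeff hA.lo_le hj]
    rfl
  have hP₀deg : P₀.natDegree = D + 1 := by
    rw [natDegree_map, natDegree_opPoly hA (hne₀ hi hA.hi_mem)]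
  have hroot0 : ∀ ρ : ℂ, aeval ρ (opPoly A lo (α' s)) = 0 → ρ ≠ 0 := by
    rintro ρ hρ rfl
    have h2 := opPoly_coeff (α := α' s) hA.lo_le hA.lo_mem
    rw [sub_self, Int.toNat_zero] at h2
    rw [← coeff_zero_eq_aeval_zero', h2] at hρ
    exact hne s hs lo hA.lo_mem ((map_eq_zero _).1 hρ)
  have hpow : ∀ ρ ρ' : ℂ, aeval ρ (opPoly A lo (α' s)) = 0 → aeval ρ' (opPoly A lo (α' s)) = 0 →
      ρ ^ n = ρ' ^ n → ρ = ρ' := by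
    intro ρ ρ' hρ hρ' hnn
    have h0 := hroot0 ρ' hρ'
    set ζ := ρ / ρ'
    have hζ : ζ * ρ' = ρ := div_mul_cancel₀ _ h0
    have hζn : ζ ^ n = 1 := by
      rw [div_pow, hnn, div_self (pow_ne_zero _ h0)]
    by_contra hne'
    have hζ1 : ζ ≠ 1 := fun h1 => hne' (by rw [← hζ, h1, one_mul])
    -- If Q ζ vanished, ζ^(j - lo) = 1 for all j ∈ A; with ζ^n = 1 the coprimality of n and the
    -- differences would give ζ = 1.
    have hQ : Q ζ ≠ 0 := by
      intro hQ
      apply hζ1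
      refine eq_one_of_pow hA hcop hζn fun j hj => ?_
      have h3 := congrArg (fun q : ℂ[X] => q.coeff (j - lo).toNat) hQ
      simp only [Q, coeff_sub, coeff_zero, comp_C_mul_X_coeff, hP₀coeff j hj] at h3
      have h4 : (α₀ j : ℂ) ≠ 0 := by exact_mod_cast hne₀ j hj
      exact mul_left_cancel₀ h4 (by rw [mul_one]; exact sub_eq_zero.1 h3)
    apply hnotZ ρ' hρ'
    refine Finset.mem_union_left _ (Finset.mem_union_right _ (Finset.mem_biUnion.2
      ⟨ζ, (mem_nthRootsFinset h.n_pos _).2 hζn, Multiset.mem_toFinset.2 ((mem_roots hQ).2 ?_)⟩))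
    change (Q ζ).eval ρ' = 0
    simp only [Q, eval_sub, eval_comp, eval_mul, eval_C, eval_X, hζ, hPs ρ hρ, hPs ρ' hρ', sub_self]
  have hsep : ∃ ρ : Fin (D + 1) → ℂ, (∀ i, aeval (ρ i) (opPoly A lo (α' s)) = 0) ∧
      Function.Injective fun i => ρ i ^ n := by
    let Ps : ℂ[X] := (opPoly A lo (α' s)).map (algebraMap ℝ ℂ)
    have hdeg : Ps.natDegree = D + 1 := by
      rw [natDegree_map, natDegree_opPoly hA (hne s hs hi hA.hi_mem)]
    have hPs0 : Ps ≠ 0 := by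
      intro h0
      rw [h0, natDegree_zero] at hdeg
      omega
    have hderiv : Ps.derivative = P₀.derivative := by
      simp only [Ps, hα', Polynomial.map_add, map_C, derivative_add, derivative_C, add_zero]
      rfl
    have hd0 : P₀.derivative ≠ 0 := by
      intro h0
      have := Polynomial.derivative_eq_zero.1 h0
      omega
    have hnodup : Ps.roots.Nodup := by
      rw [nodup_roots_iff_of_splits hPs0 (IsAlgClosed.splits _)]
      rw [Polynomial.Separable, isCoprime_iff_aeval_ne_zero_of_isAlgClosed ℂ ℂ]
      intro ρ
      by_contra hcon
      push Not at hcon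
      obtain ⟨h1, h2⟩ := hcon
      rw [coe_aeval_eq_eval] at h1 h2
      rw [eval_map_algebraMap] at h1
      apply hnotZ ρ h1
      refine Finset.mem_union_left _ (Finset.mem_union_left _
        (Multiset.mem_toFinset.2 ((mem_roots hd0).2 ?_)))
      rw [← hderiv]
      exact h2
    have hcard : Ps.roots.toFinset.card = D + 1 := by
      rw [Multiset.toFinset_card_of_nodup hnodup,
        ← (IsAlgClosed.splits Ps).natDegree_eq_card_roots, hdeg]
    let e := Ps.roots.toFinset.equivFinOfCardEq hcard
    have hroot : ∀ i, aeval ((e.symm i : ℂ)) (opPoly A lo (α' s)) = 0 := by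
      intro i
      have := (mem_roots hPs0).1 (Multiset.mem_toFinset.1 (e.symm i).2)
      rwa [IsRoot, eval_map_algebraMap] at this
    refine ⟨fun i => e.symm i, hroot, fun i i' hii => ?_⟩
    exact e.symm.injective (Subtype.ext (hpow _ _ (hroot i) (hroot i') hii))
  have hcoprime : IsCoprime (opPoly Ap lo (α' s)) (opPoly Am lo (α' s)) := by
    rw [isCoprime_iff_aeval_ne_zero_of_isAlgClosed ℝ ℂ]
    intro ρ
    by_contra hcon
    push Not at hcon
    obtain ⟨h1, h2⟩ := hcon
    have h3 : aeval ρ (opPoly A lo (α' s)) = 0 := by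
      rw [hAdef, opPoly_union hdisj, map_add, h1, h2, add_zero]
    have h4 : aeval ρ (opPoly B lo α₀) = 0 := by
      rw [← opPoly_update_of_notMem hloB s]
      rcases hB with rfl | rfl
      · exact h1
      · exact h2
    obtain ⟨j, hj⟩ := hBne
    have hB0 : (opPoly B lo α₀).map (algebraMap ℝ ℂ) ≠ 0 := by
      intro h0
      have h5 := opPoly_coeff (α := α₀) (fun j hj => hA.lo_le j (hBA hj)) hj
      have h6 := (Polynomial.map_eq_zero _).1 h0
      rw [h6, coeff_zero] at h5
      exact hne₀ j (hBA hj) h5.symm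
    apply hnotZ ρ h3
    refine Finset.mem_union_right _ (Multiset.mem_toFinset.2 ((mem_roots hB0).2 ?_))
    rwa [IsRoot, eval_map_algebraMap]
  have hhi := hne s hs hi hA.hi_mem
  -- This makes the coefficient at `hi` equal to -1, matching the normalization of `nrow`.
  let c : ℝ := -(α' s hi)⁻¹
  have hc : c ≠ 0 := neg_ne_zero.2 (inv_ne_zero hhi)
  refine ⟨fun j => c * α' s j, fun j hj => mul_ne_zero hc (hne s hs j hj), ?_, ?_, ?_, ?_⟩
  · simp only [c]
    rw [neg_mul, inv_mul_cancel₀ hhi]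
  · obtain ⟨x, hx, hpos, hroot⟩ := hroots s hs
    exact ⟨x, hx, hpos, fun i => by rw [opPoly_mul_left, eval_mul, hroot, mul_zero]⟩
  · obtain ⟨ρ, hρ, hinj⟩ := hsep
    exact ⟨ρ, fun i => by rw [opPoly_mul_left, map_mul, hρ, mul_zero], hinj⟩
  · rw [opPoly_mul_left, opPoly_mul_left]
    have hu : IsUnit (C c) := isUnit_C.2 (isUnit_iff_ne_zero.2 hc)
    exact (isCoprime_mul_unit_left hu _ _).2 hcoprime

end ModelOp

end Pentagram

namespace Pentagram

/-! ### Generic operators -/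

section Good

variable {n : ℕ} {Ap Am : Finset ℤ} {lo hi : ℤ} {D d : ℕ} {α : ℤ → ℝ} {a b : ℤ → ℤ → ℝ}

theorem fundSol_congr {A : Finset ℤ} (h : ∀ j ∈ A, ∀ k, a j k = b j k) :
    fundSol A lo D a = fundSol A lo D b := by
  have : ∀ j k, (if j ∈ A then a j k else 0) = if j ∈ A then b j k else 0 := by
    intro j k
    split_ifs with hj
    · exact h j hj k
    · rfl
  ext1 i
  simp only [fundSol, this]

theorem pent_congr {E : Type*} [AddCommGroup E] [Module ℝ E] (h : ∀ j ∈ Ap, ∀ k, a j k = b j k)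
    (V : ℤ → E) : pent Ap a V = pent Ap b V :=
  funext fun k => Finset.sum_congr rfl fun j hj => by rw [h j hj k]

/-- A periodic operator whose fundamental solution represents a corrugated polygon with a
monodromy of nonzero discriminant, coprime parts, and a nondegenerate pentagram image. -/
structure IsGood (n : ℕ) (Ap Am : Finset ℤ) (lo hi : ℤ) (D : ℕ) (a : ℤ → ℤ → ℝ) : Prop where
  ne : ∀ j ∈ Ap ∪ Am, ∀ k, a j k ≠ 0
  periodic : ∀ j ∈ Ap ∪ Am, ∀ k, a j (k + n) = a j k
  cop : ∀ l, Cop Ap Am hi D a l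
  disc_ne : ∀ M : Vec D ≃ₗ[ℝ] Vec D,
    (∀ i, fundSol (Ap ∪ Am) lo D a (i + n) = M (fundSol (Ap ∪ Am) lo D a i)) →
    disc M.toLinearMap ≠ 0
  genPos_pent : ∀ k, GenPos (Ap ∪ Am) (pent Ap a (fundSol (Ap ∪ Am) lo D a)) k
  window_pent : ∀ k, LinearIndependent ℝ
    (fun i : Fin (D + 1) => pent Ap a (fundSol (Ap ∪ Am) lo D a) (k + ((i : ℕ) : ℤ)))

theorem pent_shift {E : Type*} [AddCommGroup E] [Module ℝ E] {V : ℤ → E} {M : E →ₗ[ℝ] E}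
    (ha : ∀ j ∈ Ap, ∀ k, a j (k + n) = a j k) (hM : ∀ i, V (i + n) = M (V i)) (k : ℤ) :
    pent Ap a V (k + n) = M (pent Ap a V k) := by
  simp only [pent, map_sum, map_smul]
  exact Finset.sum_congr rfl fun j hj => by rw [ha j hj, ← hM, add_right_comm]

theorem genPos_shift_of_eq {r : ℕ} {A : Finset ℤ} {V : ℤ → Vec r} {M : Vec r ≃ₗ[ℝ] Vec r}
    (hM : ∀ i, V (i + n) = M (V i)) (k : ℤ) : GenPos A V (k + n) ↔ GenPos A V k :=
  genPos_shift (g := M.toLinearMap) M.injective (c := fun _ => 1) (fun _ => one_ne_zero)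
    (fun i => by rw [one_smul, hM]; rfl) k

theorem window_shift {W : ℤ → Vec D} {M : Vec D ≃ₗ[ℝ] Vec D} (hM : ∀ i, W (i + n) = M (W i))
    (k : ℤ) : LinearIndependent ℝ (fun i : Fin (D + 1) => W (k + n + ((i : ℕ) : ℤ))) ↔
      LinearIndependent ℝ (fun i : Fin (D + 1) => W (k + ((i : ℕ) : ℤ))) := by
  simp only [add_right_comm k (n : ℤ), hM]
  exact M.toLinearMap.linearIndependent_iff M.ker

/-- The matrix of the monodromy of the fundamental solution. -/
def monoMat (n : ℕ) (A : Finset ℤ) (lo : ℤ) (D : ℕ) (a : ℤ → ℤ → ℝ) :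
    Matrix (Fin (D + 1)) (Fin (D + 1)) ℝ :=
  Matrix.of fun s i => fundSol A lo D a (((i : ℕ) : ℤ) + n) s

/-- The window 0, …, D of the fundamental solution is the standard basis, so the monodromy matrix
consists of its later values and the discriminant is polynomial in them. -/
theorem disc_eq_monoMat {A : Finset ℤ} {M : Module.End ℝ (Vec D)}
    (hM : ∀ i, M (fundSol A lo D a i) = fundSol A lo D a (i + n)) :
    disc M = (Matrix.of fun i j : Fin (D + 1) =>
      (monoMat n A lo D a ^ ((i : ℕ) + j)).trace).det := by
  have h : M = Matrix.toLin' (monoMat n A lo D a) := by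
    refine (Pi.basisFun ℝ (Fin (D + 1))).ext fun i => ?_
    have hi : fundSol A lo D a ((i : ℕ) : ℤ) = Pi.basisFun ℝ (Fin (D + 1)) i := by
      ext s
      rw [fundSol_natCast (Nat.lt_succ_iff.1 i.2), Pi.basisFun_apply, Pi.single_apply]
      simp only [Fin.ext_iff]
    rw [← hi, hM, hi, Pi.basisFun_apply, Matrix.toLin'_apply, Matrix.mulVec_single_one]
    rfl
  rw [disc, h]
  simp only [← Matrix.toLin'_pow, Matrix.trace_toLin'_eq]

theorem FunClass.matrixPow {T m : Type*} [Fintype m] [DecidableEq m] {C : (T → ℝ) → Prop} {t₀ : T}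
    {𝓕 : Filter T} (h : FunClass C t₀ 𝓕) {B : T → Matrix m m ℝ} (hB : ∀ i j, C fun t => B t i j)
    (p : ℕ) (i j : m) : C fun t => (B t ^ p) i j := by
  induction p generalizing i j with
  | zero => simpa only [pow_zero] using h.const _
  | succ p ih =>
    simp only [pow_succ]
    exact h.matrixMul ih hB i j

/-- Operators near a model operator, along a family, are generic. -/
theorem IsModelOp.eventually_isGood (h : IsModelOp n Ap Am lo hi D d α)
    (hd : IsData n (Ap ∪ Am) lo hi D d) (hdisj : Disjoint Ap Am) {T : Type*} {C : (T → ℝ) → Prop}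
    {t₀ : T} {𝓕 : Filter T} (hC : FunClass C t₀ 𝓕) {a : T → ℤ → ℤ → ℝ}
    (ha : ∀ j ∈ Ap ∪ Am, ∀ k, C fun t => a t j k) (h0 : ∀ j ∈ Ap ∪ Am, ∀ k, a t₀ j k = α j)
    (hper : ∀ᶠ t in 𝓕, ∀ j ∈ Ap ∪ Am, ∀ k, a t j (k + n) = a t j k) :
    ∀ᶠ t in 𝓕, IsGood n Ap Am lo hi D (a t) := by
  have hA := hd.toIsSpan
  have hne0 : ∀ j ∈ Ap ∪ Am, ∀ k, a t₀ j k ≠ 0 := fun j hj k => by rw [h0 j hj]; exact h.ne j hj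
  have hsub : ∀ j ∈ Ap, ∀ k, a t₀ j k = α j := fun j hj => h0 j (Finset.mem_union_left _ hj)
  have hW : ∀ i s, C fun t => fundSol (Ap ∪ Am) lo D (a t) i s := hC.fundSol hA ha
    (hne0 _ hA.lo_mem) (hne0 _ hA.hi_mem)
  have hW0 : fundSol (Ap ∪ Am) lo D (a t₀) = fundSol (Ap ∪ Am) lo D (fun j _ => α j) :=
    fundSol_congr h0
  have hP : ∀ k s, C fun t => pent Ap (a t) (fundSol (Ap ∪ Am) lo D (a t)) k s :=
    hC.pent (fun j hj => ha j (Finset.mem_union_left _ hj)) hW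
  have hsol := h.isSol hA
  obtain ⟨Θ, hΘ⟩ := h.exists_pent_equiv hA hdisj hsol
  have hP0 : pent Ap (a t₀) (fundSol (Ap ∪ Am) lo D (a t₀)) =
      fun k => Θ (fundSol (Ap ∪ Am) lo D (fun j _ => α j) k) := by
    rw [hW0, pent_congr hsub]
    exact funext hΘ
  have hsolP := hsol.map Θ
  obtain ⟨M₀, hM₀⟩ := hsol.exists_monodromy hA (n := n) fun _ _ _ => rfl
  -- By periodicity each condition needs checking only over one period, which leaves finitely many
  -- conditions.
  have ev1 : ∀ᶠ t in 𝓕, ∀ j ∈ Ap ∪ Am, ∀ k ∈ Finset.Ico (0 : ℤ) n, a t j k ≠ 0 := by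
    simp only [Finset.eventually_all]
    exact fun j hj k _ => hC.ne (ha j hj k) (hne0 j hj k)
  have ev2 : ∀ᶠ t in 𝓕, ∀ l ∈ Finset.Ico (0 : ℤ) n, Cop Ap Am hi D (a t) l := by
    simp only [Finset.eventually_all]
    refine fun l _ => hC.eventually_cop ha ?_
    exact (h.cop hA hdisj l).gauge hA (t := fun _ => 1) (β := fun _ => 1) (fun _ => one_ne_zero)
      fun j hj k => by rw [h0 j hj, mul_one, one_mul]
  have ev3 : ∀ᶠ t in 𝓕, ∀ k ∈ Finset.Ico (0 : ℤ) n,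
      GenPos (Ap ∪ Am) (pent Ap (a t) (fundSol (Ap ∪ Am) lo D (a t))) k := by
    simp only [Finset.eventually_all]
    refine fun k _ => hC.eventually_genPos hP ?_
    rw [hP0]
    exact hsolP.genPos hA k
  have ev4 : ∀ᶠ t in 𝓕, ∀ k ∈ Finset.Ico (0 : ℤ) n, LinearIndependent ℝ
      (fun i : Fin (D + 1) => pent Ap (a t) (fundSol (Ap ∪ Am) lo D (a t)) (k + ((i : ℕ) : ℤ))) := by
    simp only [Finset.eventually_all]
    refine fun k _ => hC.eventually_window hP ?_
    rw [hP0]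
    exact hsolP.window k
  have ev5 : ∀ᶠ t in 𝓕, (Matrix.of fun i j : Fin (D + 1) =>
      (monoMat n (Ap ∪ Am) lo D (a t) ^ ((i : ℕ) + j)).trace).det ≠ 0 := by
    refine hC.ne (hC.det fun i j => ?_) ?_
    · simp only [Matrix.of_apply, Matrix.trace, Matrix.diag_apply]
      exact hC.sum _ fun s _ =>
        hC.matrixPow (B := fun t => monoMat n (Ap ∪ Am) lo D (a t)) (fun s i => hW (((i : ℕ) : ℤ) + n) s) _ _ _
    · have e : monoMat n (Ap ∪ Am) lo D (a t₀) = monoMat n (Ap ∪ Am) lo D (fun j _ => α j) := by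
        unfold monoMat
        rw [hW0]
      rw [e, ← disc_eq_monoMat (M := M₀.toLinearMap) fun i => (hM₀ i).symm]
      exact h.disc_ne_zero hA fun i => (hM₀ i).symm
  filter_upwards [ev1, ev2, ev3, ev4, ev5, hper] with t h1 h2 h3 h4 h5 hp
  have hne : ∀ j ∈ Ap ∪ Am, ∀ k, a t j k ≠ 0 := fun j hj =>
    forall_of_shift hd.n_pos (fun k => by rw [hp j hj]) (h1 j hj)
  have hs := isSol_fundSol hA hne
  obtain ⟨M, hM⟩ := hs.exists_monodromy hA hp
  have hMp := pent_shift (M := M.toLinearMap) (fun j hj => hp j (Finset.mem_union_left _ hj)) hM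
  refine ⟨hne, hp, forall_of_shift hd.n_pos (fun k => ?_) h2, fun M' hM' => ?_,
    forall_of_shift hd.n_pos (genPos_shift_of_eq hMp) h3,
    forall_of_shift hd.n_pos (window_shift hMp) h4⟩
  · exact cop_shift hA hs (c := fun _ => 1) (fun _ => one_ne_zero)
      (fun i => by rw [one_smul, hM]) k
  · rwa [disc_eq_monoMat (M := M'.toLinearMap) fun i => (hM' i).symm]

end Good

/-! ### Pentagram images of corrugated polygons -/

section Image

variable {n m : ℕ} {Ap Am : Finset ℤ} {lo hi : ℤ} {D d r : ℕ} {a : ℤ → ℤ → ℝ}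

/-- Progressions with a common difference have a sumset contained in one progression of length l +
l' - 1. This is why the pentagram image is again corrugated. -/
theorem IsArithProg.card_add_le {S S' : Finset ℤ} (hS : IsArithProg m S) (hS' : IsArithProg m S')
    (hne : S.Nonempty) (hne' : S'.Nonempty) (hm : 0 < m) :
    (Finset.image₂ (· + ·) S S').card + 1 ≤ S.card + S'.card := by
  obtain ⟨x, l, rfl⟩ := hS
  obtain ⟨x', l', rfl⟩ := hS'
  have hinj : ∀ x : ℤ, Function.Injective fun i : ℕ => x + (i : ℤ) * (m : ℤ) := by
    intro x i j hij
    have hm' : (m : ℤ) ≠ 0 := by exact_mod_cast hm.ne'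
    exact_mod_cast mul_right_cancel₀ hm' (add_left_cancel hij)
  rw [Finset.card_image_of_injective _ (hinj x), Finset.card_image_of_injective _ (hinj x'),
    Finset.card_range, Finset.card_range]
  have hl : 0 < l := by simpa [Nat.pos_iff_ne_zero] using hne
  have hl' : 0 < l' := by simpa [Nat.pos_iff_ne_zero] using hne'
  have hsub : Finset.image₂ (· + ·) ((Finset.range l).image fun i : ℕ => x + (i : ℤ) * (m : ℤ))
      ((Finset.range l').image fun i : ℕ => x' + (i : ℤ) * (m : ℤ)) ⊆
      (Finset.range (l + l' - 1)).image fun i : ℕ => x + x' + (i : ℤ) * (m : ℤ) := by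
    intro z hz
    obtain ⟨y, hy, y', hy', rfl⟩ := Finset.mem_image₂.1 hz
    obtain ⟨i, hi, rfl⟩ := Finset.mem_image.1 hy
    obtain ⟨i', hi', rfl⟩ := Finset.mem_image.1 hy'
    rw [Finset.mem_range] at hi hi'
    refine Finset.mem_image.2 ⟨i + i', Finset.mem_range.2 (by omega), ?_⟩
    push_cast
    ring
  have h1 := Finset.card_le_card hsub
  have h2 := (Finset.card_image_le (s := Finset.range (l + l' - 1))
    (f := fun i : ℕ => x + x' + (i : ℤ) * (m : ℤ)))
  rw [Finset.card_range] at h2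
  omega

/-- The points of the pentagram image with indices in `k + A` are linearly dependent. -/
theorem exists_row_pent (hm : 0 < m) (hAp : IsArithProg m Ap) (hAm : IsArithProg m Am)
    (hp : Ap.Nonempty) (hm' : Am.Nonempty) (hdisj : Disjoint Ap Am) {V : ℤ → Vec r}
    (hrel : Rel (Ap ∪ Am) a V) (k : ℤ) : ∃ x : ℤ → ℝ,
    ∑ j ∈ Ap ∪ Am, x j • pent Ap a V (k + j) = 0 ∧ ∃ j ∈ Ap ∪ Am, x j ≠ 0 := by
  -- Expanding the image vertex at k + j over `Am` when j ∈ Ap, and over `Ap` when j ∈ Am, places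
  -- all of them in the span of the V (k + i), i ∈ Ap + Am, which are fewer than |A| vectors.
  let S := Finset.image₂ (· + ·) Ap Am
  have hcard := hAp.card_add_le hAm hp hm' hm
  let f : S → Vec r := fun i => V (k + i.1)
  have hmem : ∀ i ∈ S, V (k + i) ∈ Submodule.span ℝ (Set.range f) := fun i hi =>
    Submodule.subset_span ⟨⟨i, hi⟩, rfl⟩
  refine exists_row (Submodule.span ℝ (Set.range f)) ?_ fun j hj => ?_
  · have h1 := finrank_range_le_card (R := ℝ) f
    rw [Fintype.card_coe] at h1
    rw [Finset.card_union_of_disjoint hdisj]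
    exact (Nat.lt_succ_of_le h1).trans_le hcard
  · rcases Finset.mem_union.1 hj with hj | hj
    · have e : pent Ap a V (k + j) = -∑ i ∈ Am, a i (k + j) • V (k + j + i) := by
        have := hrel (k + j)
        rw [Finset.sum_union hdisj] at this
        exact eq_neg_of_add_eq_zero_left this
      rw [e]
      refine neg_mem (sum_mem fun i hi => Submodule.smul_mem _ _ ?_)
      rw [add_assoc]
      exact hmem _ (Finset.mem_image₂_of_mem hj hi)
    · refine sum_mem fun i hi => Submodule.smul_mem _ _ ?_
      rw [add_assoc, add_comm j]
      exact hmem _ (Finset.mem_image₂_of_mem hi hj)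

/-- The polygon of a generic operator and its pentagram image. -/
theorem IsGood.exists_polygons (h : IsGood n Ap Am lo hi D a) (hd : IsData n (Ap ∪ Am) lo hi D d)
    (hm : 0 < m) (hAp : IsArithProg m Ap) (hAm : IsArithProg m Am) (hp : Ap.Nonempty)
    (hm' : Am.Nonempty) (hdisj : Disjoint Ap Am) :
    ∃ w w' : CorrugatedPolygon n (Ap ∪ Am) D, w.1 = (fun i => pt (fundSol (Ap ∪ Am) lo D a i)) ∧
      IsPentagramImage Ap Am w.1 w'.1 ∧ w.cls ∈ sepSet n (Ap ∪ Am) D ∧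
      w.cls ∈ copSet n Ap Am hi D := by
  have hA := hd.toIsSpan
  have hs := isSol_fundSol hA h.ne
  obtain ⟨M, hM⟩ := hs.exists_monodromy hA h.periodic
  have hMp := pent_shift (M := M.toLinearMap)
    (fun j hj => h.periodic j (Finset.mem_union_left _ hj)) hM
  have htw : ∀ {U : ℤ → Vec D}, (∀ i, U i ≠ 0) → (∀ i, U (i + n) = M (U i)) →
      IsTwisted n fun i => pt (U i) := fun h0 hU =>
    ⟨M, fun i => by rw [projTransf_pt _ (h0 i), ← hU]⟩
  have hne := ne_zero_of_window hs.window
  have hne' := ne_zero_of_window h.window_pent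
  have hl' := isLift_pt hne'
  refine ⟨⟨_, hs.mem_corrugated hA hs.isLift (htw hne hM)⟩, ⟨_, htw hne' hMp,
    isCorrugated_of_rel hA.hi_mem hl' h.genPos_pent
      (exists_row_pent hm hAp hAm hp hm' hdisj hs.rel),
    (inGeneralPosition_iff hl').2 h.genPos_pent, (consecutiveSpan_iff hl').2 h.window_pent⟩, rfl,
    isPentagramImage_pt hdisj hp hm' hs.isLift (hs.genPos hA) h.ne hs.rel, ?_, ?_⟩
  · exact ⟨_, rfl, _, _, hs.isLift, isMono_of_eq hM, h.disc_ne M hM⟩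
  · exact ⟨_, rfl, _, _, hs.isLift, hs, h.cop⟩

end Image

end Pentagram

namespace Pentagram

/-! ### Density of generic polygons -/

section Density

variable {n m : ℕ} {A Ap Am : Finset ℤ} {lo hi : ℤ} {D d r : ℕ} {α : ℤ → ℝ}

theorem mem_closure_generic {S : Set (GenericClass n A d)} (v₀ : GenericPolygon n A d)
    {x : ℝ → ℤ → RP d} (hx : ∀ i, ContinuousAt (fun t => x t i) 0) (hx0 : x 0 = v₀.1)
    (hS : ∀ᶠ t in 𝓝[≠] (0 : ℝ), ∃ v : GenericPolygon n A d, v.1 = x t ∧ v.cls ∈ S) :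
    v₀.cls ∈ closure S := by
  have h : v₀ ∈ closure (GenericPolygon.cls ⁻¹' S) := by
    have hind : IsInducing fun v : GenericPolygon n A d => v.1 := IsInducing.subtypeVal
    rw [hind.closure_eq_preimage_closure_image, Set.mem_preimage]
    have hc : ContinuousAt x 0 := continuousAt_pi.2 hx
    have ht : Tendsto x (𝓝[≠] 0) (𝓝 v₀.1) := hx0 ▸ hc.tendsto.mono_left nhdsWithin_le_nhds
    refine mem_closure_of_tendsto ht ?_
    filter_upwards [hS] with t ⟨v, hv, hvS⟩
    exact ⟨v, hvS, hv⟩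
  exact map_mem_closure (isOpenQuotientMap_genericCls n A d).continuous h fun _ h => h

theorem mem_closure_corrugated {S : Set (CorrugatedClass n A D)} (w₀ : CorrugatedPolygon n A D)
    {x : ℝ → ℤ → RP D} (hx : ∀ i, ContinuousAt (fun t => x t i) 0) (hx0 : x 0 = w₀.1)
    (hS : ∀ᶠ t in 𝓝[≠] (0 : ℝ), ∃ w : CorrugatedPolygon n A D, w.1 = x t ∧ w.cls ∈ S) :
    w₀.cls ∈ closure S := by
  have h : w₀ ∈ closure (CorrugatedPolygon.cls ⁻¹' S) := by
    have hind : IsInducing fun v : CorrugatedPolygon n A D => v.1 := IsInducing.subtypeVal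
    rw [hind.closure_eq_preimage_closure_image, Set.mem_preimage]
    have hc : ContinuousAt x 0 := continuousAt_pi.2 hx
    have ht : Tendsto x (𝓝[≠] 0) (𝓝 w₀.1) := hx0 ▸ hc.tendsto.mono_left nhdsWithin_le_nhds
    refine mem_closure_of_tendsto ht ?_
    filter_upwards [hS] with t ⟨v, hv, hvS⟩
    exact ⟨v, hvS, hv⟩
  exact map_mem_closure (isOpenQuotientMap_corrugatedCls n A D).continuous h fun _ h => h

theorem meromorphic_line (p q : ℝ) : Meromorphic (fun t : ℝ => p + t * (q - p)) ∧
    AnalyticAt ℝ (fun t : ℝ => p + t * (q - p)) 1 :=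
  have hC := funClass_meromorphic
  hC.add (hC.const p) (hC.mul (f := fun t => t) ⟨fun _ => MeromorphicAt.id _, analyticAt_id⟩
    (hC.const _))

/-- The coefficients move linearly from those of the given polygon at t = 0 to the constant ones of
the model at t = 1. -/
theorem dense_corrugated (hd : IsData n (Ap ∪ Am) lo hi D d) (hm : 0 < m) (hAp : IsArithProg m Ap)
    (hAm : IsArithProg m Am) (hp : Ap.Nonempty) (hm' : Am.Nonempty) (hdisj : Disjoint Ap Am)
    (hα : IsModelOp n Ap Am lo hi D d α) :
    Dense {y : CorrugatedClass n (Ap ∪ Am) D | y ∈ sepSet n (Ap ∪ Am) D ∧ y ∈ copSet n Ap Am hi D ∧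
      ∃ w w' : CorrugatedPolygon n (Ap ∪ Am) D, y = w.cls ∧ IsPentagramImage Ap Am w.1 w'.1} := by
  intro y
  obtain ⟨w₀, rfl⟩ := Quotient.exists_rep y
  have hA := hd.toIsSpan
  obtain ⟨W₀, g, hW₀, hg⟩ := exists_quasiPeriodic_lift hd.n_pos w₀.2.1
  have hsol := isSol_nrow hA.hi_mem hW₀ w₀.2.2.1 w₀.2.2.2.1 w₀.2.2.2.2
  set a₀ := nrow (Ap ∪ Am) hi W₀ with ha₀
  have hper : ∀ j k, a₀ j (k + n) = a₀ j k := nrow_periodic hA.hi_mem hg (hsol.genPos hA) hsol.rel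
  have hs := isSol_fundSol hA hsol.ne
  obtain ⟨M, hM⟩ := hs.exists_monodromy hA (n := n) fun j _ k => hper j k
  -- The fundamental solution represents the same class and varies with the coefficients.
  let w₁ : CorrugatedPolygon n (Ap ∪ Am) D := ⟨_, hs.mem_corrugated hA hs.isLift
    ((isTwisted_iff hs.isLift).2 ⟨M, fun i => ⟨1, one_ne_zero, by rw [hM, one_smul]⟩⟩)⟩
  obtain ⟨γ, hγ⟩ := hs.exists_linearEquiv hA hsol
  have hw : (Quotient.mk _ w₀ : CorrugatedClass n (Ap ∪ Am) D) = w₁.cls :=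
    (Quotient.sound ((projEquiv_iff hs.isLift hW₀).2
      ⟨γ, fun i => ⟨1, one_ne_zero, by rw [one_smul, hγ]⟩⟩) : w₁.cls = _).symm
  rw [hw]
  let a : ℝ → ℤ → ℤ → ℝ := fun t j k => a₀ j k + t * (α j - a₀ j k)
  have ha0 : a 0 = a₀ := by ext j k; simp [a]
  refine mem_closure_corrugated w₁ (x := fun t i => pt (fundSol (Ap ∪ Am) lo D (a t) i))
    (fun i => ?_) (by simp only [ha0]; rfl) ?_
  · refine continuousAt_pt_of_coord (fun s => ?_) ?_
    · refine (funClass_continuousAt (0 : ℝ)).fundSol hA (fun j _ k => ?_) (fun k => ?_)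
        (fun k => ?_) i s
      · exact (by fun_prop : Continuous fun t : ℝ => a₀ j k + t * (α j - a₀ j k)).continuousAt
      · rw [ha0]; exact hsol.ne _ hA.lo_mem k
      · rw [ha0]; exact hsol.ne _ hA.hi_mem k
    · rw [ha0]; exact ne_zero_of_window hs.window i
  · have := hα.eventually_isGood hd hdisj funClass_meromorphic (a := a)
      (fun j _ k => meromorphic_line _ _) (fun j _ k => by simp [a])
      (Eventually.of_forall fun t j _ k => by simp [a, hper])
    filter_upwards [this] with t ht
    obtain ⟨w, w', hwt, hww, h1, h2⟩ := ht.exists_polygons hd hm hAp hAm hp hm' hdisj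
    exact ⟨w, hwt, h1, h2, w, w', rfl, hww⟩

theorem FunClass.matrixZPow {T m : Type*} [Fintype m] [DecidableEq m] {C : (T → ℝ) → Prop} {t₀ : T}
    {𝓕 : Filter T} (h : FunClass C t₀ 𝓕) {B : T → Matrix m m ℝ} (hB : ∀ i j, C fun t => B t i j)
    (h0 : (B t₀).det ≠ 0) (q : ℤ) (i j : m) : C fun t => (B t ^ q) i j := by
  cases q with
  | ofNat p =>
    simp only [Int.ofNat_eq_natCast, zpow_natCast]
    exact h.matrixPow hB p i j
  | negSucc p =>
    simp only [zpow_negSucc]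
    exact h.matrixInv (h.matrixPow hB _) (by rw [Matrix.det_pow]; exact pow_ne_zero _ h0) i j

/-- The sequence with `V (i + n) = B *ᵥ V i` and given values at `0, …, n - 1`. -/
def zpowSeq (n : ℕ) (B : Matrix (Fin (r + 1)) (Fin (r + 1)) ℝ) (U : ℤ → Vec r) (i : ℤ) : Vec r :=
  (B ^ (i / n)).mulVec (U (i % n))

theorem zpowSeq_add (hn : 0 < n) {B : Matrix (Fin (r + 1)) (Fin (r + 1)) ℝ} (hB : B.det ≠ 0)
    (U : ℤ → Vec r) (i : ℤ) : zpowSeq n B U (i + n) = B.mulVec (zpowSeq n B U i) := by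
  have hn' : (n : ℤ) ≠ 0 := by exact_mod_cast hn.ne'
  rw [zpowSeq, zpowSeq, Int.add_emod_right, Int.add_ediv_of_dvd_right (dvd_refl _),
    Int.ediv_self hn', Matrix.mulVec_mulVec, add_comm _ (1 : ℤ), Matrix.zpow_one_add (isUnit_iff_ne_zero.2 hB)]

theorem zpowSeq_eq (hn : 0 < n) {B : Matrix (Fin (r + 1)) (Fin (r + 1)) ℝ} (hB : B.det ≠ 0)
    {U V : ℤ → Vec r} (hV : ∀ i, V (i + n) = B.mulVec (V i)) (hU : ∀ i : ℤ, 0 ≤ i → i < n → U i = V i) :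
    zpowSeq n B U = V := by
  have hinj : Function.Injective B.mulVec := Matrix.mulVec_injective_iff_isUnit.2
    ((Matrix.isUnit_iff_isUnit_det _).2 (isUnit_iff_ne_zero.2 hB))
  ext1 i
  refine forall_of_shift hn (Q := fun i => zpowSeq n B U i = V i) (fun k => ?_) (fun k hk => ?_) i
  · rw [zpowSeq_add hn hB, hV]
    exact hinj.eq_iff
  · rw [Finset.mem_Ico] at hk
    rw [zpowSeq, Int.ediv_eq_zero_of_lt hk.1 hk.2, zpow_zero, Matrix.one_mulVec,
      Int.emod_eq_of_lt hk.1 hk.2, hU k hk.1 hk.2]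

theorem FunClass.zpowSeq {T : Type*} {C : (T → ℝ) → Prop} {t₀ : T} {𝓕 : Filter T}
    (h : FunClass C t₀ 𝓕) {B : T → Matrix (Fin (r + 1)) (Fin (r + 1)) ℝ}
    (hB : ∀ i j, C fun t => B t i j) (h0 : (B t₀).det ≠ 0) {U : T → ℤ → Vec r}
    (hU : ∀ i s, C fun t => U t i s) (i : ℤ) (s : Fin (r + 1)) :
    C fun t => Pentagram.zpowSeq n (B t) (U t) i s :=
  h.mulVec (h.matrixZPow hB h0 _) (hU _) s

/-- A quasi-periodic sequence in general position represents a generic polygon. -/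
theorem exists_genericPolygon (hd : IsData n A lo hi D d) {V : ℤ → Vec d}
    (hg : ∀ k, GenPos A V k) {g : Vec d ≃ₗ[ℝ] Vec d} (hV : ∀ i, V (i + n) = g (V i)) :
    ∃ v : GenericPolygon n A d, v.1 = (fun i => pt (V i)) ∧ IsLift V v.1 := by
  have hne : ∀ i, V i ≠ 0 := by
    intro i
    have h2 : 1 < A.card := by rw [hd.card]; omega
    obtain ⟨j, hj, hjne⟩ := Finset.exists_mem_ne h2 hi
    have := (hg (i - hi) j hj).ne_zero ⟨hi, Finset.mem_erase.2 ⟨hjne.symm, hd.hi_mem⟩⟩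
    simpa using this
  have hl := isLift_pt hne
  exact ⟨⟨_, (isTwisted_iff hl).2 ⟨g, fun i => ⟨1, one_ne_zero, by rw [one_smul, hV]⟩⟩,
    (inGeneralPosition_iff hl).2 hg⟩, rfl, hl⟩

theorem IsModelOp.nonempty (hα : IsModelOp n Ap Am lo hi D d α)
    (hd : IsData n (Ap ∪ Am) lo hi D d) (hdisj : Disjoint Ap Am) :
    Nonempty (GenericClass n (Ap ∪ Am) d) := by
  obtain ⟨x, hx, hg, -⟩ := hα.exists_generic hd.toIsSpan hdisj hd.card
  obtain ⟨v, -⟩ := exists_genericPolygon hd hg (g := LinearEquiv.piCongrRight fun s =>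
    LinearEquiv.smulOfNeZero ℝ ℝ (x s ^ n) (pow_pos (hx s) n).ne') fun i => by
      ext s
      simp [zpow_add₀ (hx s).ne', mul_comm]
  exact ⟨v.cls⟩

/-- Here the path is taken among lifts: the vertices over one period and the monodromy matrix move
linearly to those of the model, and the operator is recomputed from the lift. -/
theorem dense_generic (hd : IsData n (Ap ∪ Am) lo hi D d) (hm : 0 < m) (hAp : IsArithProg m Ap)
    (hAm : IsArithProg m Am) (hp : Ap.Nonempty) (hm' : Am.Nonempty) (hdisj : Disjoint Ap Am)
    (hα : IsModelOp n Ap Am lo hi D d α) :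
    Dense {y : GenericClass n (Ap ∪ Am) d | corrugation hd y ∈ sepSet n (Ap ∪ Am) D ∧
      corrugation hd y ∈ copSet n Ap Am hi D ∧
      ∃ (v v' : GenericPolygon n (Ap ∪ Am) d) (w w' : CorrugatedPolygon n (Ap ∪ Am) D),
        y = v.cls ∧ corrugation hd y = w.cls ∧ IsPentagramImage Ap Am v.1 v'.1 ∧
        IsPentagramImage Ap Am w.1 w'.1} := by
  intro y
  obtain ⟨v₀, rfl⟩ := Quotient.exists_rep y
  have hA := hd.toIsSpan
  have hn := hd.n_pos
  obtain ⟨V₀, g, hV₀, hg⟩ := exists_quasiPeriodic_lift hn v₀.2.1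
  obtain ⟨x, hx, hgx, hrx, hpx⟩ := hα.exists_generic hA hdisj hd.card
  let B₀ := LinearMap.toMatrix' g.toLinearMap
  let B₁ : Matrix (Fin (d + 1)) (Fin (d + 1)) ℝ := Matrix.diagonal fun s => x s ^ n
  let B : ℝ → Matrix (Fin (d + 1)) (Fin (d + 1)) ℝ := fun t =>
    Matrix.of fun s i => B₀ s i + t * (B₁ s i - B₀ s i)
  let U : ℝ → ℤ → Vec d := fun t i s => V₀ i s + t * (x s ^ i - V₀ i s)
  -- `U t` is not quasi-periodic for general t, so only one period of it is kept and continued by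
  -- powers of `B t`.
  let V : ℝ → ℤ → Vec d := fun t => zpowSeq n (B t) (U t)
  have hB0 : B 0 = B₀ := by ext; simp [B]
  have hB1 : B 1 = B₁ := by ext; simp [B]
  have hdet0 : (B 0).det ≠ 0 := by
    rw [hB0, LinearMap.det_toMatrix']
    exact g.isUnit_det'.ne_zero
  have hdet1 : (B 1).det ≠ 0 := by
    rw [hB1, Matrix.det_diagonal]
    exact Finset.prod_ne_zero_iff.2 fun s _ => (pow_pos (hx s) n).ne'
  have hV0 : V 0 = V₀ := zpowSeq_eq hn hdet0 (fun i => by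
    rw [hB0, LinearMap.toMatrix'_mulVec, hg]; rfl) fun i _ _ => by ext; simp [U]
  have hV1 : V 1 = fun i s => x s ^ i := zpowSeq_eq hn hdet1 (fun i => by
    ext s
    rw [hB1, Matrix.mulVec_diagonal, zpow_add₀ (hx s).ne', mul_comm, zpow_natCast])
    fun i _ _ => by ext; simp [U]
  have hcV : ∀ i s, ContinuousAt (fun t => V t i s) 0 :=
    (funClass_continuousAt (0 : ℝ)).zpowSeq
      (fun i j => (by fun_prop : Continuous fun t : ℝ => B₀ i j + t * (B₁ i j - B₀ i j)).continuousAt)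
      hdet0 (fun i s =>
        (by fun_prop : Continuous fun t : ℝ => V₀ i s + t * (x s ^ i - V₀ i s)).continuousAt)
  have hC := funClass_meromorphic
  have hmB : ∀ i j, _ := fun i j => meromorphic_line (B₀ i j) (B₁ i j)
  have hmV : ∀ i s, Meromorphic (fun t => V t i s) ∧ AnalyticAt ℝ (fun t => V t i s) 1 :=
    hC.zpowSeq hmB hdet1 fun i s => meromorphic_line _ _
  have hgV1 : ∀ k, GenPos (Ap ∪ Am) (V 1) k := by rw [hV1]; exact hgx
  have hmrow := fun j k => hC.nrow hmV hA.hi_mem (hgV1 k) j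
  have hrow1 : ∀ j ∈ Ap ∪ Am, ∀ k, nrow (Ap ∪ Am) hi (V 1) j k = α j := fun j hj k =>
    nrow_eq hA.hi_mem (hgV1 k) (by rw [hV1]; exact hrx k) hα.eq_hi j hj
  have hsub : ∀ j ∈ Ap, ∀ k, nrow (Ap ∪ Am) hi (V 1) j k = α j := fun j hj =>
    hrow1 j (Finset.mem_union_left _ hj)
  have ev1 := hC.ne (hC.det hmB) hdet1
  have ev2 : ∀ᶠ t in 𝓝[≠] (0 : ℝ), ∀ k ∈ Finset.Ico (0 : ℤ) n, GenPos (Ap ∪ Am) (V t) k := by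
    simp only [Finset.eventually_all]
    exact fun k _ => hC.eventually_genPos hmV (hgV1 k)
  have ev3 : ∀ᶠ t in 𝓝[≠] (0 : ℝ), ∀ k ∈ Finset.Ico (0 : ℤ) n,
      GenPos (Ap ∪ Am) (pent Ap (nrow (Ap ∪ Am) hi (V t)) (V t)) k := by
    simp only [Finset.eventually_all]
    refine fun k _ => hC.eventually_genPos (hC.pent (fun j _ k => hmrow j k) hmV) ?_
    rw [pent_congr hsub, hV1]
    exact hpx k
  have key : ∀ t, (B t).det ≠ 0 → ∃ g : Vec d ≃ₗ[ℝ] Vec d, ∀ i, V t (i + n) = g (V t i) := by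
    intro t ht
    exact ⟨Matrix.toLinearEquiv' (B t) (Matrix.invertibleOfIsUnitDet _ (isUnit_iff_ne_zero.2 ht)),
      fun i => zpowSeq_add hn ht _ i⟩
  have ev4 : ∀ᶠ t in 𝓝[≠] (0 : ℝ), ∃ g : Vec d ≃ₗ[ℝ] Vec d, (∀ i, V t (i + n) = g (V t i)) ∧
      (∀ k, GenPos (Ap ∪ Am) (V t) k) ∧ ∀ j k,
        nrow (Ap ∪ Am) hi (V t) j (k + n) = nrow (Ap ∪ Am) hi (V t) j k := by
    filter_upwards [ev1, ev2] with t h1 h2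
    obtain ⟨g, hg⟩ := key t h1
    have hgen := forall_of_shift hn (genPos_shift_of_eq hg) h2
    exact ⟨g, hg, hgen, nrow_periodic hA.hi_mem hg hgen (rel_nrow_of_card hd.card hd.hi_mem hgen).1⟩
  have ev5 := hα.eventually_isGood hd hdisj hC (a := fun t => nrow (Ap ∪ Am) hi (V t))
    (fun j _ k => hmrow j k) hrow1 (by
      filter_upwards [ev4] with t ⟨_, _, _, h⟩ j _ k
      exact h j k)
  refine mem_closure_generic v₀ (x := fun t i => pt (V t i)) (fun i => ?_)
    (by ext1 i; simp only [hV0]; exact (hV₀ i).2) ?_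
  · exact continuousAt_pt_of_coord (hcV i) (by rw [hV0]; exact (hV₀ i).1)
  · filter_upwards [ev3, ev4, ev5] with t h3 ⟨g, hg, hgen, hper⟩ h5
    obtain ⟨v, hv, hl⟩ := exists_genericPolygon hd hgen hg
    have hP := pent_shift (a := nrow (Ap ∪ Am) hi (V t)) (Ap := Ap) (M := g.toLinearMap)
      (fun j _ k => hper j k) hg
    obtain ⟨v', hv', -⟩ := exists_genericPolygon hd
      (forall_of_shift hn (genPos_shift_of_eq (M := g) hP) h3) hP
    obtain ⟨w, w', hw, hww, h1, h2⟩ := h5.exists_polygons hd hm hAp hAm hp hm' hdisj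
    have hvw : corrugation hd v.cls = w.cls := (corrugation_eq_iff hd v w).2
      (hw ▸ (fundSol_projection hd hl v.2.2).2)
    obtain ⟨hrel, hne⟩ := rel_nrow_of_card hd.card hd.hi_mem hgen
    refine ⟨v, hv, hvw ▸ h1, hvw ▸ h2, v, v', w, w', rfl, hvw, ?_, hww⟩
    rw [hv']
    exact isPentagramImage_pt hdisj hp hm' hl hgen hne hrel

end Density

end Pentagram

end

theorem mainTheorem6 (m n d D : ℕ) (Ap Am : Finset ℤ) (lo hi : ℤ)
    (hm : 0 < m) (hn : 0 < n)
    (hAp : Pentagram.IsArithProg m Ap) (hAm : Pentagram.IsArithProg m Am)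
    (hAp2 : 2 ≤ Ap.card) (hAm2 : 2 ≤ Am.card) (hdisj : Disjoint Ap Am)
    (hd : Ap.card + Am.card = d + 2)
    (hlo : IsLeast (↑(Ap ∪ Am) : Set ℤ) lo) (hhi : IsGreatest (↑(Ap ∪ Am) : Set ℤ) hi)
    (hD : (D : ℤ) = hi - lo - 1)
    (hcop : ∀ c : ℕ, c ∣ n → (∀ i ∈ Ap ∪ Am, ∀ j ∈ Ap ∪ Am, (c : ℤ) ∣ i - j) → c = 1) :
    Nonempty (Pentagram.GenericClass n (Ap ∪ Am) d) ∧
    ∃ (F : Pentagram.GenericClass n (Ap ∪ Am) d → Pentagram.CorrugatedClass n (Ap ∪ Am) D)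
      (O : Set (Pentagram.CorrugatedClass n (Ap ∪ Am) D)),
      Pentagram.IsFiniteRamifiedCovering F O ∧
      (∀ (v : Pentagram.GenericPolygon n (Ap ∪ Am) d)
        (w : Pentagram.CorrugatedPolygon n (Ap ∪ Am) D),
        F v.cls = w.cls ↔ Pentagram.IsProjectionOf w.1 v.1) ∧
      (∀ (v : Pentagram.GenericPolygon n (Ap ∪ Am) d)
        (w : Pentagram.CorrugatedPolygon n (Ap ∪ Am) D),
        F v.cls = w.cls → Pentagram.SameLax n Ap Am v.1 w.1) ∧
      (∀ (v : Pentagram.GenericPolygon n (Ap ∪ Am) d)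
        (w : Pentagram.CorrugatedPolygon n (Ap ∪ Am) D),
        w.cls ∈ O → Pentagram.SameLax n Ap Am v.1 w.1 → F v.cls = w.cls) ∧
      (∀ (v v' : Pentagram.GenericPolygon n (Ap ∪ Am) d)
        (w w' : Pentagram.CorrugatedPolygon n (Ap ∪ Am) D),
        Pentagram.IsPentagramImage Ap Am v.1 v'.1 → Pentagram.IsPentagramImage Ap Am w.1 w'.1 →
        F v.cls = w.cls → F v'.cls = w'.cls) ∧
      Dense {x : Pentagram.GenericClass n (Ap ∪ Am) d |
        ∃ (v v' : Pentagram.GenericPolygon n (Ap ∪ Am) d)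
          (w w' : Pentagram.CorrugatedPolygon n (Ap ∪ Am) D),
          x = v.cls ∧ F x = w.cls ∧
          Pentagram.IsPentagramImage Ap Am v.1 v'.1 ∧
          Pentagram.IsPentagramImage Ap Am w.1 w'.1} ∧
      Dense {y : Pentagram.CorrugatedClass n (Ap ∪ Am) D |
        ∃ w w' : Pentagram.CorrugatedPolygon n (Ap ∪ Am) D,
          y = w.cls ∧ Pentagram.IsPentagramImage Ap Am w.1 w'.1} := by
  have hp : Ap.Nonempty := Finset.card_pos.1 (by omega)
  have hm' : Am.Nonempty := Finset.card_pos.1 (by omega)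
  have h : Pentagram.IsData n (Ap ∪ Am) lo hi D d :=
    { lo_mem := hlo.1
      hi_mem := hhi.1
      lo_le := fun j hj => hlo.2 hj
      le_hi := fun j hj => hhi.2 hj
      hi_eq := by omega
      card := by rw [Finset.card_union_of_disjoint hdisj, hd]
      n_pos := hn }
  obtain ⟨i, hi', j, hj, hij⟩ := Finset.one_lt_card.1 (show 1 < Ap.card by omega)
  obtain ⟨G, hG⟩ := Pentagram.exists_period ⟨i, Finset.mem_union_left _ hi', j,
    Finset.mem_union_left _ hj, hij⟩ hcop
  obtain ⟨α, hα⟩ := Pentagram.exists_isModelOp h hdisj hp hm' hcop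
  have hX := Pentagram.dense_generic h hm hAp hAm hp hm' hdisj hα
  have hY := Pentagram.dense_corrugated h hm hAp hAm hp hm' hdisj hα
  have := Pentagram.t2Space_genericClass h
  -- Nonzero discriminant gives openness of F and finite fibers; the coprime locus is intersected
  -- with it so that the Lax operator determines F over O.
  obtain ⟨O, hO, hF⟩ := Pentagram.exists_isFiniteRamifiedCovering
    (Pentagram.continuous_corrugation h)
    ((Pentagram.isOpen_sepSet hG h.toIsSpan).inter (Pentagram.isOpen_copSet h.toIsSpan hn))
    (hY.mono fun y hy => ⟨hy.1, hy.2.1⟩) (hX.mono fun x hx => ⟨hx.1, hx.2.1⟩)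
    (fun x hx => Pentagram.nhds_le_map_corrugation hG h x hx.1)
    (fun y hy => Pentagram.encard_fiber_le hG h hy.1)
  refine ⟨hα.nonempty h hdisj, Pentagram.corrugation h, O, hF, Pentagram.corrugation_eq_iff h,
    fun v w hvw => Pentagram.sameLax_of_corrugation h hm' hvw,
    fun v w hw hvw => Pentagram.corrugation_of_sameLax h (hO hw).2 hvw,
    fun v v' w w' hv hw hvw => ?_, hX.mono fun x hx => hx.2.2, hY.mono fun y hy => hy.2.2⟩
  rw [Pentagram.corrugation_eq_iff] at hvw ⊢
  exact hvw.pentagramImage hdisj hp h.hi_mem w.2.2.1 v.2.2 hv hw
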